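/- Let $\mathfrak A^{CAR}$ be the CAR algebra over $\mathbb Z$, i.e. the unital $C^*$-algebra generated by $c_j$ ($j\in\mathbb Z$) with $\{c_j,c_k\}=0$ and $\{c_j,c_k^*\}=\delta_{jk}1$. Let $\Theta$ be its parity automorphism, $\Theta(c_j)=-c_j$ for all $j$, let $\Theta_-$ be the automorphism with $\Theta_-(c_j)=-c_j$ for $j\le 0$ and $\Theta_-(c_j)=c_j$ for $j>0$, and let $\tau_j$ be the translation, $\tau_j(c_k)=c_{k+j}$. Let $\tilde{\mathfrak A}$ be the crossed product of $\mathfrak A^{CAR}$ by the $\mathbb Z_2$-action $\Theta_-$, i.e. the $C^*$-algebra generated by $\mathfrak A^{CAR}$ and a unitary $T=T^*$, $T^2=1$, $TQT=\Theta_-(Q)$, and extend $\Theta$ to it by $\Theta(T)=T$. Let $\mathfrak A\subset\tilde{\mathfrak A}$ be the algebra of the spin-$\tfrac12$ chain, that is, the $C^*$-subalgebra generated by $$\sigma_z^{(j)}=2c_j^*c_j-1,\qquad \sigma_x^{(j)}=TS_j(c_j+c_j^*),\qquad \sigma_y^{(j)}=iTS_j(c_j-c_j^*)\qquad(j\in\mathbb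 Z),$$ where $S_n=\sigma_z^{(1)}\cdots\sigma_z^{(n-1)}$ for $n>1$, $S_1=1$, and $S_n=\sigma_z^{(0)}\sigma_z^{(-1)}\cdots\sigma_z^{(n)}$ for $n<1$. The translation $\tau_j$ of $\mathfrak A$ is the automorphism with $\tau_j(\sigma_a^{(k)})=\sigma_a^{(k+j)}$ for $a=x,y,z$. For $\Lambda\subset\mathbb Z$ let $\mathfrak A_\Lambda$ be the $C^*$-subalgebra of $\mathfrak A$ generated by the $\sigma_a^{(j)}$ with $j\in\Lambda$, and put $\mathfrak A_L=\mathfrak A_{(-\infty,0]}$ and $\mathfrak A_R=\mathfrak A_{[1,\infty)}$. A subscript $+$ on an algebra denotes its $\Theta$-fixed part; one has $(\mathfrak A)_+=(\mathfrak A^{CAR})_+$. For a state $\varphi$ let $(\pi_\varphi,\Omega_\varphi,\mathfrak H_\varphi)$ be its GNS triple. States are called unitarily equivalent if their GNS representations are; a double prime denotes the bicommutant; a state is translationally invariant if it is invariant under all $\tau_j$. Let $\psi$ be a $\Theta$-invariant pure state of $\mathfrak A^{CAR}$ and let $\psi_+$ be its restriction to $(\mathfrak A^{CAR})_+$. (i)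 Suppose that $\psi$ and $\psi\circ\Theta_-$ are not unitarily equivalent. Then $\psi_+$ has a unique extension to a $\Theta$-invariant state $\varphi$ of $\mathfrak A$, and $\varphi$ is pure. If $\psi$ is translationally invariant, so is $\varphi$. (ii) Suppose that $\psi$ and $\psi\circ\Theta_-$ are unitarily equivalent and that $\psi_+$ and $\psi_+\circ\Theta_-$ are unitarily equivalent as states of $(\mathfrak A^{CAR})_+$. Then $\psi_+$ has a unique extension to a $\Theta$-invariant state $\varphi$ of $\mathfrak A$, and $\varphi$ is pure. If $\psi$ is translationally invariant, so is $\varphi$. (iii) Suppose that $\psi$ and $\psi\circ\Theta_-$ are unitarily equivalent and that $\psi_+$ and $\psi_+\circ\Theta_-$ are not unitarily equivalent as states of $(\mathfrak A^{CAR})_+$. Then there is a pure state $\varphi$ of $\mathfrak A$ that extends $\psi_+$, is not $\Theta$-invariant, and has the following properties. There is a unitary $U:\mathfrak H_{\psi_+}\to\mathfrak H_\varphi$ with $U\Omega_{\psi_+}=\Omega_\varphi$ and $U\pi_{\psi_+}(Q)=\pi_\varphi(Q)U$ for all $Q\in(\mathfrak A^{CAR})_+$, and $$\pi_\varphi(\mathfrak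 A)''=\pi_\varphi((\mathfrak A)_+)''.$$ If $\psi$ is translationally invariant, then moreover $\varphi\circ\tau_2=\varphi$ and $$\pi_\varphi(\mathfrak A_L)''=\pi_\varphi((\mathfrak A_L)_+)'',\qquad \pi_\varphi(\mathfrak A_R)''=\pi_\varphi((\mathfrak A_R)_+)''.$$ -/

import Mathlib

open scoped ComplexOrder InnerProductSpace lp
noncomputable section

instance closedStarSubalgebra_starOrderedRing {A : Type*} [CStarAlgebra A] [PartialOrder A]
    [StarOrderedRing A] (S : StarSubalgebra ℂ A) [IsClosed (S : Set A)] : StarOrderedRing S := by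
  refine StarOrderedRing.of_nonneg_iff' (fun {x y} h z => ?_) (fun x => ⟨fun hx => ?_, ?_⟩)
  · have h' : (x : A) ≤ y := h
    exact add_le_add_right h' (z : A)
  · have hx' : (0 : A) ≤ (x : A) := hx
    have hsa : IsSelfAdjoint x := Subtype.ext (IsSelfAdjoint.of_nonneg hx')
    have hsp : QuasispectrumRestricts x ContinuousMap.realToNNReal := by
      rw [quasispectrumRestricts_iff_spectrumRestricts, SpectrumRestricts.nnreal_iff]
      intro r hr
      have h1 : (algebraMap ℝ ℂ r) ∈ spectrum ℂ x := (spectrum.algebraMap_mem_iff ℂ).2 hr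
      rw [StarSubalgebra.spectrum_eq] at h1
      exact spectrum_nonneg_of_nonneg hx' ((spectrum.algebraMap_mem_iff ℂ).1 h1)
    obtain ⟨s, hs₁, _, hs₂⟩ :=
      CFC.exists_sqrt_of_isSelfAdjoint_of_quasispectrumRestricts hsa hsp
    exact ⟨s, by rw [hs₁.star_eq, hs₂]⟩
  · rintro ⟨s, rfl⟩
    exact star_mul_self_nonneg (s : A)

theorem weighted_summable {ι : Type*} (f : ι ≃ ι) (v : ℓ²(ι, ℂ)) :
    Summable fun i => ‖v (f i)‖ ^ (2 : ENNReal).toReal :=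
  (f.summable_iff (f := fun i => ‖v i‖ ^ (2 : ENNReal).toReal)).2
    ((memℓp_gen_iff (by simp)).1 (lp.memℓp v))

theorem weighted_le {ι : Type*} (f : ι ≃ ι) (w : ι → ℂ) (hw : ∀ i, ‖w i‖ ≤ 1) (v : ℓ²(ι, ℂ))
    (i : ι) : ‖w i * v (f i)‖ ^ (2 : ENNReal).toReal ≤ ‖v (f i)‖ ^ (2 : ENNReal).toReal := by
  rw [norm_mul]
  exact Real.rpow_le_rpow (by positivity)
    (mul_le_of_le_one_left (norm_nonneg _) (hw i)) (by simp)

theorem weighted_mem {ι : Type*} (f : ι ≃ ι) (w : ι → ℂ) (hw : ∀ i, ‖w i‖ ≤ 1) (v : ℓ²(ι, ℂ)) :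
    Memℓp (E := fun _ : ι => ℂ) (fun i => w i * v (f i)) 2 :=
  (memℓp_gen_iff (by simp)).2
    ((weighted_summable f v).of_nonneg_of_le (fun i => by positivity) (weighted_le f w hw v))

theorem weighted_norm_le {ι : Type*} (f : ι ≃ ι) (w : ι → ℂ) (hw : ∀ i, ‖w i‖ ≤ 1)
    (v : ℓ²(ι, ℂ)) : ‖(⟨_, weighted_mem f w hw v⟩ : ℓ²(ι, ℂ))‖ ≤ 1 * ‖v‖ := by
  rw [one_mul]
  have h := lp.norm_rpow_eq_tsum (p := 2) (by simp) (⟨_, weighted_mem f w hw v⟩ : ℓ²(ι, ℂ))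
  have h' := lp.norm_rpow_eq_tsum (p := 2) (by simp) v
  refine (Real.rpow_le_rpow_iff (z := (2 : ENNReal).toReal)
    (norm_nonneg _) (norm_nonneg _) (by simp)).1 ?_
  refine h.trans_le (le_trans ?_ h'.ge)
  rw [← f.tsum_eq (fun i => ‖v i‖ ^ (2 : ENNReal).toReal)]
  exact ((weighted_summable f v).of_nonneg_of_le (fun i => by positivity)
    (weighted_le f w hw v)).tsum_le_tsum (weighted_le f w hw v) (weighted_summable f v)

/-- The weighted permutation operator on `ℓ²(ι)`: `(weightedPerm f w v) i = w i * v (f i)`. -/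
def weightedPerm {ι : Type*} (f : ι ≃ ι) (w : ι → ℂ) (hw : ∀ i, ‖w i‖ ≤ 1) :
    ℓ²(ι, ℂ) →L[ℂ] ℓ²(ι, ℂ) :=
  LinearMap.mkContinuous
    { toFun := fun v => ⟨fun i => w i * v (f i), weighted_mem f w hw v⟩
      map_add' := fun u v => lp.ext (funext fun i => mul_add (w i) (u (f i)) (v (f i)))
      map_smul' := fun a v => lp.ext (funext fun i => mul_left_comm (w i) a (v (f i))) } 1
    (weighted_norm_le f w hw)

section

variable {ι : Type*} (f : ι ≃ ι) (w : ι → ℂ) (hw : ∀ i, ‖w i‖ ≤ 1)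

theorem weightedPerm_apply (v : ℓ²(ι, ℂ)) (i : ι) :
    weightedPerm f w hw v i = w i * v (f i) := rfl

theorem star_weightedPerm_apply (v : ℓ²(ι, ℂ)) (i : ι) :
    star (weightedPerm f w hw) v i = star (w (f.symm i)) * v (f.symm i) := by
  have hw' : ∀ i, ‖star (w (f.symm i))‖ ≤ 1 := fun i => by rw [norm_star]; exact hw _
  have h : weightedPerm f.symm (fun i => star (w (f.symm i))) hw' = star (weightedPerm f w hw) := by
    rw [ContinuousLinearMap.star_eq_adjoint, ContinuousLinearMap.eq_adjoint_iff]
    intro x y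
    refine (lp.hasSum_inner _ _).unique ?_
    have := (f.symm.hasSum_iff (f := fun i => ⟪x i, weightedPerm f w hw y i⟫_ℂ)).2
      (lp.hasSum_inner x (weightedPerm f w hw y))
    refine (congrArg (fun F => HasSum F _) (funext fun i => ?_)).mp this
    simp [weightedPerm_apply, RCLike.inner_apply]
    ring
  rw [← h, weightedPerm_apply]
end

/-! States, purity, GNS representations -/

section States

variable {A : Type*} [CStarAlgebra A] [PartialOrder A] [StarOrderedRing A]
variable {B : Type*} [CStarAlgebra B] [PartialOrder B] [StarOrderedRing B]

/-- A state is a normalized positive linear functional. -/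
def IsState (φ : A →ₚ[ℂ] ℂ) : Prop := φ 1 = 1

/-- A pure state is an extreme point of the convex set of all states. -/
def IsPureState (φ : A →ₚ[ℂ] ℂ) : Prop :=
  φ.toLinearMap ∈
    Set.extremePoints ℝ {f : A →ₗ[ℂ] ℂ | ∃ ω : A →ₚ[ℂ] ℂ, IsState ω ∧ ω.toLinearMap = f}

/-- The functional `φ ∘ α` for a unital `*`-homomorphism `α`. -/
def pullback (φ : B →ₚ[ℂ] ℂ) (α : A →⋆ₐ[ℂ] B) : A →ₚ[ℂ] ℂ := φ.comp (.ofClass α)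

/-- The canonical cyclic vector of the GNS representation of `φ`. -/
def gnsVector (φ : A →ₚ[ℂ] ℂ) : φ.GNS := ((φ.toPreGNS 1 : φ.PreGNS) : φ.GNS)

/-- Two states are unitarily equivalent if their GNS representations are. -/
def UnitarilyEquivalent (φ ω : A →ₚ[ℂ] ℂ) : Prop :=
  ∃ U : φ.GNS ≃ₗᵢ[ℂ] ω.GNS, ∀ (a : A) (ξ : φ.GNS),
    U (φ.gnsStarAlgHom a ξ) = ω.gnsStarAlgHom a (U ξ)

/-- The von Neumann algebra `π_φ(M)''` on the GNS space of `φ` (as a set of operators). -/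
def gnsBicommutant (φ : A →ₚ[ℂ] ℂ) (M : Set A) : Set (φ.GNS →L[ℂ] φ.GNS) :=
  (φ.gnsStarAlgHom '' M).centralizer.centralizer

end States

/-- A weighted permutation operator with weights of modulus one is unitary. -/
def weightedUnitary {ι : Type*} (f : ι ≃ ι) (w : ι → ℂ) (hw : ∀ i, ‖w i‖ = 1) :
    unitary (ℓ²(ι, ℂ) →L[ℂ] ℓ²(ι, ℂ)) :=
  ⟨weightedPerm f w (fun i => (hw i).le), by
    have hc : ∀ i, (starRingEnd ℂ) (w i) * w i = 1 := fun i => by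
      rw [mul_comm, Complex.mul_conj, Complex.normSq_eq_norm_sq, hw]; simp
    rw [Unitary.mem_iff]
    constructor
    · ext v i
      rw [mul_apply_eq_comp, star_weightedPerm_apply, weightedPerm_apply, ← mul_assoc]
      simp [hc]
    · ext v i
      rw [mul_apply_eq_comp, weightedPerm_apply, star_weightedPerm_apply, ← mul_assoc,
        mul_comm (w i)]
      simp [hc]⟩

namespace JordanWigner

/-- A basis configuration: a finite set of occupied sites, and one of two copies of Fock space. -/
abbrev Config : Type := Finset ℤ × Bool
/-- Two copies of the fermionic Fock space over `ℤ`, `ℓ²(finite subsets of ℤ) ⊗ ℂ²`. -/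
abbrev Space : Type := ℓ²(Config, ℂ)
/-- The algebra of bounded operators on `Space`. -/
def Op : Type := Space →L[ℂ] Space

instance : CStarAlgebra Op := inferInstanceAs (CStarAlgebra (Space →L[ℂ] Space))
instance : PartialOrder Op := inferInstanceAs (PartialOrder (Space →L[ℂ] Space))
instance : StarOrderedRing Op := inferInstanceAs (StarOrderedRing (Space →L[ℂ] Space))
instance : FunLike Op Space Space := inferInstanceAs (FunLike (Space →L[ℂ] Space) Space Space)

namespace Op
theorem ext {a b : Op} (h : ∀ (v : Space) (p : Config), a v p = b v p) : a = b :=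
  ContinuousLinearMap.ext (M₁ := Space) (M₂ := Space) (σ₁₂ := RingHom.id ℂ)
    fun v => lp.ext (funext (h v))
theorem mul_apply (a b : Op) (v : Space) : (a * b) v = a (b v) := rfl
@[simp]
theorem one_apply (v : Space) : (1 : Op) v = v := rfl
@[simp]
theorem zero_apply (v : Space) (p : Config) : (0 : Op) v p = 0 := rfl
theorem add_apply (a b : Op) (v : Space) (p : Config) : (a + b) v p = a v p + b v p := rfl
theorem sub_apply (a b : Op) (v : Space) (p : Config) : (a - b) v p = a v p - b v p := rfl
theorem neg_apply (a : Op) (v : Space) (p : Config) : (-a) v p = -(a v p) := rfl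
theorem smul_apply (r : ℂ) (a : Op) (v : Space) (p : Config) : (r • a) v p = r * a v p := rfl
end Op

/-- Change the occupation of the site `j`. -/
def toggle (j : ℤ) : Config ≃ Config where
  toFun p := (symmDiff p.1 {j}, p.2)
  invFun p := (symmDiff p.1 {j}, p.2)
  left_inv p := by simp
  right_inv p := by simp

/-- Move all occupied sites by `-1`. -/
def shift : Config ≃ Config :=
  (Equiv.finsetCongr (Equiv.subRight (1 : ℤ))).prodCongr (Equiv.refl Bool)

/-- Exchange the two copies of Fock space. -/
def boolFlip : Config ≃ Config := (Equiv.refl _).prodCongr Equiv.boolNot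

/-- The annihilation operator `c_j` of the Fock representation, acting identically on both copies:
`(c_j v)(F) = (-1)^#{i ∈ F, i < j} v(F ∪ {j})` if `j ∉ F`, and `0` otherwise. -/
def c (j : ℤ) : Op :=
  weightedPerm (toggle j)
    (fun p => if j ∈ p.1 then 0 else (-1) ^ (p.1.filter (· < j)).card)
    (fun p => by split_ifs <;> simp)

/-- The unitary `(-1)^N` on both copies; it implements the parity `Θ`. -/
def parityOp : unitary Op :=
  weightedUnitary (Equiv.refl _) (fun p => (-1) ^ p.1.card) (fun p => by simp)

/-- The selfadjoint unitary `T = (-1)^{N_{(-∞,0]}} ⊗ (exchange of the copies)`. Its conjugation action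
on the CAR algebra is `Θ_-`. As `a + b T = 0` with `a`, `b` in the CAR algebra (which acts identically
on both copies) forces `a = b = 0`, the `C*`-algebra generated by the CAR algebra and `T` is the
crossed product of the CAR algebra by the `ℤ₂`-action `Θ_-`. -/
def T : unitary Op :=
  weightedUnitary boolFlip (fun p => (-1) ^ (p.1.filter (· ≤ 0)).card) (fun p => by simp)

/-- The unitary that shifts the occupied sites by `1`, with a sign `-1` on the second copy. Its
conjugation action maps `c_j` to `c_{j+1}` and `T` to `T σ_z^{(1)}`, hence `σ_a^{(j)}` to
`σ_a^{(j+1)}` for `a = x, y, z`. -/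
def shiftOp : unitary Op :=
  weightedUnitary shift (fun p => if p.2 then -1 else 1) (fun p => by split_ifs <;> simp)

/-- `σ_z^{(j)} = 2 c_j^* c_j - 1`. -/
def σz (j : ℤ) : Op := (2 : ℂ) • (star (c j) * c j) - 1

theorem neg_one_pow_mul_self (n : ℕ) : ((-1 : ℂ) ^ n) * (-1) ^ n = 1 := by
  rw [← pow_add, Even.neg_one_pow (by simp)]

theorem c_apply (j : ℤ) (v : Space) (p : Config) : c j v p =
    (if j ∈ p.1 then 0 else (-1) ^ (p.1.filter (· < j)).card) * v (symmDiff p.1 {j}, p.2) := rfl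

theorem star_c_apply (j : ℤ) (v : Space) (p : Config) : star (c j) v p =
    (if j ∈ p.1 then (-1) ^ (p.1.filter (· < j)).card else 0) * v (symmDiff p.1 {j}, p.2) := by
  refine (star_weightedPerm_apply _ _ _ v p).trans ?_
  simp only [toggle, Equiv.coe_fn_symm_mk, Finset.mem_symmDiff, Finset.mem_singleton]
  by_cases h : j ∈ p.1
  · have : (symmDiff p.1 {j}).filter (· < j) = p.1.filter (· < j) := by
      ext k; simp [Finset.mem_symmDiff]; grind
    simp [h, this]
  · simp [h]

theorem σz_apply (j : ℤ) (v : Space) (p : Config) :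
    σz j v p = (if j ∈ p.1 then 1 else -1) * v p := by
  have : σz j v p = 2 * (star (c j) (c j v)) p - v p := rfl
  rw [this, star_c_apply, c_apply]
  have h2 : (symmDiff p.1 {j}).filter (· < j) = p.1.filter (· < j) := by
    ext k; simp [Finset.mem_symmDiff]; grind
  by_cases h : j ∈ p.1
  · simp [h, h2, Finset.mem_symmDiff]
    have := neg_one_pow_mul_self (p.1.filter (· < j)).card
    linear_combination (2 * v p) * this
  · simp [h]

theorem symm_card (p : Finset ℤ) (j : ℤ) (h : j ∉ p) : (symmDiff p {j}) = insert j p := by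
  ext k; simp [Finset.mem_symmDiff]; grind

theorem T_apply (v : Space) (p : Config) :
    (T : Op) v p = (-1) ^ (p.1.filter (· ≤ 0)).card * v (p.1, !p.2) := rfl

theorem star_T : star (T : Op) = T := by
  refine Op.ext fun v p => ?_
  refine (star_weightedPerm_apply _ _ (fun p => by simp) v p).trans ?_
  rw [T_apply]
  cases hp : p.2 <;> simp [boolFlip, Prod.map, hp]

theorem T_mul_T : (T : Op) * T = 1 := by
  nth_rw 1 [← star_T]
  exact Unitary.star_mul_self_of_mem T.2

theorem parity_apply (v : Space) (p : Config) :
    (parityOp : Op) v p = (-1) ^ p.1.card * v p := rfl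

theorem star_parity : star (parityOp : Op) = parityOp := by
  refine Op.ext fun v p => ?_
  refine (star_weightedPerm_apply _ _ (fun p => by simp) v p).trans ?_
  rw [parity_apply]
  simp

theorem shift_apply (v : Space) (p : Config) :
    (shiftOp : Op) v p = (if p.2 then -1 else 1) * v (shift p) := rfl

theorem parity_mul_c (j : ℤ) : (parityOp : Op) * c j = -(c j * parityOp) := by
  refine Op.ext fun v p => ?_
  simp only [Op.mul_apply, parity_apply, c_apply, Op.neg_apply]
  by_cases h : j ∈ p.1
  · simp [h]
  · simp [h, symm_card, pow_succ]; ring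

theorem T_mul_c (j : ℤ) : (T : Op) * c j = (if j ≤ 0 then -1 else 1 : ℂ) • (c j * T) := by
  refine Op.ext fun v p => ?_
  simp only [Op.mul_apply, T_apply, c_apply, Op.smul_apply]
  by_cases h : j ∈ p.1
  · simp [h]
  · by_cases hj : j ≤ 0
    · simp [h, symm_card, hj, Finset.filter_insert, pow_succ]; ring
    · simp [h, symm_card, hj, Finset.filter_insert]; ring

theorem parity_mul_T : (parityOp : Op) * T = T * parityOp := by
  refine Op.ext fun v p => ?_
  simp only [Op.mul_apply, T_apply, parity_apply]
  ring

theorem shift_mul_c (j : ℤ) : (shiftOp : Op) * c j = c (j + 1) * shiftOp := by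
  refine Op.ext fun v p => ?_
  simp only [Op.mul_apply, shift_apply, c_apply]
  have h1 : j ∈ (shift p).1 ↔ j + 1 ∈ p.1 := by simp [shift]
  have h2 : ((shift p).1.filter (· < j)).card = (p.1.filter (· < j + 1)).card := by
    rw [← Finset.card_map (f := (Equiv.subRight (1 : ℤ)).toEmbedding)
      (s := p.1.filter (· < j + 1))]
    congr 1; ext k; simp [shift]
  have h3 : shift (symmDiff p.1 {j + 1}, p.2) = (symmDiff (shift p).1 {j}, (shift p).2) := by
    ext k
    · simp [shift, Finset.mem_symmDiff]
    · simp [shift]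
  rw [h2, h3]; simp only [h1]; ring

theorem shift_mul_T : (shiftOp : Op) * T = T * σz 1 * shiftOp := by
  refine Op.ext fun v p => ?_
  simp only [Op.mul_apply, shift_apply, T_apply, σz_apply]
  have h2 : ((shift p).1.filter (· ≤ 0)).card = (p.1.filter (· ≤ 1)).card := by
    rw [← Finset.card_map (f := (Equiv.subRight (1 : ℤ)).toEmbedding) (s := p.1.filter (· ≤ 1))]
    congr 1; ext k; simp [shift]
  have h3 : shift (p.1, !p.2) = ((shift p).1, !(shift p).2) := rfl
  rw [h2, h3]
  by_cases h : (1 : ℤ) ∈ p.1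
  · have : p.1.filter (· ≤ 1) = insert 1 (p.1.filter (· ≤ 0)) := by ext k; simp; grind
    rw [this, Finset.card_insert_of_notMem (by simp)]
    cases hp : p.2 <;> simp [h, pow_succ]
  · have : p.1.filter (· ≤ 1) = (p.1.filter (· ≤ 0)) := by ext k; simp; grind
    rw [this]
    cases hp : p.2 <;> simp [h]

/-- The canonical anticommutation relations. -/
theorem car_rel (j k : ℤ) :
    c j * star (c k) + star (c k) * c j = if j = k then 1 else 0 := by
  refine Op.ext fun v p => ?_
  by_cases hjk : j = k
  · subst hjk
    have h2 : (symmDiff p.1 {j}).filter (· < j) = p.1.filter (· < j) := by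
      ext k; simp [Finset.mem_symmDiff]; grind
    simp only [Op.add_apply, Op.mul_apply, c_apply, star_c_apply]
    by_cases h : j ∈ p.1 <;> simp [h, h2, Finset.mem_symmDiff] <;>
      rw [← mul_assoc, ← pow_add, Even.neg_one_pow (by simp), one_mul]
  · simp only [Op.add_apply, Op.mul_apply, c_apply, star_c_apply]
    have e : symmDiff (symmDiff p.1 {j}) {k} = symmDiff (symmDiff p.1 {k}) {j} := by
      rw [symmDiff_assoc, symmDiff_comm ({j} : Finset ℤ) {k}, ← symmDiff_assoc]
    rw [e]
    by_cases h : j ∈ p.1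
    · simp [h, hjk, Finset.mem_symmDiff]
    · by_cases h' : k ∈ p.1
      · have h1 : symmDiff p.1 {k} = p.1.erase k := by ext; simp [Finset.mem_symmDiff]; grind
        have h2 : symmDiff p.1 {j} = insert j p.1 := symm_card _ _ h
        simp only [h, h', hjk, h1, h2, Finset.filter_insert, Finset.filter_erase]
        rcases lt_or_gt_of_ne hjk with hl | hl
        · simp [h, h', hjk, hl, hl.not_gt, pow_succ, Ne.symm hjk]; ring
        · have h3 : k ∈ p.1.filter (· < j) := by simp [h', hl]
          have h4 := Finset.card_erase_add_one h3
          simp only [h', hl.not_gt, Finset.mem_insert, or_true, if_true, if_false,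
            Finset.mem_erase, h, and_false, ← h4, pow_succ, Op.zero_apply]
          ring
      · simp [h, h', Ne.symm hjk, hjk, Finset.mem_symmDiff]

theorem car_rel' (j k : ℤ) : c j * c k + c k * c j = 0 := by
  refine Op.ext fun v p => ?_
  simp only [Op.add_apply, Op.mul_apply, c_apply]
  have e : symmDiff (symmDiff p.1 {j}) {k} = symmDiff (symmDiff p.1 {k}) {j} := by
      rw [symmDiff_assoc, symmDiff_comm ({j} : Finset ℤ) {k}, ← symmDiff_assoc]
  rw [e]
  by_cases hjk : j = k
  · subst hjk; by_cases h : j ∈ p.1 <;> simp [h, Finset.mem_symmDiff]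
  by_cases h : j ∈ p.1
  · simp [h, hjk, Finset.mem_symmDiff]
  by_cases h' : k ∈ p.1
  · simp [h, h', Ne.symm hjk, Finset.mem_symmDiff]
  · simp only [h, h', symm_card p.1 _ h, symm_card p.1 _ h', Finset.filter_insert]
    rcases lt_or_gt_of_ne hjk with hl | hl
    · simp [h, h', hjk, hl, hl.not_gt, pow_succ, Ne.symm hjk]; ring
    · simp [h, h', hjk, hl, hl.not_gt, pow_succ, Ne.symm hjk]; ring

/-- `S_n = σ_z^{(1)} ⋯ σ_z^{(n-1)}` for `n > 1`, `S_1 = 1`, and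
`S_n = σ_z^{(0)} σ_z^{(-1)} ⋯ σ_z^{(n)}` for `n < 1`. -/
def S (n : ℤ) : Op :=
  if 1 ≤ n then ((List.range (n - 1).toNat).map fun k : ℕ => σz (k + 1)).prod
  else ((List.range (1 - n).toNat).map fun k : ℕ => σz (-k)).prod

/-- `σ_x^{(j)} = T S_j (c_j + c_j^*)`. -/
def σx (j : ℤ) : Op := T * S j * (c j + star (c j))

/-- `σ_y^{(j)} = i T S_j (c_j - c_j^*)`. -/
def σy (j : ℤ) : Op := Complex.I • (T * S j * (c j - star (c j)))

/-- The unital `C*`-algebra generated by a set of operators. -/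
def generatedBy (G : Set Op) : StarSubalgebra ℂ Op := (StarAlgebra.adjoin ℂ G).topologicalClosure

instance (G : Set Op) : IsClosed (generatedBy G : Set Op) :=
  StarSubalgebra.isClosed_topologicalClosure _

/-- The CAR algebra over `ℤ`. -/
def carAlgebra : StarSubalgebra ℂ Op := generatedBy (Set.range c)

instance : IsClosed (carAlgebra : Set Op) := inferInstanceAs (IsClosed (generatedBy _ : Set Op))

/-- The `C*`-algebra of spin observables localized in `Λ`. -/
def spinAlgebraOn (Λ : Set ℤ) : StarSubalgebra ℂ Op :=
  generatedBy (σx '' Λ ∪ σy '' Λ ∪ σz '' Λ)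

/-- The `C*`-algebra of the spin chain, as a subalgebra of the crossed product. -/
def spinAlgebra : StarSubalgebra ℂ Op := spinAlgebraOn Set.univ

instance : IsClosed (spinAlgebra : Set Op) := inferInstanceAs (IsClosed (generatedBy _ : Set Op))

/-- The parity automorphism: `c_j ↦ -c_j`, `T ↦ T`. -/
def Θ : Op ≃⋆ₐ[ℂ] Op := Unitary.conjStarAlgAut ℂ Op parityOp

/-- The automorphism `Q ↦ T Q T`: `c_j ↦ -c_j` for `j ≤ 0`, `c_j ↦ c_j` for `j > 0`. -/
def Θm : Op ≃⋆ₐ[ℂ] Op := Unitary.conjStarAlgAut ℂ Op T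

/-- The lattice translation by `j`. -/
def τ (j : ℤ) : Op ≃⋆ₐ[ℂ] Op := Unitary.conjStarAlgAut ℂ Op (shiftOp ^ j)

theorem conj_eq (u : unitary Op) {a b : Op} (h : (u : Op) * a = b * u) :
    Unitary.conjStarAlgAut ℂ Op u a = b := by
  rw [Unitary.conjStarAlgAut_apply, h, mul_assoc, Unitary.mul_star_self_of_mem u.2, mul_one]

theorem continuous_conj (u : unitary Op) : Continuous (Unitary.conjStarAlgAut ℂ Op u) := by
  have : (Unitary.conjStarAlgAut ℂ Op u : Op → Op) = fun x => u * x * star (u : Op) := rfl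
  rw [this]; fun_prop

theorem conj_mem (u : unitary Op) {G : Set Op} {A : StarSubalgebra ℂ Op}
    (hA : IsClosed (A : Set Op)) (h : ∀ g ∈ G, Unitary.conjStarAlgAut ℂ Op u g ∈ A) :
    ∀ Q ∈ generatedBy G, Unitary.conjStarAlgAut ℂ Op u Q ∈ A := by
  have : generatedBy G ≤ A.comap (Unitary.conjStarAlgAut ℂ Op u : Op →⋆ₐ[ℂ] Op) :=
    StarSubalgebra.topologicalClosure_minimal (StarAlgebra.adjoin_le h)
      (hA.preimage (continuous_conj u))
  exact fun Q hQ => this hQ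

theorem mem_generatedBy {G : Set Op} {g : Op} (hg : g ∈ G) : g ∈ generatedBy G :=
  StarSubalgebra.le_topologicalClosure _ (StarAlgebra.subset_adjoin ℂ G hg)

theorem Θ_c (j : ℤ) : Θ (c j) = -c j :=
  conj_eq _ (by rw [parity_mul_c, neg_mul])

theorem Θ_T : Θ T = T := conj_eq _ parity_mul_T

theorem Θm_c (j : ℤ) : Θm (c j) = (if j ≤ 0 then -1 else 1 : ℂ) • c j :=
  conj_eq _ (by rw [T_mul_c, smul_mul_assoc])

theorem Θm_T : Θm T = T := conj_eq _ rfl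

theorem τ_one_c (j : ℤ) : τ 1 (c j) = c (j + 1) := by
  rw [τ, zpow_one]; exact conj_eq _ (shift_mul_c j)

theorem τ_one_T : τ 1 T = T * σz 1 := by
  rw [τ, zpow_one]; exact conj_eq _ shift_mul_T

theorem Θ_σz (j : ℤ) : Θ (σz j) = σz j := by
  simp [σz, map_star, Θ_c]

theorem Θm_σz (j : ℤ) : Θm (σz j) = σz j := by
  simp only [σz, map_sub, map_smul, map_mul, map_star, Θm_c, map_one]
  split_ifs <;> simp

theorem τ_one_σz (j : ℤ) : τ 1 (σz j) = σz (j + 1) := by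
  simp [σz, map_star, τ_one_c]

theorem σz_mul_self (j : ℤ) : σz j * σz j = 1 := by
  refine Op.ext fun v p => ?_
  simp only [Op.mul_apply, σz_apply]
  split_ifs <;> simp

theorem σz_comm (j k : ℤ) : σz j * σz k = σz k * σz j := by
  refine Op.ext fun v p => ?_
  simp only [Op.mul_apply, σz_apply]
  ring

theorem fix_S (α : Op ≃⋆ₐ[ℂ] Op) (h : ∀ j, α (σz j) = σz j) (n : ℤ) : α (S n) = S n := by
  unfold S
  split_ifs <;> simp [map_list_prod, Function.comp_def, h]

theorem list_prod_mul_self (l : List ℤ) : (l.map σz).prod * (l.map σz).prod = 1 := by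
  induction l with
  | nil => simp
  | cons a l ih =>
    have hc : Commute (σz a) (l.map σz).prod :=
      Commute.list_prod_right _ _ (by
        intro x hx
        obtain ⟨b, -, rfl⟩ := List.mem_map.1 hx
        exact σz_comm a b)
    simp only [List.map_cons, List.prod_cons]
    rw [mul_assoc, ← mul_assoc _ (σz a), ← hc.eq, mul_assoc, ih, mul_one, σz_mul_self]

theorem S_mul_self (n : ℤ) : S n * S n = 1 := by
  unfold S
  split_ifs
  · simpa [Function.comp_def] using
      list_prod_mul_self ((List.range (n - 1).toNat).map fun k : ℕ => (k + 1 : ℤ))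
  · simpa [Function.comp_def] using
      list_prod_mul_self ((List.range (1 - n).toNat).map fun k : ℕ => (-k : ℤ))

theorem S_succ (n : ℤ) : σz 1 * τ 1 (S n) = S (n + 1) := by
  unfold S
  rcases lt_trichotomy n 0 with h | h | h
  · have h1 : ¬ 1 ≤ n := by omega
    have h2 : ¬ 1 ≤ n + 1 := by omega
    have h3 : (1 - n).toNat = (1 - (n + 1)).toNat + 1 := by omega
    rw [if_neg h1, if_neg h2, h3, List.range_succ_eq_map]
    simp only [List.map_cons, List.prod_cons, map_mul, map_list_prod, List.map_map, τ_one_σz,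
      Function.comp_def, ← mul_assoc]
    simp [σz_mul_self]
  · subst h; simp [τ_one_σz, σz_mul_self]
  · have h1 : 1 ≤ n := by omega
    have h2 : 1 ≤ n + 1 := by omega
    have h3 : (n + 1 - 1).toNat = (n - 1).toNat + 1 := by omega
    rw [if_pos h1, if_pos h2, h3, List.range_succ_eq_map]
    simp [map_list_prod, τ_one_σz, Function.comp_def]

theorem τ_one_σx (j : ℤ) : τ 1 (σx j) = σx (j + 1) := by
  rw [σx, map_mul, map_mul, τ_one_T, mul_assoc (T : Op), S_succ]
  simp [map_star, τ_one_c, σx]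

theorem τ_one_σy (j : ℤ) : τ 1 (σy j) = σy (j + 1) := by
  rw [σy, map_smul, map_mul, map_mul, τ_one_T, mul_assoc (T : Op), S_succ]
  simp [map_star, τ_one_c, σy]

theorem Θ_σx (j : ℤ) : Θ (σx j) = -σx j := by
  simp only [σx, map_mul, Θ_T, fix_S Θ Θ_σz, map_add, map_star, Θ_c, star_neg]
  noncomm_ring

theorem Θ_σy (j : ℤ) : Θ (σy j) = -σy j := by
  simp only [σy, map_smul, map_mul, Θ_T, fix_S Θ Θ_σz, map_sub, map_star, Θ_c, star_neg]
  rw [← smul_neg]; congr 1; noncomm_ring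

theorem Θm_σx (j : ℤ) : Θm (σx j) = (if j ≤ 0 then -1 else 1 : ℂ) • σx j := by
  simp only [σx, map_mul, Θm_T, fix_S Θm Θm_σz, map_add, map_star, Θm_c]
  split_ifs
  · simp; noncomm_ring
  · simp

theorem Θm_σy (j : ℤ) : Θm (σy j) = (if j ≤ 0 then -1 else 1 : ℂ) • σy j := by
  simp only [σy, map_smul, map_mul, Θm_T, fix_S Θm Θm_σz, map_sub, map_star, Θm_c]
  split_ifs
  · simp; rw [← smul_neg]; congr 1; noncomm_ring
  · simp

theorem τ_neg_one {a b : Op} (h : τ 1 a = b) : τ (-1) b = a := by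
  rw [← h]
  have : τ (-1) (τ 1 a) = (τ (-1) * τ 1) a := rfl
  rw [this, τ, τ, ← map_mul, ← zpow_add]; simp

theorem τ_mem {A : StarSubalgebra ℂ Op} (h1 : ∀ Q ∈ A, τ 1 Q ∈ A) (h2 : ∀ Q ∈ A, τ (-1) Q ∈ A)
    (j : ℤ) : ∀ Q ∈ A, τ j Q ∈ A := by
  have hadd : ∀ j k Q, τ (j + k) Q = τ j (τ k Q) := fun j k Q => by
    have : τ j (τ k Q) = (τ j * τ k) Q := rfl
    rw [this, τ, τ, τ, ← map_mul, ← zpow_add]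
  induction j using Int.induction_on with
  | zero => intro Q hQ; simpa [τ] using hQ
  | succ i ih => intro Q hQ; rw [hadd]; exact ih _ (h1 _ hQ)
  | pred i ih => intro Q hQ; rw [sub_eq_add_neg, hadd]; exact ih _ (h2 _ hQ)

theorem c_mem (j : ℤ) : c j ∈ carAlgebra := mem_generatedBy ⟨j, rfl⟩
theorem σx_mem (j : ℤ) : σx j ∈ spinAlgebra := mem_generatedBy (Or.inl (Or.inl ⟨j, trivial, rfl⟩))
theorem σy_mem (j : ℤ) : σy j ∈ spinAlgebra := mem_generatedBy (Or.inl (Or.inr ⟨j, trivial, rfl⟩))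
theorem σz_mem (j : ℤ) : σz j ∈ spinAlgebra := mem_generatedBy (Or.inr ⟨j, trivial, rfl⟩)

theorem conj_mem_car (u : unitary Op) (h : ∀ j, Unitary.conjStarAlgAut ℂ Op u (c j) ∈ carAlgebra) :
    ∀ Q ∈ carAlgebra, Unitary.conjStarAlgAut ℂ Op u Q ∈ carAlgebra :=
  conj_mem u inferInstance (by rintro _ ⟨j, rfl⟩; exact h j)

theorem conj_mem_spin (u : unitary Op)
    (hx : ∀ j, Unitary.conjStarAlgAut ℂ Op u (σx j) ∈ spinAlgebra)
    (hy : ∀ j, Unitary.conjStarAlgAut ℂ Op u (σy j) ∈ spinAlgebra)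
    (hz : ∀ j, Unitary.conjStarAlgAut ℂ Op u (σz j) ∈ spinAlgebra) :
    ∀ Q ∈ spinAlgebra, Unitary.conjStarAlgAut ℂ Op u Q ∈ spinAlgebra :=
  conj_mem u inferInstance (by
    rintro _ ((⟨j, -, rfl⟩ | ⟨j, -, rfl⟩) | ⟨j, -, rfl⟩)
    exacts [hx j, hy j, hz j])

theorem Θ_mem_car : ∀ Q ∈ carAlgebra, Θ Q ∈ carAlgebra :=
  conj_mem_car _ fun j => (Θ_c j).symm ▸ neg_mem (c_mem j)

theorem Θm_mem_car : ∀ Q ∈ carAlgebra, Θm Q ∈ carAlgebra :=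
  conj_mem_car _ fun j => (Θm_c j).symm ▸ carAlgebra.smul_mem (c_mem j) _

theorem τ_mem_car (j : ℤ) : ∀ Q ∈ carAlgebra, τ j Q ∈ carAlgebra :=
  τ_mem (conj_mem_car _ fun j => (τ_one_c j).symm ▸ c_mem _)
    (conj_mem_car _ fun j => by
      have := τ_neg_one (τ_one_c (j - 1))
      rw [sub_add_cancel] at this
      exact this.symm ▸ c_mem _) j

theorem Θ_mem_spin : ∀ Q ∈ spinAlgebra, Θ Q ∈ spinAlgebra :=
  conj_mem_spin _ (fun j => (Θ_σx j).symm ▸ neg_mem (σx_mem j))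
    (fun j => (Θ_σy j).symm ▸ neg_mem (σy_mem j)) (fun j => (Θ_σz j).symm ▸ σz_mem j)

theorem Θm_mem_spin : ∀ Q ∈ spinAlgebra, Θm Q ∈ spinAlgebra :=
  conj_mem_spin _ (fun j => (Θm_σx j).symm ▸ spinAlgebra.smul_mem (σx_mem j) _)
    (fun j => (Θm_σy j).symm ▸ spinAlgebra.smul_mem (σy_mem j) _)
    (fun j => (Θm_σz j).symm ▸ σz_mem j)

theorem τ_mem_spin (j : ℤ) : ∀ Q ∈ spinAlgebra, τ j Q ∈ spinAlgebra := by
  have key : ∀ f : ℤ → Op, (∀ j, τ 1 (f j) = f (j + 1)) → ∀ j, τ (-1) (f j) = f (j - 1) :=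
    fun f hf j => by
      have := τ_neg_one (hf (j - 1))
      rwa [sub_add_cancel] at this
  exact τ_mem (conj_mem_spin _ (fun j => (τ_one_σx j).symm ▸ σx_mem _)
      (fun j => (τ_one_σy j).symm ▸ σy_mem _) (fun j => (τ_one_σz j).symm ▸ σz_mem _))
    (conj_mem_spin _ (fun j => (key _ τ_one_σx j).symm ▸ σx_mem _)
      (fun j => (key _ τ_one_σy j).symm ▸ σy_mem _)
      (fun j => (key _ τ_one_σz j).symm ▸ σz_mem _)) j

/-- The `Θ`-fixed elements of a subalgebra. -/
def evenPart (A : StarSubalgebra ℂ Op) : StarSubalgebra ℂ Op :=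
  A ⊓ StarAlgHom.equalizer (Θ : Op →⋆ₐ[ℂ] Op) (StarAlgHom.id ℂ Op)

theorem mem_evenPart {A : StarSubalgebra ℂ Op} {Q : Op} :
    Q ∈ evenPart A ↔ Q ∈ A ∧ Θ Q = Q := Iff.rfl

instance (A : StarSubalgebra ℂ Op) [hA : IsClosed (A : Set Op)] :
    IsClosed (evenPart A : Set Op) :=
  hA.inter (isClosed_eq (continuous_conj parityOp) continuous_id)

theorem Θm_mem_even : ∀ Q ∈ evenPart carAlgebra, Θm Q ∈ evenPart carAlgebra := fun Q hQ => by
  refine ⟨Θm_mem_car Q hQ.1, ?_⟩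
  have h : Θ (Θm Q) = Θm (Θ Q) := by
    have h1 : Θ (Θm Q) = (Θ * Θm) Q := rfl
    have h2 : Θm (Θ Q) = (Θm * Θ) Q := rfl
    have h3 : parityOp * T = T * parityOp := Subtype.ext parity_mul_T
    rw [h1, h2, Θ, Θm, ← map_mul, ← map_mul, h3]
  change Θ (Θm Q) = Θm Q
  rw [h, (mem_evenPart.1 hQ).2]

theorem S_mem (n : ℤ) : S n ∈ spinAlgebra := by
  unfold S
  split_ifs <;> refine list_prod_mem ?_ <;> simp only [List.mem_map] <;>
    rintro _ ⟨k, -, rfl⟩ <;> exact σz_mem _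

theorem Θ_Θ (Q : Op) : Θ (Θ Q) = Q := by
  have h1 : Θ (Θ Q) = (Θ * Θ) Q := rfl
  have h3 : parityOp * parityOp = 1 := Subtype.ext (by
    have := Unitary.star_mul_self_of_mem parityOp.2
    rwa [star_parity] at this)
  rw [h1, Θ, ← map_mul, h3, map_one]; rfl

theorem T_mul (Q : Op) : (T : Op) * Q = Θm Q * T := by
  rw [Θm, Unitary.conjStarAlgAut_apply, star_T, mul_assoc, T_mul_T, mul_one]

theorem T_mul_c_mem (j : ℤ) : (T : Op) * c j ∈ spinAlgebra := by
  have hST : S j * T = T * S j := by rw [T_mul, fix_S Θm Θm_σz]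
  have h : (T : Op) * c j = (1 / 2 : ℂ) • (S j * (σx j + (-Complex.I) • σy j)) := by
    have h1 : σx j + (-Complex.I) • σy j = (2 : ℂ) • (T * S j * c j) := by
      rw [σx, σy, smul_smul, neg_mul, Complex.I_mul_I, neg_neg, one_smul, ← mul_add, two_smul,
        ← mul_add]
      congr 1; abel
    rw [h1, mul_smul_comm, smul_smul, ← mul_assoc, ← mul_assoc, hST, mul_assoc (T : Op),
      S_mul_self]
    norm_num
  rw [h]
  exact spinAlgebra.smul_mem (mul_mem (S_mem j) (add_mem (σx_mem j)
    (spinAlgebra.smul_mem (σy_mem j) _))) _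

/-- The elements of the form `Q₀ + Q₁` with `Q₀` even in the spin algebra, `Q₁` odd and
`T Q₁` in the spin algebra. -/
def splitAlgebra : StarSubalgebra ℂ Op where
  carrier := {Q | Q + Θ Q ∈ spinAlgebra ∧ T * (Q - Θ Q) ∈ spinAlgebra}
  mul_mem' := by
    rintro P Q ⟨hP0, hP1⟩ ⟨hQ0, hQ1⟩
    have e0 : P * Q + Θ (P * Q) = (1 / 2 : ℂ) • ((P + Θ P) * (Q + Θ Q) +
        Θm (T * (P - Θ P)) * (T * (Q - Θ Q))) := by
      have : Θm (T * (P - Θ P)) * (T * (Q - Θ Q)) = (P - Θ P) * (Q - Θ Q) := by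
        rw [← mul_assoc, ← T_mul, ← mul_assoc, T_mul_T, one_mul]
      rw [this, map_mul]
      have : (P + Θ P) * (Q + Θ Q) + (P - Θ P) * (Q - Θ Q) = (2 : ℂ) • (P * Q + Θ P * Θ Q) := by
        rw [two_smul]; noncomm_ring
      rw [this, smul_smul]; norm_num
    have e1 : T * (P * Q - Θ (P * Q)) = (1 / 2 : ℂ) • (Θm (P + Θ P) * (T * (Q - Θ Q)) +
        T * (P - Θ P) * (Q + Θ Q)) := by
      rw [← mul_assoc (Θm _), ← T_mul, map_mul]
      have : T * (P + Θ P) * (Q - Θ Q) + T * (P - Θ P) * (Q + Θ Q) =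
          (2 : ℂ) • (T * (P * Q - Θ P * Θ Q)) := by
        rw [two_smul]; noncomm_ring
      rw [this, smul_smul]; norm_num
    exact ⟨e0 ▸ spinAlgebra.smul_mem (add_mem (mul_mem hP0 hQ0)
        (mul_mem (Θm_mem_spin _ hP1) hQ1)) _,
      e1 ▸ spinAlgebra.smul_mem (add_mem (mul_mem (Θm_mem_spin _ hP0) hQ1)
        (mul_mem hP1 hQ0)) _⟩
  add_mem' := by
    rintro P Q ⟨hP0, hP1⟩ ⟨hQ0, hQ1⟩
    refine ⟨?_, ?_⟩
    · have := add_mem hP0 hQ0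
      rwa [show P + Q + Θ (P + Q) = P + Θ P + (Q + Θ Q) by rw [map_add]; abel]
    · have := add_mem hP1 hQ1
      rwa [show T * (P + Q - Θ (P + Q)) = T * (P - Θ P) + T * (Q - Θ Q) by
        rw [map_add]; noncomm_ring]
  algebraMap_mem' r := by
    have h : Θ (algebraMap ℂ Op r) = algebraMap ℂ Op r := by
      rw [Algebra.algebraMap_eq_smul_one, map_smul, map_one]
    refine ⟨?_, ?_⟩
    · rw [h]; exact add_mem (algebraMap_mem _ r) (algebraMap_mem _ r)
    · rw [h, sub_self, mul_zero]; exact zero_mem _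
  star_mem' := by
    rintro P ⟨hP0, hP1⟩
    refine ⟨?_, ?_⟩
    · have := star_mem hP0
      rwa [star_add, ← map_star] at this
    · have := Θm_mem_spin _ (star_mem hP1)
      rwa [star_mul, star_T, map_mul, Θm_T, ← T_mul, star_sub, ← map_star] at this

theorem car_le_split : carAlgebra ≤ splitAlgebra := by
  refine StarSubalgebra.topologicalClosure_minimal (StarAlgebra.adjoin_le ?_) ?_
  · rintro _ ⟨j, rfl⟩
    refine ⟨?_, ?_⟩
    · rw [Θ_c, add_neg_cancel]; exact zero_mem _
    · rw [Θ_c, sub_neg_eq_add, mul_add]; exact add_mem (T_mul_c_mem j) (T_mul_c_mem j)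
  · have hs : IsClosed (spinAlgebra : Set Op) := inferInstance
    have hc : Continuous Θ := continuous_conj parityOp
    exact (hs.preimage (continuous_id.add hc)).inter
      (hs.preimage (continuous_const.mul (continuous_id.sub hc)))

theorem even_car_le_spin : evenPart carAlgebra ≤ spinAlgebra := by
  rintro Q ⟨hQ, hΘ⟩
  have h := (car_le_split hQ).1
  have hΘ' : Θ Q = Q := hΘ
  rw [hΘ', ← two_smul ℂ] at h
  have := spinAlgebra.smul_mem h (1 / 2 : ℂ)
  rw [smul_smul] at this
  norm_num at this
  exact this

/-! The automorphisms restricted to the algebras on which states are considered -/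

/-- The restriction of an automorphism to an invariant subalgebra. -/
def restrictTo (α : Op ≃⋆ₐ[ℂ] Op) (A : StarSubalgebra ℂ Op) (h : ∀ Q ∈ A, α Q ∈ A) :
    A →⋆ₐ[ℂ] A :=
  ((α : Op →⋆ₐ[ℂ] Op).comp A.subtype).codRestrict A fun Q => h Q Q.2

/-- `Θ` on the CAR algebra. -/
def ΘCar : carAlgebra →⋆ₐ[ℂ] carAlgebra := restrictTo Θ carAlgebra Θ_mem_car

/-- `Θ_-` on the CAR algebra. -/
def ΘmCar : carAlgebra →⋆ₐ[ℂ] carAlgebra := restrictTo Θm carAlgebra Θm_mem_car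

/-- `Θ_-` on the even part of the CAR algebra. -/
def ΘmEven : evenPart carAlgebra →⋆ₐ[ℂ] evenPart carAlgebra :=
  restrictTo Θm (evenPart carAlgebra) Θm_mem_even

/-- The lattice translation `τ_j` of the CAR algebra. -/
def τCar (j : ℤ) : carAlgebra →⋆ₐ[ℂ] carAlgebra := restrictTo (τ j) carAlgebra (τ_mem_car j)

/-- `Θ` on the spin algebra. -/
def ΘSpin : spinAlgebra →⋆ₐ[ℂ] spinAlgebra := restrictTo Θ spinAlgebra Θ_mem_spin

/-- The lattice translation `τ_j` of the spin algebra. -/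
def τSpin (j : ℤ) : spinAlgebra →⋆ₐ[ℂ] spinAlgebra := restrictTo (τ j) spinAlgebra (τ_mem_spin j)

/-- The inclusion of the even part of the CAR algebra into the spin algebra. -/
def evenToSpin : evenPart carAlgebra →⋆ₐ[ℂ] spinAlgebra :=
  StarSubalgebra.inclusion even_car_le_spin

/-- The restriction `ψ_+` of a functional `ψ` on the CAR algebra to the even part. -/
def evenRestriction (ψ : carAlgebra →ₚ[ℂ] ℂ) : evenPart carAlgebra →ₚ[ℂ] ℂ :=
  pullback ψ (StarSubalgebra.inclusion (inf_le_left : evenPart carAlgebra ≤ carAlgebra))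

/-- `φ` is an extension to the spin algebra of the functional `ω` on the even part. -/
def IsExtension (φ : spinAlgebra →ₚ[ℂ] ℂ) (ω : evenPart carAlgebra →ₚ[ℂ] ℂ) : Prop :=
  pullback φ evenToSpin = ω

/-- `ψ ∘ τ_j = ψ` for all `j`. -/
def TranslationInvariantCar (ψ : carAlgebra →ₚ[ℂ] ℂ) : Prop :=
  ∀ j : ℤ, pullback ψ (τCar j) = ψ

/-- `φ ∘ τ_j = φ` for all `j`. -/
def TranslationInvariantSpin (φ : spinAlgebra →ₚ[ℂ] ℂ) : Prop :=
  ∀ j : ℤ, pullback φ (τSpin j) = φ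

/-- The von Neumann algebra `π_φ(M)''` for a subalgebra `M` of the spin algebra. -/
def spinBicommutant (φ : spinAlgebra →ₚ[ℂ] ℂ) (M : StarSubalgebra ℂ Op) :
    Set (φ.GNS →L[ℂ] φ.GNS) :=
  gnsBicommutant φ {Q : spinAlgebra | (Q : Op) ∈ M}

end JordanWigner

end

open JordanWigner

/-! Both algebras are generated by the same even part E and one odd selfadjoint unitary: u = c_1 +
c_1^* for the CAR algebra, and σ_x^{(1)} = T u for the spin algebra. Each is therefore E ⊕
E·(unitary), which `GradedExtension` abstracts. Writing β for Ad u on E, the corresponding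
automorphism for the spin algebra is Θ_- ∘ β (`gradedSpin_β`). Let ω = ψ_+ and let P be the
projection onto the even part; Θ-invariance of ψ means ψ = ω ∘ P.

For a graded extension with automorphism β there is a dichotomy. If ω is pure and not equivalent to
ω ∘ β, then ω ∘ P is pure, because the odd part of any component of a convex decomposition is given
by an operator intertwining π_ω and π_ω ∘ β, which vanishes by Schur's lemma (`isPureState_comp_P`).
If ω is pure and equivalent to ω ∘ β, then β is implemented on the GNS space of ω by a selfadjoint
unitary W, and letting the odd unitary act as W gives a non-invariant extension on that same space
(`exists_extension_of_equiv`). Its average with its θ-transform is ω ∘ P, so ω ∘ P is then not pure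
(`not_repEquiv_of_isPureState`). Hence purity of ψ makes ω pure and inequivalent to ω ∘ β, and
everything depends on whether ω is equivalent to ω ∘ Θ_- ∘ β.

Such an equivalence makes ψ ∘ Θ_- a vector state of π_ψ, which (i) forbids
(`unitarilyEquivalent_comp_P`). In (ii), cancelling ω ∼ ω ∘ Θ_- would leave ω ∼ ω ∘ β, which is
impossible. In (iii), ω ∘ Θ_- occurs in the restriction of π_ψ to E, so it is equivalent to ω or to
ω ∘ β (`repEquiv_or`); the first is excluded, and the equivalence holds.

In case (iii), E already acts irreducibly in π_φ, which yields purity and equality of the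
bicommutants. If ω is translation invariant, the operator of the odd unitary and its translate
implement the same automorphism up to the translation unitary, so they differ by a sign z with z² =
1; thus τ_1 multiplies φ by z on odd elements and τ_2 fixes φ (`exists_sign`, `pullback_sq`). For
the half chains, pick an odd local Q with φ(Q) ≠ 0. Its translates D_n by ±2n are asymptotically
central with constant expectation, so they converge weakly, along an ultrafilter, to φ(Q)·1. For odd
R in the half chain, the elements R D_n are eventually even elements of the half chain and converge
weakly to φ(Q) R (`gnsBicommutant_eq_even`). -/

noncomputable section

/-! ### Irreducible representations and Schur's lemma -/

section Representations

variable {A B : Type*} [CStarAlgebra A] [CStarAlgebra B]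
variable {H K M : Type*} [NormedAddCommGroup H] [InnerProductSpace ℂ H] [CompleteSpace H]
  [NormedAddCommGroup K] [InnerProductSpace ℂ K] [CompleteSpace K]
  [NormedAddCommGroup M] [InnerProductSpace ℂ M] [CompleteSpace M]

/-- A representation is irreducible if its commutant consists of the scalars. -/
def IrreducibleRep (π : A →⋆ₐ[ℂ] (H →L[ℂ] H)) : Prop :=
  ∀ Y : H →L[ℂ] H, (∀ a ξ, Y (π a ξ) = π a (Y ξ)) → ∃ z : ℂ, Y = z • 1

/-- Unitary equivalence of representations. -/
def RepEquiv (π : A →⋆ₐ[ℂ] (H →L[ℂ] H)) (ρ : A →⋆ₐ[ℂ] (K →L[ℂ] K)) : Prop :=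
  ∃ U : H ≃ₗᵢ[ℂ] K, ∀ (a : A) (ξ : H), U (π a ξ) = ρ a (U ξ)

theorem RepEquiv.symm {π : A →⋆ₐ[ℂ] (H →L[ℂ] H)} {ρ : A →⋆ₐ[ℂ] (K →L[ℂ] K)}
    (h : RepEquiv π ρ) : RepEquiv ρ π := by
  obtain ⟨U, hU⟩ := h
  exact ⟨U.symm, fun a ξ => by
    rw [LinearIsometryEquiv.symm_apply_eq, hU, LinearIsometryEquiv.apply_symm_apply]⟩

theorem RepEquiv.trans {π : A →⋆ₐ[ℂ] (H →L[ℂ] H)} {ρ : A →⋆ₐ[ℂ] (K →L[ℂ] K)}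
    {σ : A →⋆ₐ[ℂ] (M →L[ℂ] M)} (h : RepEquiv π ρ) (h' : RepEquiv ρ σ) : RepEquiv π σ := by
  obtain ⟨U, hU⟩ := h
  obtain ⟨V, hV⟩ := h'
  exact ⟨U.trans V, fun a ξ => by simp [hU, hV]⟩

theorem RepEquiv.comp {π : A →⋆ₐ[ℂ] (H →L[ℂ] H)} {ρ : A →⋆ₐ[ℂ] (K →L[ℂ] K)}
    (h : RepEquiv π ρ) (α : B →⋆ₐ[ℂ] A) : RepEquiv (π.comp α) (ρ.comp α) := by
  obtain ⟨U, hU⟩ := h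
  exact ⟨U, fun a ξ => hU (α a) ξ⟩

theorem IrreducibleRep.of_equiv {π : A →⋆ₐ[ℂ] (H →L[ℂ] H)} {ρ : A →⋆ₐ[ℂ] (K →L[ℂ] K)}
    (hπ : IrreducibleRep π) (h : RepEquiv π ρ) : IrreducibleRep ρ := by
  obtain ⟨U, hU⟩ := h
  intro Y hY
  obtain ⟨z, hz⟩ := hπ ((U.symm : K →L[ℂ] H) ∘L Y ∘L (U : H →L[ℂ] K)) fun a ξ => by
    simp only [ContinuousLinearMap.comp_apply]
    change U.symm (Y (U (π a ξ))) = π a (U.symm (Y (U ξ)))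
    rw [hU, hY, LinearIsometryEquiv.symm_apply_eq, hU, LinearIsometryEquiv.apply_symm_apply]
  refine ⟨z, ContinuousLinearMap.ext fun η => ?_⟩
  have h1 : U.symm (Y (U (U.symm η))) = z • U.symm η := congrArg (fun X => X (U.symm η)) hz
  rw [LinearIsometryEquiv.apply_symm_apply, LinearIsometryEquiv.symm_apply_eq, map_smul,
    LinearIsometryEquiv.apply_symm_apply] at h1
  exact h1

/-- Both representations have the same range, hence the same commutant. -/
theorem IrreducibleRep.comp_surjective {π : A →⋆ₐ[ℂ] (H →L[ℂ] H)} (hπ : IrreducibleRep π)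
    (α : B →⋆ₐ[ℂ] A) (hα : Function.Surjective α) : IrreducibleRep (π.comp α) := by
  intro Y hY
  refine hπ Y fun a ξ => ?_
  obtain ⟨b, rfl⟩ := hα a
  exact hY b ξ

/-- The adjoint of an intertwiner is an intertwiner. -/
theorem intertwiner_adjoint {π : A →⋆ₐ[ℂ] (H →L[ℂ] H)} {ρ : A →⋆ₐ[ℂ] (K →L[ℂ] K)}
    (X : H →L[ℂ] K) (hX : ∀ a ξ, X (π a ξ) = ρ a (X ξ)) (a : A) (η : K) :
    X.adjoint (ρ a η) = π a (X.adjoint η) := by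
  refine ext_inner_left ℂ fun ξ => ?_
  have e1 : ∀ (a : A) (ξ η : H), ⟪ξ, π a η⟫_ℂ = ⟪π (star a) ξ, η⟫_ℂ := fun a ξ η => by
    rw [map_star, ContinuousLinearMap.star_eq_adjoint, ContinuousLinearMap.adjoint_inner_left]
  have e2 : ∀ (a : A) (ξ η : K), ⟪ξ, ρ a η⟫_ℂ = ⟪ρ (star a) ξ, η⟫_ℂ := fun a ξ η => by
    rw [map_star, ContinuousLinearMap.star_eq_adjoint, ContinuousLinearMap.adjoint_inner_left]
  rw [ContinuousLinearMap.adjoint_inner_right, e1, e2, ContinuousLinearMap.adjoint_inner_right, hX]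

/-- **Schur's lemma**: irreducible representations with a nonzero intertwiner are unitarily
equivalent. -/
theorem RepEquiv.of_intertwiner {π : A →⋆ₐ[ℂ] (H →L[ℂ] H)} {ρ : A →⋆ₐ[ℂ] (K →L[ℂ] K)}
    (hπ : IrreducibleRep π) (hρ : IrreducibleRep ρ) (X : H →L[ℂ] K)
    (hX : ∀ a ξ, X (π a ξ) = ρ a (X ξ)) (h0 : X ≠ 0) : RepEquiv π ρ := by
  have hX' := intertwiner_adjoint X hX
  obtain ⟨z, hz⟩ := hπ (X.adjoint ∘L X) fun a ξ => by simp [hX, hX']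
  obtain ⟨w, hw⟩ := hρ (X ∘L X.adjoint) fun a ξ => by simp [hX, hX']
  have hz' : ∀ ξ, X.adjoint (X ξ) = z • ξ := fun ξ => congrArg (fun Y => Y ξ) hz
  have hw' : ∀ ξ, X (X.adjoint ξ) = w • ξ := fun ξ => congrArg (fun Y => Y ξ) hw
  obtain ⟨ξ₀, hξ₀⟩ : ∃ ξ, X ξ ≠ 0 := by
    by_contra! h
    exact h0 (ContinuousLinearMap.ext h)
  -- The scalars X^* X = z and X X^* = w agree on comparing both bracketings of X X^* X.
  have hzw : z = w := by
    have h1 : z • X ξ₀ = w • X ξ₀ := by rw [← hw', hz', map_smul]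
    exact smul_left_injective ℂ hξ₀ h1
  subst hzw
  have hn : ∀ ξ, ((‖X ξ‖ ^ 2 : ℝ) : ℂ) = z * (‖ξ‖ ^ 2 : ℝ) := fun ξ => by
    have h1 : ⟪X ξ, X ξ⟫_ℂ = ⟪ξ, X.adjoint (X ξ)⟫_ℂ := by
      rw [ContinuousLinearMap.adjoint_inner_right]
    rw [hz', inner_smul_right, inner_self_eq_norm_sq_to_K, inner_self_eq_norm_sq_to_K] at h1
    exact_mod_cast h1
  have hξ₁ : ξ₀ ≠ 0 := fun h => hξ₀ (by rw [h, map_zero])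
  -- X multiplies every norm by r = √z; the ratio at one vector not killed by X determines r, and
  -- r⁻¹ X is the unitary sought.
  obtain ⟨r, hr, hrz⟩ : ∃ r : ℝ, 0 < r ∧ z = ((r ^ 2 : ℝ) : ℂ) := by
    refine ⟨‖X ξ₀‖ / ‖ξ₀‖, by positivity, ?_⟩
    have h1 := hn ξ₀
    have h2 : ((‖ξ₀‖ ^ 2 : ℝ) : ℂ) ≠ 0 := by
      have : ‖ξ₀‖ ≠ 0 := norm_ne_zero_iff.2 hξ₁
      exact_mod_cast pow_ne_zero 2 this
    rw [div_pow, Complex.ofReal_div, eq_div_iff h2, h1]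
  have hrc : (r : ℂ) ≠ 0 := by exact_mod_cast hr.ne'
  let e : H ≃ₗ[ℂ] K :=
    { toLinearMap := ((r : ℂ)⁻¹ • X : H →L[ℂ] K).toLinearMap
      invFun := fun η => (r : ℂ)⁻¹ • X.adjoint η
      left_inv := fun ξ => by
        change (r : ℂ)⁻¹ • X.adjoint ((r : ℂ)⁻¹ • X ξ) = ξ
        rw [map_smul, hz', hrz, smul_smul, smul_smul]
        push_cast
        rw [show (r : ℂ)⁻¹ * (r : ℂ)⁻¹ * (r : ℂ) ^ 2 = 1 by field_simp, one_smul]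
      right_inv := fun ξ => by
        change (r : ℂ)⁻¹ • X ((r : ℂ)⁻¹ • X.adjoint ξ) = ξ
        rw [map_smul, hw', hrz, smul_smul, smul_smul]
        push_cast
        rw [show (r : ℂ)⁻¹ * (r : ℂ)⁻¹ * (r : ℂ) ^ 2 = 1 by field_simp, one_smul] }
  have he : ∀ ξ, e ξ = (r : ℂ)⁻¹ • X ξ := fun ξ => rfl
  refine ⟨⟨e, fun ξ => ?_⟩, fun a ξ => ?_⟩
  · have h1 := hn ξ
    rw [hrz] at h1
    have h2 : ‖X ξ‖ ^ 2 = (r * ‖ξ‖) ^ 2 := by rw [mul_pow]; exact_mod_cast h1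
    have h3 : ‖X ξ‖ = r * ‖ξ‖ := (sq_eq_sq₀ (norm_nonneg _) (by positivity)).1 h2
    rw [he, norm_smul, h3, norm_inv, Complex.norm_real, Real.norm_of_nonneg hr.le]
    field_simp
  · change e (π a ξ) = ρ a (e ξ)
    rw [he, he, hX, map_smul]

end Representations

/-! ### GNS representations and vector states -/

section GNS

variable {A : Type*} [CStarAlgebra A] [PartialOrder A] [StarOrderedRing A]
variable {B : Type*} [CStarAlgebra B] [PartialOrder B] [StarOrderedRing B]
variable {H K : Type*} [NormedAddCommGroup H] [InnerProductSpace ℂ H] [CompleteSpace H]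
  [NormedAddCommGroup K] [InnerProductSpace ℂ K] [CompleteSpace K]

theorem inner_self_complex {H : Type*} [NormedAddCommGroup H] [InnerProductSpace ℂ H]
    (ξ : H) : ⟪ξ, ξ⟫_ℂ = ((‖ξ‖ ^ 2 : ℝ) : ℂ) := by
  rw [inner_self_eq_norm_sq_to_K]; push_cast; rfl

theorem inner_self_complex_nonneg {H : Type*} [NormedAddCommGroup H] [InnerProductSpace ℂ H]
    (ξ : H) : 0 ≤ ⟪ξ, ξ⟫_ℂ := by
  rw [inner_self_complex]
  exact_mod_cast sq_nonneg ‖ξ‖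

theorem inner_rep {A : Type*} [CStarAlgebra A] (π : A →⋆ₐ[ℂ] (H →L[ℂ] H)) (a : A) (ξ η : H) :
    ⟪π a ξ, η⟫_ℂ = ⟪ξ, π (star a) η⟫_ℂ := by
  rw [map_star, ContinuousLinearMap.star_eq_adjoint, ContinuousLinearMap.adjoint_inner_right]

theorem rep_mul_apply {A : Type*} [CStarAlgebra A] (π : A →⋆ₐ[ℂ] (H →L[ℂ] H)) (a b : A) (ξ : H) :
    π (a * b) ξ = π a (π b ξ) := by
  rw [map_mul]; rfl

theorem gns_apply_vector (φ : A →ₚ[ℂ] ℂ) (a : A) :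
    φ.gnsStarAlgHom a (gnsVector φ) = ((φ.toPreGNS a : φ.PreGNS) : φ.GNS) := by
  rw [gnsVector]
  refine (φ.gnsNonUnitalStarAlgHom_apply_coe).trans ?_
  simp

theorem gns_cyclic (φ : A →ₚ[ℂ] ℂ) :
    DenseRange fun a => φ.gnsStarAlgHom a (gnsVector φ) := by
  have h : (fun a => φ.gnsStarAlgHom a (gnsVector φ)) =
      ((↑) : φ.PreGNS → φ.GNS) ∘ φ.toPreGNS := funext (gns_apply_vector φ)
  rw [h]
  exact UniformSpace.Completion.denseRange_coe.comp φ.toPreGNS.surjective.denseRange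
    (UniformSpace.Completion.continuous_coe _)

theorem gns_state (φ : A →ₚ[ℂ] ℂ) (a : A) :
    φ a = ⟪gnsVector φ, φ.gnsStarAlgHom a (gnsVector φ)⟫_ℂ := by
  rw [gns_apply_vector, gnsVector, UniformSpace.Completion.inner_coe, φ.preGNS_inner_def]
  simp

/-- Two continuous maps on a representation space agree if they agree on a cyclic orbit. -/
theorem gns_ext {X : Type*} [TopologicalSpace X] [T2Space X] (φ : A →ₚ[ℂ] ℂ) {f g : φ.GNS → X}
    (hf : Continuous f) (hg : Continuous g)
    (h : ∀ a, f (φ.gnsStarAlgHom a (gnsVector φ)) = g (φ.gnsStarAlgHom a (gnsVector φ))) :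
    f = g :=
  (gns_cyclic φ).equalizer hf hg (funext h)

/-- A vector that induces the state `φ` yields an isometric embedding of the GNS space. -/
theorem exists_gns_isometry (φ : A →ₚ[ℂ] ℂ) (π : A →⋆ₐ[ℂ] (H →L[ℂ] H)) (ξ : H)
    (h : ∀ a, φ a = ⟪ξ, π a ξ⟫_ℂ) :
    ∃ J : φ.GNS →ₗᵢ[ℂ] H, J (gnsVector φ) = ξ ∧
      ∀ a η, J (φ.gnsStarAlgHom a η) = π a (J η) := by
  let f : φ.PreGNS →ₗ[ℂ] H :=
    { toFun := fun a => π (φ.ofPreGNS a) ξ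
      map_add' := fun a b => by simp
      map_smul' := fun r a => by simp }
  -- ‖π(a) ξ‖² = φ(a^* a), so a ↦ π(a) ξ is isometric before completion.
  have hf : ∀ a, ‖f a‖ = ‖a‖ := fun a => by
    have h1 : ((‖f a‖ ^ 2 : ℝ) : ℂ) = ((‖a‖ ^ 2 : ℝ) : ℂ) := by
      have h2 := φ.preGNS_norm_sq a
      have h3 : ⟪f a, f a⟫_ℂ = φ (star (φ.ofPreGNS a) * φ.ofPreGNS a) := by
        rw [h, rep_mul_apply, ← inner_rep]; rfl
      rw [inner_self_eq_norm_sq_to_K] at h3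
      push_cast
      exact h3.trans h2.symm
    have h2 : ‖f a‖ ^ 2 = ‖a‖ ^ 2 := by exact_mod_cast h1
    exact (sq_eq_sq₀ (norm_nonneg _) (norm_nonneg _)).1 h2
  let F : φ.PreGNS →L[ℂ] H := f.mkContinuous 1 fun a => by rw [hf, one_mul]
  have hd : DenseRange (UniformSpace.Completion.toComplL : φ.PreGNS →L[ℂ] φ.GNS) :=
    UniformSpace.Completion.denseRange_coe
  have hi : IsUniformInducing (UniformSpace.Completion.toComplL : φ.PreGNS →L[ℂ] φ.GNS) :=
    UniformSpace.Completion.isUniformInducing_coe _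
  let G : φ.GNS →L[ℂ] H := F.extend UniformSpace.Completion.toComplL
  have hG : ∀ a : φ.PreGNS, G (a : φ.GNS) = f a := fun a => F.extend_eq hd hi a
  have hGn : ∀ η, ‖G η‖ = ‖η‖ := fun η => by
    induction η using UniformSpace.Completion.induction_on with
    | hp => exact isClosed_eq G.continuous.norm continuous_norm
    | ih a => rw [hG, hf, UniformSpace.Completion.norm_coe]
  refine ⟨⟨G.toLinearMap, hGn⟩, ?_, fun a η => ?_⟩
  · change G _ = ξ
    rw [gnsVector, hG]
    change π (φ.ofPreGNS (φ.toPreGNS 1)) ξ = ξ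
    rw [φ.ofPreGNS_toPreGNS, map_one]; rfl
  · change G _ = π a (G η)
    refine congrFun (gns_ext φ (f := fun η => G (φ.gnsStarAlgHom a η))
      (g := fun η => π a (G η)) (by fun_prop) (by fun_prop) fun b => ?_) η
    rw [← rep_mul_apply, gns_apply_vector, gns_apply_vector, hG, hG]
    change π (a * b) ξ = π a (π b ξ)
    rw [rep_mul_apply]

/-- Uniqueness of the GNS representation. -/
theorem exists_gns_unitary (φ : A →ₚ[ℂ] ℂ) (π : A →⋆ₐ[ℂ] (H →L[ℂ] H)) (ξ : H)
    (h : ∀ a, φ a = ⟪ξ, π a ξ⟫_ℂ) (hc : DenseRange fun a => π a ξ) :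
    ∃ U : φ.GNS ≃ₗᵢ[ℂ] H, U (gnsVector φ) = ξ ∧
      ∀ a η, U (φ.gnsStarAlgHom a η) = π a (U η) := by
  obtain ⟨J, hJ, hJ'⟩ := exists_gns_isometry φ π ξ h
  -- The range is closed because J is isometric, and dense because it contains the orbit of ξ.
  have hs : Function.Surjective J := by
    have h1 : IsClosed (Set.range J) := J.isometry.isClosedEmbedding.isClosed_range
    have h2 : DenseRange J := by
      refine Dense.mono ?_ hc
      rintro _ ⟨a, rfl⟩
      exact ⟨φ.gnsStarAlgHom a (gnsVector φ), by rw [hJ', hJ]⟩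
    rw [← Set.range_eq_univ, ← h1.closure_eq, h2.closure_range]
  exact ⟨LinearIsometryEquiv.ofSurjective J hs, hJ, hJ'⟩

theorem gns_norm_vector {φ : A →ₚ[ℂ] ℂ} (h : IsState φ) : ‖gnsVector φ‖ = 1 := by
  have h1 := gns_state φ 1
  rw [show φ 1 = 1 from h, map_one] at h1
  change 1 = ⟪gnsVector φ, gnsVector φ⟫_ℂ at h1
  rw [inner_self_complex] at h1
  have h2 : (1 : ℝ) = ‖gnsVector φ‖ ^ 2 := by exact_mod_cast h1
  nlinarith [norm_nonneg (gnsVector φ)]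

theorem pullback_apply (φ : B →ₚ[ℂ] ℂ) (α : A →⋆ₐ[ℂ] B) (a : A) : pullback φ α a = φ (α a) := rfl

theorem isState_pullback {φ : B →ₚ[ℂ] ℂ} (h : IsState φ) (α : A →⋆ₐ[ℂ] B) :
    IsState (pullback φ α) := by
  rw [IsState, pullback_apply, map_one, h]

/-- The GNS representation of `φ ∘ α` for a surjective `α`. -/
theorem repEquiv_pullback (φ : B →ₚ[ℂ] ℂ) (α : A →⋆ₐ[ℂ] B) (hα : Function.Surjective α) :
    RepEquiv (pullback φ α).gnsStarAlgHom (φ.gnsStarAlgHom.comp α) := by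
  obtain ⟨U, -, hU⟩ := exists_gns_unitary (pullback φ α) (φ.gnsStarAlgHom.comp α) (gnsVector φ)
    (fun a => gns_state φ (α a)) ((gns_cyclic φ).comp hα.denseRange (by
      have : Continuous fun a => φ.gnsStarAlgHom a := map_continuous φ.gnsStarAlgHom
      fun_prop))
  exact ⟨U, hU⟩

/-- The functional `a ↦ ⟨ξ, π(a) ξ⟩`. -/
def vectorFunctional (π : A →⋆ₐ[ℂ] (H →L[ℂ] H)) (ξ : H) : A →ₚ[ℂ] ℂ :=
  .mk₀ { toFun := fun a => ⟪ξ, π a ξ⟫_ℂ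
         map_add' := fun a b => by simp
         map_smul' := fun r a => by simp } fun a ha => by
    obtain ⟨b, rfl⟩ := CStarAlgebra.nonneg_iff_eq_star_mul_self.1 ha
    change 0 ≤ ⟪ξ, π (star b * b) ξ⟫_ℂ
    rw [rep_mul_apply, ← inner_rep]
    exact inner_self_complex_nonneg _

end GNS

/-! ### Purity and irreducibility -/

section PureStates

variable {A : Type*} [CStarAlgebra A] [PartialOrder A]

theorem IsPureState.isState {φ : A →ₚ[ℂ] ℂ} (h : IsPureState φ) : IsState φ := by
  obtain ⟨ω, hω, he⟩ := h.1
  rwa [PositiveLinearMap.toLinearMap_inj.1 he] at hω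

/-- Pure states have no proper convex decompositions. -/
theorem IsPureState.eq_of_convex {φ ω ω' : A →ₚ[ℂ] ℂ} (h : IsPureState φ) (hω : IsState ω)
    (hω' : IsState ω') {t : ℝ} (ht : 0 < t) (ht' : t < 1)
    (he : ∀ a, (t : ℂ) * ω a + (1 - t : ℂ) * ω' a = φ a) : ω = φ := by
  refine PositiveLinearMap.toLinearMap_inj.1 (h.2 ⟨ω, hω, rfl⟩ ⟨ω', hω', rfl⟩
    ⟨t, 1 - t, ht, by linarith, by ring, LinearMap.ext fun a => ?_⟩)
  rw [LinearMap.add_apply, LinearMap.smul_apply, LinearMap.smul_apply]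
  change t • ω a + (1 - t) • ω' a = φ a
  rw [Complex.real_smul, Complex.real_smul, ← he a]
  push_cast
  ring

theorem isPureState_of {φ : A →ₚ[ℂ] ℂ} (h : IsState φ)
    (h' : ∀ ω ω' : A →ₚ[ℂ] ℂ, IsState ω → IsState ω' → ∀ t : ℝ, 0 < t → t < 1 →
      (∀ a, (t : ℂ) * ω a + (1 - t : ℂ) * ω' a = φ a) → ω = φ) : IsPureState φ := by
  refine ⟨⟨φ, h, rfl⟩, ?_⟩
  rintro _ ⟨ω, hω, rfl⟩ _ ⟨ω', hω', rfl⟩ ⟨t, s, ht, hs, hts, he⟩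
  have hs' : s = 1 - t := by linarith
  subst hs'
  rw [h' ω ω' hω hω' t ht (by linarith) fun a => ?_]
  have := LinearMap.congr_fun he a
  rw [LinearMap.add_apply, LinearMap.smul_apply, LinearMap.smul_apply] at this
  change t • ω a + (1 - t) • ω' a = φ a at this
  rw [Complex.real_smul, Complex.real_smul] at this
  rw [← this]; push_cast; rfl

variable [StarOrderedRing A]

/-- The functional `a ↦ ⟨ξ, D π(a) ξ⟩` for a positive operator `D` in the commutant. -/
def commutantFunctional {H : Type*} [NormedAddCommGroup H] [InnerProductSpace ℂ H]
    [CompleteSpace H] (π : A →⋆ₐ[ℂ] (H →L[ℂ] H)) (ξ : H) (D : H →L[ℂ] H)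
    (hD : ∀ a η, D (π a η) = π a (D η)) (hD' : ∀ η, 0 ≤ ⟪η, D η⟫_ℂ) : A →ₚ[ℂ] ℂ :=
  .mk₀ { toFun := fun a => ⟪ξ, D (π a ξ)⟫_ℂ
         map_add' := fun a b => by simp
         map_smul' := fun r a => by simp } fun a ha => by
    obtain ⟨b, rfl⟩ := CStarAlgebra.nonneg_iff_eq_star_mul_self.1 ha
    change 0 ≤ ⟪ξ, D (π (star b * b) ξ)⟫_ℂ
    rw [rep_mul_apply, hD, ← inner_rep]
    exact hD' _

/-- Ensures that perturbing a state by a selfadjoint contraction in the commutant keeps it positive.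
-/
theorem inner_one_add_nonneg {H : Type*} [NormedAddCommGroup H] [InnerProductSpace ℂ H]
    [CompleteSpace H] {Y : H →L[ℂ] H} (hY : IsSelfAdjoint Y) (hn : ‖Y‖ ≤ 1) (η : H) :
    0 ≤ ⟪η, (1 + Y) η⟫_ℂ := by
  have h1 : (starRingEnd ℂ) ⟪η, Y η⟫_ℂ = ⟪η, Y η⟫_ℂ := by
    rw [inner_conj_symm, ← ContinuousLinearMap.adjoint_inner_right,
      ← ContinuousLinearMap.star_eq_adjoint, hY.star_eq]
  obtain ⟨r, hr⟩ := Complex.conj_eq_iff_real.1 h1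
  have h2 : |r| ≤ ‖η‖ ^ 2 := by
    have h3 : ‖⟪η, Y η⟫_ℂ‖ ≤ ‖η‖ * (1 * ‖η‖) :=
      (norm_inner_le_norm _ _).trans (by gcongr; exact Y.le_of_opNorm_le hn η)
    rw [hr, Complex.norm_real, Real.norm_eq_abs] at h3
    linarith
  change 0 ≤ ⟪η, η + Y η⟫_ℂ
  rw [inner_add_right, hr, inner_self_complex]
  have h3 : 0 ≤ ‖η‖ ^ 2 + r := by linarith [neg_abs_le r]
  exact_mod_cast h3

/-- Subtract from Y its expectation and rescale to a contraction sY₀. The operators 1 ± sY₀ give two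
states averaging to φ, so both equal φ; then Y₀Ω is orthogonal to the cyclic orbit, and Y₀ = 0. -/
theorem IsPureState.selfAdjoint_commutant {φ : A →ₚ[ℂ] ℂ} (h : IsPureState φ)
    {H : Type*} [NormedAddCommGroup H] [InnerProductSpace ℂ H] [CompleteSpace H]
    {π : A →⋆ₐ[ℂ] (H →L[ℂ] H)} {Ω : H} (hφΩ : ∀ a, φ a = ⟪Ω, π a Ω⟫_ℂ)
    (hcyc : DenseRange fun a => π a Ω) {Y : H →L[ℂ] H} (hY : IsSelfAdjoint Y)
    (hc : ∀ a ξ, Y (π a ξ) = π a (Y ξ)) : ∃ z : ℂ, Y = z • 1 := by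
  have hφ : φ 1 = 1 := h.isState
  have hΩ : ⟪Ω, Ω⟫_ℂ = 1 := by
    rw [← hφ, hφΩ, map_one]; rfl
  have hz : (starRingEnd ℂ) ⟪Ω, Y Ω⟫_ℂ = ⟪Ω, Y Ω⟫_ℂ := by
    rw [inner_conj_symm, ← ContinuousLinearMap.adjoint_inner_right,
      ← ContinuousLinearMap.star_eq_adjoint, hY.star_eq]
  set z := ⟪Ω, Y Ω⟫_ℂ
  refine ⟨z, ?_⟩
  have hzs : IsSelfAdjoint z := hz
  set Y₀ := Y - z • (1 : H →L[ℂ] H) with hY₀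
  have hs₀ : IsSelfAdjoint Y₀ := hY.sub (hzs.smul (IsSelfAdjoint.one _))
  have hc₀ : ∀ a ξ, Y₀ (π a ξ) = π a (Y₀ ξ) := fun a ξ => by
    change Y _ - z • _ = π a (Y ξ - z • ξ)
    rw [hc, map_sub, map_smul]; rfl
  have h₀ : ⟪Ω, Y₀ Ω⟫_ℂ = 0 := by
    change ⟪Ω, Y Ω - z • Ω⟫_ℂ = 0
    rw [inner_sub_right, inner_smul_right, hΩ, mul_one, sub_self]
  -- The 1 in the denominator avoids a case distinction when Y₀ = 0.
  obtain ⟨s, hs, hsn⟩ : ∃ s : ℝ, 0 < s ∧ ‖(s : ℂ) • Y₀‖ ≤ 1 := by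
    refine ⟨(1 + ‖Y₀‖)⁻¹, by positivity, ?_⟩
    rw [norm_smul, Complex.norm_real, Real.norm_of_nonneg (by positivity),
      inv_mul_le_one₀ (by positivity)]
    linarith
  have hst : IsSelfAdjoint ((s : ℂ) • Y₀) :=
    IsSelfAdjoint.smul (show IsSelfAdjoint (s : ℂ) from Complex.conj_ofReal s) hs₀
  have hst' : IsSelfAdjoint (-((s : ℂ) • Y₀)) := hst.neg
  let ω := commutantFunctional π Ω (1 + (s : ℂ) • Y₀)
    (fun a η => by
      change _ + (s : ℂ) • Y₀ _ = π a (η + (s : ℂ) • Y₀ η)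
      rw [hc₀, map_add, map_smul]; rfl) (inner_one_add_nonneg hst hsn)
  let ω' := commutantFunctional π Ω (1 + -((s : ℂ) • Y₀))
    (fun a η => by
      change _ + -((s : ℂ) • Y₀ _) = π a (η + -((s : ℂ) • Y₀ η))
      rw [hc₀, map_add, map_neg, map_smul]; rfl) (inner_one_add_nonneg hst' (by rwa [norm_neg]))
  have hω : ∀ a, ω a = φ a + s * ⟪Ω, Y₀ (π a Ω)⟫_ℂ := fun a => by
    change ⟪Ω, π a Ω + (s : ℂ) • Y₀ (π a Ω)⟫_ℂ = _
    rw [inner_add_right, inner_smul_right, ← hφΩ]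
  have hω' : ∀ a, ω' a = φ a - s * ⟪Ω, Y₀ (π a Ω)⟫_ℂ := fun a => by
    change ⟪Ω, π a Ω + -((s : ℂ) • Y₀ (π a Ω))⟫_ℂ = _
    rw [inner_add_right, inner_neg_right, inner_smul_right, ← hφΩ, sub_eq_add_neg]
  have hone : ⟪Ω, Y₀ (π 1 Ω)⟫_ℂ = 0 := by rw [map_one]; exact h₀
  have he : ω = φ := h.eq_of_convex (ω' := ω') (t := 1 / 2)
    (by rw [IsState, hω, hone, hφ]; simp) (by rw [IsState, hω', hone, hφ]; simp)
    (by norm_num) (by norm_num) fun a => by rw [hω, hω']; push_cast; ring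
  have hperp : ∀ a, ⟪Y₀ Ω, π a Ω⟫_ℂ = 0 := fun a => by
    have h1 := hω a
    rw [he] at h1
    have h2 : (s : ℂ) * ⟪Ω, Y₀ (π a Ω)⟫_ℂ = 0 := by linear_combination -h1
    have h3 := (mul_eq_zero.1 h2).resolve_left (by exact_mod_cast hs.ne')
    rw [← h3, ← ContinuousLinearMap.adjoint_inner_left Y₀, ← ContinuousLinearMap.star_eq_adjoint,
      hs₀.star_eq]
  have hYΩ : Y₀ Ω = 0 :=
    inner_self_eq_zero.1 (congrFun (hcyc.equalizer (g := fun η => ⟪Y₀ Ω, η⟫_ℂ) (h := fun _ => 0)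
      (by fun_prop) (by fun_prop) (funext hperp)) (Y₀ Ω))
  have hY0 : (Y₀ : H → H) = fun _ => 0 :=
    hcyc.equalizer Y₀.continuous continuous_const (funext fun a => by
      change Y₀ (π a Ω) = 0
      rw [hc₀, hYΩ, map_zero])
  exact sub_eq_zero.1 (ContinuousLinearMap.ext fun η => congrFun hY0 η)

/-- The GNS representation of a pure state is irreducible. -/
theorem IsPureState.irreducible {φ : A →ₚ[ℂ] ℂ} (h : IsPureState φ) :
    IrreducibleRep φ.gnsStarAlgHom := by
  intro Y hY
  have hY' : ∀ a ξ, (star Y) (φ.gnsStarAlgHom a ξ) = φ.gnsStarAlgHom a (star Y ξ) :=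
    intertwiner_adjoint Y hY
  -- The selfadjoint case applies to Y + Y^* and i(Y - Y^*), from which Y is recovered.
  obtain ⟨z, hz⟩ := h.selfAdjoint_commutant (gns_state φ) (gns_cyclic φ) (Y := Y + star Y) 
    (IsSelfAdjoint.add_star_self Y)
    fun a ξ => by simp only [add_apply, hY, hY', map_add]
  obtain ⟨w, hw⟩ := h.selfAdjoint_commutant (gns_state φ) (gns_cyclic φ) (Y := Complex.I • (Y - star Y))
    (by simp [IsSelfAdjoint, add_comm, sub_eq_add_neg])
    fun a ξ => by
      simp only [smul_apply, sub_apply, hY, hY', map_sub,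
        map_smul]
  refine ⟨(z - Complex.I * w) / 2, ?_⟩
  have e : Y = (1 / 2 : ℂ) • ((Y + star Y) + (-Complex.I) • (Complex.I • (Y - star Y))) := by
    rw [smul_smul, neg_mul, Complex.I_mul_I, neg_neg, one_smul, add_add_sub_cancel, ← two_smul ℂ,
      smul_smul]
    norm_num
  rw [e, hz, hw, smul_smul, ← add_smul, smul_smul]
  congr 1
  ring

/-- A state with irreducible GNS representation is pure. -/
theorem isPureState_of_irreducible {φ : A →ₚ[ℂ] ℂ} (h : IsState φ)
    (hi : IrreducibleRep φ.gnsStarAlgHom) : IsPureState φ := by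
  refine isPureState_of h fun ω ω' hω hω' t ht ht' he => ?_
  have hle : ∀ a : A, t * (ω (star a * a)).re ≤ (φ (star a * a)).re := fun a => by
    have h1 : 0 ≤ (ω' (star a * a)).re :=
      (Complex.nonneg_iff.1 (ω'.map_nonneg (star_mul_self_nonneg a))).1
    have h2 := congrArg Complex.re (he (star a * a))
    have h3 : (1 - t : ℂ) = ((1 - t : ℝ) : ℂ) := by push_cast; rfl
    rw [h3, Complex.add_re, Complex.re_ofReal_mul, Complex.re_ofReal_mul] at h2
    nlinarith
  let f : φ.PreGNS →ₗ[ℂ] ω.PreGNS := ω.toPreGNS.toLinearMap ∘ₗ φ.ofPreGNS.toLinearMap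
  -- Since tω ≤ φ, the identity of A is bounded by t^{-1/2} between the two GNS norms. The resulting
  -- intertwiner V has V^*V scalar, which makes ω proportional to φ.
  let F : φ.PreGNS →L[ℂ] ω.PreGNS := f.mkContinuous (Real.sqrt t⁻¹) fun a => by
    rw [ω.preGNS_norm_def, φ.preGNS_norm_def, ← Real.sqrt_mul (by positivity)]
    refine Real.sqrt_le_sqrt ?_
    rw [inv_mul_eq_div, le_div_iff₀ ht, mul_comm]
    exact hle (φ.ofPreGNS a)
  let V : φ.GNS →L[ℂ] ω.GNS := F.completion
  have hV : ∀ a, V (φ.gnsStarAlgHom a (gnsVector φ)) = ω.gnsStarAlgHom a (gnsVector ω) :=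
    fun a => by
      rw [gns_apply_vector, gns_apply_vector]
      exact F.completion_apply_coe _
  have hVc : ∀ a ξ, V (φ.gnsStarAlgHom a ξ) = ω.gnsStarAlgHom a (V ξ) := fun a =>
    congrFun (gns_ext φ (f := fun ξ => V (φ.gnsStarAlgHom a ξ))
      (g := fun ξ => ω.gnsStarAlgHom a (V ξ)) (by fun_prop) (by fun_prop) fun b => by
        rw [← rep_mul_apply, hV, hV, rep_mul_apply])
  have hV' := intertwiner_adjoint V hVc
  obtain ⟨z, hz⟩ := hi (V.adjoint ∘L V) fun a ξ => by
    simp only [ContinuousLinearMap.comp_apply, hVc, hV']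
  have hz' : ∀ ξ, V.adjoint (V ξ) = z • ξ := fun ξ => congrArg (fun Y => Y ξ) hz
  have hV1 : V (gnsVector φ) = gnsVector ω := by simpa using hV 1
  have hω1 : ∀ a, ω a = z * φ a := fun a => by
    rw [gns_state ω, gns_state φ, ← hV, ← hV1, ← ContinuousLinearMap.adjoint_inner_right, hz',
      inner_smul_right]
  have hz1 : z = 1 := by
    have h1 := hω1 1
    rw [show ω 1 = 1 from hω, show φ 1 = 1 from h, mul_one] at h1
    exact h1.symm
  ext a
  rw [hω1, hz1, one_mul]

end PureStates

/-! ### Graded extensions by an odd selfadjoint unitary -/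

/-- A `ℤ₂`-graded `C*`-algebra `B` with grading automorphism `θ` and even part `E`, generated by `E`
and an odd selfadjoint unitary `u`; `P` is the projection onto the even part and `β` the action of
`u` on `E` by conjugation. -/
structure GradedExtension (E B : Type*) [CStarAlgebra E] [PartialOrder E] [CStarAlgebra B]
    [PartialOrder B] where
  ι : E →⋆ₐ[ℂ] B
  θ : B →⋆ₐ[ℂ] B
  P : B →ₚ[ℂ] E
  β : E →⋆ₐ[ℂ] E
  u : B
  P_ι : ∀ a, P (ι a) = a
  ι_P : ∀ b, (2 : ℂ) • ι (P b) = b + θ b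
  θ_u : θ u = -u
  star_u : star u = u
  u_mul_u : u * u = 1
  ι_β : ∀ a, ι (β a) = u * ι a * u

namespace GradedExtension

variable {E B : Type*} [CStarAlgebra E] [PartialOrder E] [CStarAlgebra B] [PartialOrder B]

section Algebra

variable (G : GradedExtension E B)

theorem ι_injective : Function.Injective G.ι := fun a b h => by
  rw [← G.P_ι a, h, G.P_ι]

/-- The structure specifies P through 2 ι P = id + θ, so identities in E are checked in B after
doubling. -/
theorem eq_of_two_smul {a b : E} (h : (2 : ℂ) • G.ι a = (2 : ℂ) • G.ι b) : a = b :=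
  G.ι_injective (smul_right_injective B (two_ne_zero : (2 : ℂ) ≠ 0) h)

theorem θ_ι (a : E) : G.θ (G.ι a) = G.ι a := by
  have h := G.ι_P (G.ι a)
  rw [G.P_ι, two_smul] at h
  exact (add_left_cancel h).symm

theorem θ_θ (b : B) : G.θ (G.θ b) = b := by
  have h : G.θ (b + G.θ b) = b + G.θ b := by rw [← G.ι_P, map_smul, θ_ι]
  rw [map_add, add_comm b] at h
  exact add_left_cancel h

theorem P_θ (b : B) : G.P (G.θ b) = G.P b := by
  refine G.eq_of_two_smul ?_
  rw [G.ι_P, G.ι_P, θ_θ, add_comm]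

theorem P_odd {b : B} (hb : G.θ b = -b) : G.P b = 0 := by
  refine G.eq_of_two_smul ?_
  rw [G.ι_P, hb, add_neg_cancel, map_zero, smul_zero]

theorem θ_ι_mul_u (a : E) : G.θ (G.ι a * G.u) = -(G.ι a * G.u) := by
  rw [map_mul, G.θ_u, θ_ι, mul_neg]

theorem P_ι_mul_u (a : E) : G.P (G.ι a * G.u) = 0 := G.P_odd (G.θ_ι_mul_u a)

theorem two_ι_P_mul_u (b : B) : (2 : ℂ) • G.ι (G.P (b * G.u)) = (b - G.θ b) * G.u := by
  rw [G.ι_P, map_mul, G.θ_u]; noncomm_ring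

/-- As u is odd with u² = 1, the coefficient of u is the even part of b u. Thus B = E ⊕ E u. -/
theorem decomp (b : B) : b = G.ι (G.P b) + G.ι (G.P (b * G.u)) * G.u := by
  refine smul_right_injective B (two_ne_zero : (2 : ℂ) ≠ 0) ?_
  change (2 : ℂ) • b = (2 : ℂ) • (_ + _)
  rw [smul_add, G.ι_P, ← smul_mul_assoc, two_ι_P_mul_u, mul_assoc, G.u_mul_u, two_smul]
  noncomm_ring

theorem u_mul_ι (a : E) : G.u * G.ι a = G.ι (G.β a) * G.u := by
  rw [G.ι_β, mul_assoc, G.u_mul_u, mul_one]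

theorem β_β (a : E) : G.β (G.β a) = a := by
  refine G.ι_injective ?_
  rw [G.ι_β, G.ι_β, mul_assoc, mul_assoc, G.u_mul_u, mul_one, ← mul_assoc, G.u_mul_u, one_mul]

theorem β_surjective : Function.Surjective G.β := fun a => ⟨G.β a, G.β_β a⟩

theorem P_one : G.P 1 = 1 := by rw [← map_one G.ι, G.P_ι]

/-- The even part of (x + y u)(x' + y' u) is x x' + y (u y' u), and u acts on E by β. -/
theorem P_mul (b c : B) :
    G.P (b * c) = G.P b * G.P c + G.P (b * G.u) * G.β (G.P (c * G.u)) := by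
  have h : ∀ x y : E, (2 : ℂ) • x = (2 : ℂ) • y → x = y := fun x y h =>
    smul_right_injective E (two_ne_zero : (2 : ℂ) ≠ 0) h
  refine h _ _ (G.eq_of_two_smul ?_)
  rw [map_smul, G.ι_P, map_smul, map_add, map_mul G.θ, map_mul G.ι, map_mul G.ι, G.ι_β]
  -- One factor 2 for each of the two projections, so that no halves occur.
  have e1 : (2 : ℂ) • (2 : ℂ) • (G.ι (G.P b) * G.ι (G.P c)) = (b + G.θ b) * (c + G.θ c) := by
    rw [← G.ι_P, ← G.ι_P c, smul_mul_smul_comm, smul_smul]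
  have e2 : (2 : ℂ) • (2 : ℂ) • (G.ι (G.P (b * G.u)) * (G.u * G.ι (G.P (c * G.u)) * G.u)) =
      (b - G.θ b) * (c - G.θ c) := by
    have h1 : (2 : ℂ) • (2 : ℂ) • (G.ι (G.P (b * G.u)) * (G.u * G.ι (G.P (c * G.u)) * G.u)) =
        ((2 : ℂ) • G.ι (G.P (b * G.u))) * (G.u * ((2 : ℂ) • G.ι (G.P (c * G.u))) * G.u) := by
      simp only [mul_smul_comm, smul_mul_assoc]
    rw [h1, two_ι_P_mul_u, two_ι_P_mul_u]
    calc (b - G.θ b) * G.u * (G.u * ((c - G.θ c) * G.u) * G.u)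
        = (b - G.θ b) * (G.u * G.u) * (c - G.θ c) * (G.u * G.u) := by noncomm_ring
      _ = _ := by rw [G.u_mul_u, mul_one, mul_one]
  conv_rhs => rw [smul_add, smul_add, e1, e2]
  rw [two_smul]
  noncomm_ring

theorem P_mul_u (b c : B) :
    G.P (b * c * G.u) = G.P b * G.P (c * G.u) + G.P (b * G.u) * G.β (G.P c) := by
  rw [mul_assoc b, P_mul, mul_assoc c, G.u_mul_u, mul_one]

theorem P_star (b : B) : G.P (star b) = star (G.P b) := by
  refine G.eq_of_two_smul ?_
  rw [G.ι_P, map_star, map_star, ← star_add, ← G.ι_P, star_smul]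
  simp

/-- The adjoint of y u is u y^* = β(y^*) u. With `P_star` this is what makes `crossedRep` a
*-homomorphism. -/
theorem P_star_mul_u (b : B) : G.P (star b * G.u) = G.β (star (G.P (b * G.u))) := by
  refine G.eq_of_two_smul ?_
  have h : (2 : ℂ) • star (G.ι (G.P (b * G.u))) = star ((b - G.θ b) * G.u) := by
    rw [← two_ι_P_mul_u, star_smul]; simp
  rw [two_ι_P_mul_u, G.ι_β, map_star G.ι, ← smul_mul_assoc, ← mul_smul_comm, h, star_mul, G.star_u,
    ← mul_assoc, G.u_mul_u, one_mul, star_sub, map_star G.θ]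

end Algebra

variable (G : GradedExtension E B)
variable {H : Type*} [NormedAddCommGroup H] [InnerProductSpace ℂ H] [CompleteSpace H]

/-- The representation of `B` determined by a representation of `E` and a selfadjoint unitary
implementing `β`. -/
def crossedRep (π : E →⋆ₐ[ℂ] (H →L[ℂ] H)) (W : H →L[ℂ] H) (hs : star W = W) (hW : W * W = 1)
    (hβ : ∀ a, W * π a = π (G.β a) * W) : B →⋆ₐ[ℂ] (H →L[ℂ] H) where
  toFun b := π (G.P b) + π (G.P (b * G.u)) * W
  map_one' := by
    have h : G.P (1 * G.u) = 0 := by rw [← map_one G.ι, P_ι_mul_u]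
    rw [h, G.P_one]; simp
  map_mul' b c := by
    rw [P_mul, P_mul_u]
    simp only [map_add, map_mul, add_mul, mul_add]
    have e1 : π (G.P b) * (π (G.P (c * G.u)) * W) = π (G.P b) * π (G.P (c * G.u)) * W :=
      (mul_assoc _ _ _).symm
    have e2 : π (G.P (b * G.u)) * W * π (G.P c) =
        π (G.P (b * G.u)) * π (G.β (G.P c)) * W := by
      rw [mul_assoc, hβ, mul_assoc]
    have e3 : π (G.P (b * G.u)) * W * (π (G.P (c * G.u)) * W) =
        π (G.P (b * G.u)) * π (G.β (G.P (c * G.u))) := by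
      rw [mul_assoc, ← mul_assoc W, hβ, mul_assoc _ W, hW, mul_one]
    rw [e1, e2, e3]; abel
  map_zero' := by simp
  map_add' b c := by simp only [add_mul, map_add]; abel
  commutes' r := by
    have h : G.P (algebraMap ℂ B r * G.u) = 0 := by
      rw [← AlgHomClass.commutes G.ι r, P_ι_mul_u]
    rw [h, ← AlgHomClass.commutes G.ι r, G.P_ι, map_zero, zero_mul, add_zero,
      AlgHomClass.commutes π r]
  map_star' b := by
    rw [P_star, P_star_mul_u, star_add, star_mul, hs, ← map_star π, ← map_star π, hβ]

theorem crossedRep_apply (π : E →⋆ₐ[ℂ] (H →L[ℂ] H)) (W : H →L[ℂ] H) (hs : star W = W)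
    (hW : W * W = 1) (hβ : ∀ a, W * π a = π (G.β a) * W) (b : B) :
    G.crossedRep π W hs hW hβ b = π (G.P b) + π (G.P (b * G.u)) * W := rfl

theorem crossedRep_ι (π : E →⋆ₐ[ℂ] (H →L[ℂ] H)) (W : H →L[ℂ] H) (hs : star W = W)
    (hW : W * W = 1) (hβ : ∀ a, W * π a = π (G.β a) * W) (a : E) :
    G.crossedRep π W hs hW hβ (G.ι a) = π a := by
  rw [crossedRep_apply, G.P_ι, P_ι_mul_u, map_zero, zero_mul, add_zero]

theorem crossedRep_ι_mul_u (π : E →⋆ₐ[ℂ] (H →L[ℂ] H)) (W : H →L[ℂ] H) (hs : star W = W)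
    (hW : W * W = 1) (hβ : ∀ a, W * π a = π (G.β a) * W) (a : E) :
    G.crossedRep π W hs hW hβ (G.ι a * G.u) = π a * W := by
  rw [crossedRep_apply, P_ι_mul_u, mul_assoc, G.u_mul_u, mul_one, G.P_ι, map_zero, zero_add]

/-- The compression X = J^* ρ(u) J works because J^* is also an intertwiner and u ι(a) = ι(β a) u.
It records the odd part of every vector state coming from the range of J, so Schur's lemma can force
that part to vanish. -/
theorem compression_intertwiner {H K : Type*} [NormedAddCommGroup H] [InnerProductSpace ℂ H]
    [CompleteSpace H] [NormedAddCommGroup K] [InnerProductSpace ℂ K] [CompleteSpace K]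
    {π : E →⋆ₐ[ℂ] (H →L[ℂ] H)} {ρ : B →⋆ₐ[ℂ] (K →L[ℂ] K)} (J : H →L[ℂ] K)
    (hJ : ∀ a ξ, J (π a ξ) = ρ (G.ι a) (J ξ)) :
    ∃ X : H →L[ℂ] H, (∀ a ξ, X (π a ξ) = π (G.β a) (X ξ)) ∧
      ∀ a ξ, ⟪ξ, π a (X ξ)⟫_ℂ = ⟪J ξ, ρ (G.ι a * G.u) (J ξ)⟫_ℂ := by
  have hJ2 : ∀ a ξ, J.adjoint (ρ (G.ι a) ξ) = π a (J.adjoint ξ) :=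
    intertwiner_adjoint (ρ := ρ.comp G.ι) J hJ
  refine ⟨J.adjoint ∘L ρ G.u ∘L J, fun a ξ => ?_, fun a ξ => ?_⟩
  · simp only [ContinuousLinearMap.comp_apply]
    rw [hJ, ← rep_mul_apply, u_mul_ι, rep_mul_apply, hJ2]
  · simp only [ContinuousLinearMap.comp_apply]
    rw [← hJ2, ContinuousLinearMap.adjoint_inner_right, ← rep_mul_apply]

theorem isState_comp_P {ω : E →ₚ[ℂ] ℂ} (h : IsState ω) : IsState (ω.comp G.P) := by
  change ω (G.P 1) = 1
  rw [G.P_one, h]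

end GradedExtension

/-- An automorphism of order two that is unitarily implemented in an irreducible representation
is implemented by a selfadjoint unitary. -/
theorem exists_selfAdjoint_implementer {E : Type*} [CStarAlgebra E] {H : Type*}
    [NormedAddCommGroup H] [InnerProductSpace ℂ H] [CompleteSpace H] {π : E →⋆ₐ[ℂ] (H →L[ℂ] H)}
    (hi : IrreducibleRep π) {Ω : H} (hΩ : Ω ≠ 0) {β : E →⋆ₐ[ℂ] E} (hβ : ∀ a, β (β a) = a)
    (h : RepEquiv π (π.comp β)) :
    ∃ W : H →L[ℂ] H, star W = W ∧ W * W = 1 ∧ ∀ a, W * π a = π (β a) * W := by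
  obtain ⟨U, hU⟩ := h
  have hU' : ∀ a ξ, U (π a ξ) = π (β a) (U ξ) := hU
  let V : H →L[ℂ] H := (U : H →L[ℂ] H)
  have hV : ∀ ξ, V ξ = U ξ := fun ξ => rfl
  -- Since β² = 1, the square of the implementing unitary lies in the commutant, hence is a scalar,
  -- of modulus one.
  obtain ⟨z, hz⟩ := hi (V * V) fun a ξ => by
    change U (U (π a ξ)) = π a (U (U ξ))
    rw [hU', hU', hβ]
  have hz' : ∀ ξ, U (U ξ) = z • ξ := fun ξ => congrArg (fun Y => Y ξ) hz
  have hzn : ‖z‖ = 1 := by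
    have h1 := congrArg norm (hz' Ω)
    rw [U.norm_map, U.norm_map, norm_smul] at h1
    exact (mul_eq_right₀ (norm_ne_zero_iff.2 hΩ)).1 h1.symm
  -- Rescaling by a square root of z⁻¹, again of modulus one, makes the square equal to 1.
  obtain ⟨s, hs⟩ := IsAlgClosed.exists_pow_nat_eq z⁻¹ (n := 2) (by norm_num)
  have hsn : ‖s‖ = 1 := by
    have h1 := congrArg norm hs
    rw [norm_pow, norm_inv, hzn, inv_one] at h1
    exact (pow_eq_one_iff_of_nonneg (norm_nonneg s) (by norm_num)).1 h1
  have hz0 : z ≠ 0 := norm_ne_zero_iff.1 (by rw [hzn]; norm_num)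
  have hW : (s • V) * (s • V) = 1 := by
    rw [smul_mul_smul_comm, hz, smul_smul, ← sq, hs, inv_mul_cancel₀ hz0, one_smul]
  have hW' : star (s • V) * (s • V) = 1 := by
    rw [ContinuousLinearMap.star_eq_adjoint]
    refine (ContinuousLinearMap.norm_map_iff_adjoint_comp_self _).1 fun ξ => ?_
    change ‖s • U ξ‖ = ‖ξ‖
    rw [norm_smul, hsn, U.norm_map, one_mul]
  refine ⟨s • V, ?_, hW, fun a => ?_⟩
  -- A unitary with square one is its own adjoint.
  · rw [← mul_one (star (s • V)), ← hW, ← mul_assoc, hW', one_mul]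
  · refine ContinuousLinearMap.ext fun ξ => ?_
    change s • U (π a ξ) = π (β a) (s • U ξ)
    rw [hU', map_smul]

namespace GradedExtension

variable {E B : Type*} [CStarAlgebra E] [PartialOrder E]
  [CStarAlgebra B] [PartialOrder B] [StarOrderedRing B] (G : GradedExtension E B)

theorem pullback_comp_P_θ (ω : E →ₚ[ℂ] ℂ) : pullback (ω.comp G.P) G.θ = ω.comp G.P := by
  ext b
  change ω (G.P (G.θ b)) = ω (G.P b)
  rw [P_θ]

variable [StarOrderedRing E]

theorem pullback_comp_P_ι (ω : E →ₚ[ℂ] ℂ) : pullback (ω.comp G.P) G.ι = ω := by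
  ext b
  change ω (G.P (G.ι b)) = ω b
  rw [G.P_ι]

/-- Averaging any extension of ω over θ gives the invariant extension ω ∘ P. -/
theorem average_eq {φ : B →ₚ[ℂ] ℂ} {ω : E →ₚ[ℂ] ℂ} (hω : pullback φ G.ι = ω) (b : B) :
    φ b + φ (G.θ b) = 2 * ω (G.P b) := by
  rw [← hω, pullback_apply, ← smul_eq_mul, ← map_smul, G.ι_P, map_add]

/-- The `θ`-invariant extension of a functional on the even part is unique. -/
theorem eq_comp_P {φ : B →ₚ[ℂ] ℂ} {ω : E →ₚ[ℂ] ℂ} (hφ : pullback φ G.θ = φ)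
    (hω : pullback φ G.ι = ω) : φ = ω.comp G.P := by
  ext b
  have h1 := G.average_eq hω b
  have h2 : φ (G.θ b) = φ b := congrArg (fun f : B →ₚ[ℂ] ℂ => f b) hφ
  rw [h2] at h1
  change φ b = ω (G.P b)
  linear_combination h1 / 2

/-- The restriction of a pure `θ`-invariant state to the even part is pure. -/
theorem isPureState_of_comp_P {ω : E →ₚ[ℂ] ℂ} (h : IsPureState (ω.comp G.P)) :
    IsPureState ω := by
  have h1 : IsState ω := by
    have := isState_pullback h.isState G.ι
    rwa [pullback_comp_P_ι] at this
  refine isPureState_of h1 fun ω₁ ω₂ h₁ h₂ t ht ht' he => ?_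
  -- Composing with P turns a convex decomposition of ω into one of ω ∘ P.
  have h2 := h.eq_of_convex (G.isState_comp_P h₁) (G.isState_comp_P h₂) ht ht' fun b => he (G.P b)
  rw [← G.pullback_comp_P_ι ω₁, h2, pullback_comp_P_ι]

/-- Every extension of `ω` is given on the odd part by a bounded operator implementing `β`. -/
theorem exists_intertwiner {φ : B →ₚ[ℂ] ℂ} {ω : E →ₚ[ℂ] ℂ} (hω : pullback φ G.ι = ω) :
    ∃ X : ω.GNS →L[ℂ] ω.GNS,
      (∀ a ξ, X (ω.gnsStarAlgHom a ξ) = ω.gnsStarAlgHom (G.β a) (X ξ)) ∧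
      ∀ a, φ (G.ι a * G.u) = ⟪gnsVector ω, ω.gnsStarAlgHom a (X (gnsVector ω))⟫_ℂ := by
  obtain ⟨J, hJ, hJ'⟩ := exists_gns_isometry ω (φ.gnsStarAlgHom.comp G.ι) (gnsVector φ)
    fun a => by rw [← hω, pullback_apply, gns_state]; rfl
  obtain ⟨X, hX, hX'⟩ := G.compression_intertwiner (π := ω.gnsStarAlgHom)
    (ρ := φ.gnsStarAlgHom) J.toContinuousLinearMap hJ'
  refine ⟨X, hX, fun a => ?_⟩
  rw [hX', LinearIsometry.coe_toContinuousLinearMap, hJ, ← gns_state]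

/-- The invariant extension of a pure state `ω` that is not equivalent to `ω ∘ β` is pure. -/
theorem isPureState_comp_P {ω : E →ₚ[ℂ] ℂ} (hp : IsPureState ω)
    (hne : ¬ RepEquiv ω.gnsStarAlgHom (ω.gnsStarAlgHom.comp G.β)) :
    IsPureState (ω.comp G.P) := by
  refine isPureState_of (G.isState_comp_P hp.isState) fun φ₁ φ₂ h₁ h₂ t ht ht' he => ?_
  -- The components agree with ω on E because ω is pure; only their odd parts could differ.
  have hφ₁ : pullback φ₁ G.ι = ω :=
    hp.eq_of_convex (isState_pullback h₁ G.ι) (isState_pullback h₂ G.ι) ht ht' fun a => by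
      have := he (G.ι a)
      change _ = ω (G.P (G.ι a)) at this
      rwa [G.P_ι] at this
  obtain ⟨X, hX, hX'⟩ := G.exists_intertwiner hφ₁
  have hX0 : X = 0 := by
    by_contra h0
    exact hne (RepEquiv.of_intertwiner hp.irreducible
      (hp.irreducible.comp_surjective G.β G.β_surjective) X hX h0)
  ext b
  have h1 : φ₁ (G.ι (G.P b)) = ω (G.P b) := by rw [← hφ₁]; rfl
  conv_lhs => rw [G.decomp b]
  rw [map_add, h1, hX', hX0, zero_apply, map_zero, inner_zero_right, add_zero]
  rfl

/-- If a pure state `ω` is equivalent to `ω ∘ β`, it has an extension to `B` living on the same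
Hilbert space, which is not `θ`-invariant. -/
theorem exists_extension_of_equiv {ω : E →ₚ[ℂ] ℂ} (hp : IsPureState ω)
    (he : RepEquiv ω.gnsStarAlgHom (ω.gnsStarAlgHom.comp G.β)) :
    ∃ φ : B →ₚ[ℂ] ℂ, IsState φ ∧ pullback φ G.ι = ω ∧ pullback φ G.θ ≠ φ ∧
      ∃ U : ω.GNS ≃ₗᵢ[ℂ] φ.GNS, U (gnsVector ω) = gnsVector φ ∧
        ∀ a ξ, U (ω.gnsStarAlgHom a ξ) = φ.gnsStarAlgHom (G.ι a) (U ξ) := by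
  have hΩ : gnsVector ω ≠ 0 := norm_ne_zero_iff.1 (by rw [gns_norm_vector hp.isState]; norm_num)
  obtain ⟨W, hs, hW, hβ⟩ := exists_selfAdjoint_implementer hp.irreducible hΩ G.β_β he
  set ρ := G.crossedRep ω.gnsStarAlgHom W hs hW hβ with hρ
  have hρι : ∀ a, ρ (G.ι a) = ω.gnsStarAlgHom a := G.crossedRep_ι _ W hs hW hβ
  have hρu : ∀ a, ρ (G.ι a * G.u) = ω.gnsStarAlgHom a * W := G.crossedRep_ι_mul_u _ W hs hW hβ
  set φ := vectorFunctional ρ (gnsVector ω) with hφ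
  have hφa : ∀ b, φ b = ⟪gnsVector ω, ρ b (gnsVector ω)⟫_ℂ := fun b => rfl
  have hφι : pullback φ G.ι = ω := by
    ext a
    rw [pullback_apply, hφa, hρι, ← gns_state]
  -- The orbit of E alone is dense, so the GNS space of φ is that of ω.
  have hcyc : DenseRange fun b => ρ b (gnsVector ω) := by
    refine Dense.mono ?_ (gns_cyclic ω)
    rintro _ ⟨a, rfl⟩
    exact ⟨G.ι a, by simp only [hρι]⟩
  obtain ⟨U, hU, hU'⟩ := exists_gns_unitary φ ρ (gnsVector ω) hφa hcyc
  refine ⟨φ, ?_, hφι, fun hinv => ?_, U.symm, ?_, fun a ξ => ?_⟩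
  · have h1 : φ 1 = ω 1 := by rw [← hφι, pullback_apply, map_one G.ι]
    rw [IsState, h1, hp.isState]
  -- Invariance would kill φ on E u, making WΩ orthogonal to the cyclic orbit; but W is invertible.
  · have h0 : ∀ a, ⟪W (gnsVector ω), ω.gnsStarAlgHom a (gnsVector ω)⟫_ℂ = 0 := fun a => by
      have h1 : φ (G.θ (G.ι (star a) * G.u)) = φ (G.ι (star a) * G.u) :=
        congrArg (fun f : B →ₚ[ℂ] ℂ => f (G.ι (star a) * G.u)) hinv
      rw [θ_ι_mul_u, map_neg] at h1
      have h2 : φ (G.ι (star a) * G.u) = 0 := by linear_combination -h1 / 2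
      rw [hφa, hρu] at h2
      change ⟪gnsVector ω, ω.gnsStarAlgHom (star a) (W (gnsVector ω))⟫_ℂ = 0 at h2
      rw [← inner_rep] at h2
      rw [← inner_conj_symm, h2, map_zero]
    have h1 : W (gnsVector ω) = 0 :=
      inner_self_eq_zero.1 (congrFun (gns_ext ω (f := fun η => ⟪W (gnsVector ω), η⟫_ℂ)
        (g := fun _ => 0) (by fun_prop) (by fun_prop) h0) (W (gnsVector ω)))
    have h2 : (W * W) (gnsVector ω) = 0 := by
      change W (W (gnsVector ω)) = 0
      rw [h1, map_zero]
    rw [hW] at h2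
    exact hΩ h2
  · rw [LinearIsometryEquiv.symm_apply_eq, hU]
  · rw [LinearIsometryEquiv.symm_apply_eq, hU', hρι, LinearIsometryEquiv.apply_symm_apply]

/-- If `ω ∘ P` is pure, `ω` is not equivalent to `ω ∘ β`. -/
theorem not_repEquiv_of_isPureState {ω : E →ₚ[ℂ] ℂ} (h : IsPureState (ω.comp G.P)) :
    ¬ RepEquiv ω.gnsStarAlgHom (ω.gnsStarAlgHom.comp G.β) := fun he => by
  obtain ⟨φ, hφ, hι, hθ, -⟩ := G.exists_extension_of_equiv (G.isPureState_of_comp_P h) he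
  -- ω ∘ P is the midpoint of φ and φ ∘ θ, so purity would make φ invariant.
  have h1 : φ = ω.comp G.P := h.eq_of_convex (t := 1 / 2) hφ (isState_pullback hφ G.θ)
    (by norm_num) (by norm_num) fun b => by
      have := G.average_eq hι b
      change _ = ω (G.P b)
      rw [pullback_apply]
      push_cast
      linear_combination this / 2
  exact hθ (by rw [h1, pullback_comp_P_θ])

end GradedExtension

namespace JordanWigner

/-! The even parts of the CAR algebra and of the spin algebra coincide -/

/-- The elements `Q` with even part in `A` and odd part in `T A`. -/
def twistedAlgebra (A : StarSubalgebra ℂ Op) (hA : ∀ Q ∈ A, Θm Q ∈ A) : StarSubalgebra ℂ Op where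
  carrier := {Q | Q + Θ Q ∈ A ∧ T * (Q - Θ Q) ∈ A}
  mul_mem' := by
    rintro P Q ⟨hP0, hP1⟩ ⟨hQ0, hQ1⟩
    have e0 : P * Q + Θ (P * Q) = (1 / 2 : ℂ) • ((P + Θ P) * (Q + Θ Q) +
        Θm (T * (P - Θ P)) * (T * (Q - Θ Q))) := by
      have : Θm (T * (P - Θ P)) * (T * (Q - Θ Q)) = (P - Θ P) * (Q - Θ Q) := by
        rw [← mul_assoc, ← T_mul, ← mul_assoc, T_mul_T, one_mul]
      rw [this, map_mul]
      have : (P + Θ P) * (Q + Θ Q) + (P - Θ P) * (Q - Θ Q) = (2 : ℂ) • (P * Q + Θ P * Θ Q) := by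
        rw [two_smul]; noncomm_ring
      rw [this, smul_smul]; norm_num
    have e1 : T * (P * Q - Θ (P * Q)) = (1 / 2 : ℂ) • (Θm (P + Θ P) * (T * (Q - Θ Q)) +
        T * (P - Θ P) * (Q + Θ Q)) := by
      rw [← mul_assoc (Θm _), ← T_mul, map_mul]
      have : T * (P + Θ P) * (Q - Θ Q) + T * (P - Θ P) * (Q + Θ Q) =
          (2 : ℂ) • (T * (P * Q - Θ P * Θ Q)) := by
        rw [two_smul]; noncomm_ring
      rw [this, smul_smul]; norm_num
    exact ⟨e0 ▸ A.smul_mem (add_mem (mul_mem hP0 hQ0) (mul_mem (hA _ hP1) hQ1)) _,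
      e1 ▸ A.smul_mem (add_mem (mul_mem (hA _ hP0) hQ1) (mul_mem hP1 hQ0)) _⟩
  add_mem' := by
    rintro P Q ⟨hP0, hP1⟩ ⟨hQ0, hQ1⟩
    refine ⟨?_, ?_⟩
    · have := add_mem hP0 hQ0
      rwa [show P + Q + Θ (P + Q) = P + Θ P + (Q + Θ Q) by rw [map_add]; abel]
    · have := add_mem hP1 hQ1
      rwa [show T * (P + Q - Θ (P + Q)) = T * (P - Θ P) + T * (Q - Θ Q) by
        rw [map_add]; noncomm_ring]
  algebraMap_mem' r := by
    have h : Θ (algebraMap ℂ Op r) = algebraMap ℂ Op r := by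
      rw [Algebra.algebraMap_eq_smul_one, map_smul, map_one]
    refine ⟨?_, ?_⟩
    · rw [h]; exact add_mem (algebraMap_mem _ r) (algebraMap_mem _ r)
    · rw [h, sub_self, mul_zero]; exact zero_mem _
  star_mem' := by
    rintro P ⟨hP0, hP1⟩
    refine ⟨?_, ?_⟩
    · have := star_mem hP0
      rwa [star_add, ← map_star] at this
    · have := hA _ (star_mem hP1)
      rwa [star_mul, star_T, map_mul, Θm_T, ← T_mul, star_sub, ← map_star] at this

theorem σz_mem_car (j : ℤ) : σz j ∈ carAlgebra :=
  sub_mem (carAlgebra.smul_mem (mul_mem (star_mem (c_mem j)) (c_mem j)) _) (one_mem _)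

theorem S_mem_car (n : ℤ) : S n ∈ carAlgebra := by
  unfold S
  split_ifs <;> refine list_prod_mem ?_ <;> simp only [List.mem_map] <;>
    rintro _ ⟨k, -, rfl⟩ <;> exact σz_mem_car _

theorem T_mul_σx (j : ℤ) : (T : Op) * σx j = S j * (c j + star (c j)) := by
  rw [σx, ← mul_assoc, ← mul_assoc, T_mul_T, one_mul]

theorem T_mul_σy (j : ℤ) : (T : Op) * σy j = Complex.I • (S j * (c j - star (c j))) := by
  rw [σy, mul_smul_comm, ← mul_assoc, ← mul_assoc, T_mul_T, one_mul]

/-- The right side is a closed *-algebra, so only generators matter: T σ_x^{(j)} and T σ_y^{(j)}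
lose their T and lie in the CAR algebra. Together with `even_car_le_spin` this identifies the two
even parts. -/
theorem spin_le_twisted : spinAlgebra ≤ twistedAlgebra carAlgebra Θm_mem_car := by
  refine StarSubalgebra.topologicalClosure_minimal (StarAlgebra.adjoin_le ?_) ?_
  · rintro _ ((⟨j, -, rfl⟩ | ⟨j, -, rfl⟩) | ⟨j, -, rfl⟩)
    · have h : (T : Op) * σx j ∈ carAlgebra := by
        rw [T_mul_σx]
        exact mul_mem (S_mem_car j) (add_mem (c_mem j) (star_mem (c_mem j)))
      refine ⟨?_, ?_⟩
      · rw [Θ_σx, add_neg_cancel]; exact zero_mem _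
      · rw [Θ_σx, sub_neg_eq_add, mul_add]; exact add_mem h h
    · have h : (T : Op) * σy j ∈ carAlgebra := by
        rw [T_mul_σy]
        exact carAlgebra.smul_mem
          (mul_mem (S_mem_car j) (sub_mem (c_mem j) (star_mem (c_mem j)))) _
      refine ⟨?_, ?_⟩
      · rw [Θ_σy, add_neg_cancel]; exact zero_mem _
      · rw [Θ_σy, sub_neg_eq_add, mul_add]; exact add_mem h h
    · refine ⟨?_, ?_⟩
      · rw [Θ_σz]; exact add_mem (σz_mem_car j) (σz_mem_car j)
      · rw [Θ_σz, sub_self, mul_zero]; exact zero_mem _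
  · have hs : IsClosed (carAlgebra : Set Op) := inferInstance
    have hc : Continuous Θ := continuous_conj parityOp
    exact (hs.preimage (continuous_id.add hc)).inter
      (hs.preimage (continuous_const.mul (continuous_id.sub hc)))

theorem add_Θ_fixed (Q : Op) : Θ (Q + Θ Q) = Q + Θ Q := by rw [map_add, Θ_Θ, add_comm]

theorem car_add_Θ_mem {Q : Op} (hQ : Q ∈ carAlgebra) : Q + Θ Q ∈ evenPart carAlgebra :=
  ⟨add_mem hQ (Θ_mem_car Q hQ), add_Θ_fixed Q⟩

theorem spin_add_Θ_mem {Q : Op} (hQ : Q ∈ spinAlgebra) : Q + Θ Q ∈ evenPart carAlgebra :=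
  ⟨(spin_le_twisted hQ).1, add_Θ_fixed Q⟩

/-! The CAR algebra and the spin algebra as graded extensions of the common even part -/

section Graded

variable {E A : StarSubalgebra ℂ Op} [IsClosed (E : Set Op)] [IsClosed (A : Set Op)]

/-- The projection onto the even part. -/
def evenProj (hP : ∀ Q ∈ A, Q + Θ Q ∈ E) : A →ₚ[ℂ] E :=
  .mk₀ { toFun := fun Q => ⟨(1 / 2 : ℂ) • (Q + Θ Q), E.smul_mem (hP Q Q.2) _⟩
         map_add' := fun P Q => Subtype.ext (by
          change (1 / 2 : ℂ) • ((P : Op) + Q + Θ (P + Q)) =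
            (1 / 2 : ℂ) • ((P : Op) + Θ P) + (1 / 2 : ℂ) • ((Q : Op) + Θ Q)
          rw [map_add, ← smul_add]; congr 1; abel)
         map_smul' := fun r Q => Subtype.ext (by
          change (1 / 2 : ℂ) • (r • (Q : Op) + Θ (r • (Q : Op))) =
            r • (1 / 2 : ℂ) • ((Q : Op) + Θ Q)
          rw [map_smul, ← smul_add, smul_comm]) } fun Q hQ => by
    have hQ' : (0 : Op) ≤ Q := hQ
    change (0 : Op) ≤ (1 / 2 : ℂ) • (Q + Θ Q)
    have h1 : (0 : Op) ≤ Q + Θ Q := add_nonneg hQ' (map_nonneg Θ hQ')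
    have h2 : (1 / 2 : ℂ) • ((Q : Op) + Θ Q) = (1 / 2 : ℝ) • ((Q : Op) + Θ Q) := by
      rw [← Complex.coe_smul]; norm_num
    rw [h2]
    exact smul_nonneg (by norm_num) h1

theorem coe_evenProj (hP : ∀ Q ∈ A, Q + Θ Q ∈ E) (Q : A) :
    (evenProj hP Q : Op) = (1 / 2 : ℂ) • (Q + Θ Q) := rfl

/-- A `Θ`-invariant algebra `A` with even part `E` that contains an odd selfadjoint unitary. -/
def gradedOf (hEA : E ≤ A) (hA : ∀ Q ∈ A, Θ Q ∈ A) (hE : ∀ Q ∈ E, Θ Q = Q)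
    (hP : ∀ Q ∈ A, Q + Θ Q ∈ E) (u : unitary Op) (hu : (u : Op) ∈ A) (hus : star (u : Op) = u)
    (hΘu : Θ (u : Op) = -u) : GradedExtension E A where
  ι := StarSubalgebra.inclusion hEA
  θ := restrictTo Θ A hA
  P := evenProj hP
  β := restrictTo (Unitary.conjStarAlgAut ℂ Op u) E fun Q hQ => by
    rw [Unitary.conjStarAlgAut_apply, hus]
    have h1 : (u : Op) * Q * u ∈ A := mul_mem (mul_mem hu (hEA hQ)) hu
    -- The two signs from Θ(u) = -u cancel, so uQu is Θ-fixed and equals its own even projection,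
    -- which lies in E.
    have h2 := E.smul_mem (hP _ h1) (1 / 2 : ℂ)
    rw [map_mul, map_mul, hΘu, hE Q hQ, neg_mul, neg_mul_neg, ← two_smul ℂ, smul_smul] at h2
    norm_num at h2
    exact h2
  u := ⟨u, hu⟩
  P_ι Q := Subtype.ext (by
    rw [coe_evenProj]
    change (1 / 2 : ℂ) • ((Q : Op) + Θ Q) = Q
    rw [hE Q Q.2, ← two_smul ℂ, smul_smul]; norm_num)
  ι_P Q := Subtype.ext (by
    change (2 : ℂ) • (1 / 2 : ℂ) • ((Q : Op) + Θ Q) = Q + Θ Q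
    rw [smul_smul]; norm_num)
  θ_u := Subtype.ext hΘu
  star_u := Subtype.ext hus
  u_mul_u := Subtype.ext (by
    have := Unitary.star_mul_self_of_mem u.2
    rwa [hus] at this)
  ι_β Q := Subtype.ext (by
    change Unitary.conjStarAlgAut ℂ Op u Q = (u : Op) * Q * u
    rw [Unitary.conjStarAlgAut_apply, hus])

end Graded

theorem c_add_star_mul_self : (c 1 + star (c 1)) * (c 1 + star (c 1)) = 1 := by
  have h1 := car_rel 1 1
  have h2 : c 1 * c 1 = 0 := by
    have h := car_rel' 1 1
    rw [← two_smul ℂ] at h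
    exact (smul_eq_zero.1 h).resolve_left two_ne_zero
  have h3 : star (c 1) * star (c 1) = 0 := by rw [← star_mul, h2, star_zero]
  rw [if_pos rfl] at h1
  rw [add_mul, mul_add, mul_add, h2, h3, zero_add, add_zero, h1]

theorem star_c_add_star : star (c 1 + star (c 1)) = c 1 + star (c 1) := by
  rw [star_add, star_star, add_comm]

/-- The odd selfadjoint unitary `c_1 + c_1^*` of the CAR algebra. -/
def carUnitary : unitary Op :=
  ⟨c 1 + star (c 1), Unitary.mem_iff.2 (by rw [star_c_add_star]; simp [c_add_star_mul_self])⟩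

theorem coe_carUnitary : (carUnitary : Op) = c 1 + star (c 1) := rfl

/-- Site 1 lies to the right of the cut, so T commutes with u; this makes T u selfadjoint. Moreover
S_1 = 1, so T u is exactly σ_x^{(1)}. -/
theorem Θm_carUnitary : Θm (carUnitary : Op) = carUnitary := by
  rw [coe_carUnitary, map_add, map_star, Θm_c]; simp

theorem σx_one : σx 1 = (T : Op) * carUnitary := by
  rw [σx, coe_carUnitary]; simp [S]

theorem commute_T_carUnitary : T * carUnitary = carUnitary * T :=
  Subtype.ext (by
    change (T : Op) * carUnitary = carUnitary * T
    rw [T_mul, Θm_carUnitary])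

/-- `σ_x^{(1)}` as a unitary. -/
def spinUnitary : unitary Op := T * carUnitary

theorem coe_spinUnitary : (spinUnitary : Op) = σx 1 := σx_one.symm

theorem star_spinUnitary : star (spinUnitary : Op) = spinUnitary := by
  have h : (spinUnitary : Op) = (T : Op) * carUnitary := rfl
  have hcomm : (carUnitary : Op) * T = T * carUnitary :=
    (congrArg Subtype.val commute_T_carUnitary).symm
  rw [h, star_mul, star_T, coe_carUnitary, star_c_add_star, ← coe_carUnitary, hcomm]

/-- The CAR algebra as a graded extension of its even part. -/
def gradedCar : GradedExtension (evenPart carAlgebra) carAlgebra :=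
  gradedOf inf_le_left Θ_mem_car (fun _ hQ => hQ.2) (fun _ hQ => car_add_Θ_mem hQ) carUnitary
    (add_mem (c_mem 1) (star_mem (c_mem 1))) star_c_add_star (by
      rw [coe_carUnitary, map_add, map_star, Θ_c, star_neg, neg_add])

/-- The spin algebra as a graded extension of the even part of the CAR algebra. -/
def gradedSpin : GradedExtension (evenPart carAlgebra) spinAlgebra :=
  gradedOf even_car_le_spin Θ_mem_spin (fun _ hQ => hQ.2) (fun _ hQ => spin_add_Θ_mem hQ)
    spinUnitary (by rw [coe_spinUnitary]; exact σx_mem 1) star_spinUnitary (by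
      rw [coe_spinUnitary, Θ_σx])

/-- Ad(T u) = Ad T ∘ Ad u. This relation links the two extensions: the spin criterion differs from
the CAR criterion by Θ_-. -/
theorem gradedSpin_β (Q : evenPart carAlgebra) : gradedSpin.β Q = ΘmEven (gradedCar.β Q) := by
  refine Subtype.ext ?_
  change Unitary.conjStarAlgAut ℂ Op (T * carUnitary) (Q : Op) =
    Unitary.conjStarAlgAut ℂ Op T (Unitary.conjStarAlgAut ℂ Op carUnitary Q)
  rw [map_mul]; rfl

theorem gradedSpin_β_eq : gradedSpin.β = ΘmEven.comp gradedCar.β := StarAlgHom.ext gradedSpin_β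

theorem Θm_Θm (Q : Op) : Θm (Θm Q) = Q := by
  have h1 : Θm (Θm Q) = (Θm * Θm) Q := rfl
  have h3 : T * T = 1 := Subtype.ext T_mul_T
  rw [h1, Θm, ← map_mul, h3, map_one]; rfl

theorem ΘmEven_ΘmEven (Q : evenPart carAlgebra) : ΘmEven (ΘmEven Q) = Q :=
  Subtype.ext (Θm_Θm Q)

theorem ΘmEven_surjective : Function.Surjective ΘmEven := fun Q => ⟨ΘmEven Q, ΘmEven_ΘmEven Q⟩

theorem ΘmCar_surjective : Function.Surjective ΘmCar := fun Q =>
  ⟨ΘmCar Q, Subtype.ext (Θm_Θm Q)⟩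

theorem ΘmCar_ι (Q : evenPart carAlgebra) : ΘmCar (gradedCar.ι Q) = gradedCar.ι (ΘmEven Q) := rfl

/-! Translations -/

theorem τ_add (j k : ℤ) (Q : Op) : τ (j + k) Q = τ j (τ k Q) := by
  have : τ j (τ k Q) = (τ j * τ k) Q := rfl
  rw [this, τ, τ, τ, ← map_mul, ← zpow_add]

theorem parity_mul_shift : parityOp * shiftOp = shiftOp * parityOp :=
  Subtype.ext (Op.ext fun v p => by
    have h1 : ((parityOp * shiftOp : unitary Op) : Op) v p =
      (parityOp : Op) ((shiftOp : Op) v) p := rfl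
    have h2 : ((shiftOp * parityOp : unitary Op) : Op) v p =
      (shiftOp : Op) ((parityOp : Op) v) p := rfl
    have h3 : (shift p).1.card = p.1.card := by simp [shift]
    rw [h1, h2, shift_apply, parity_apply, parity_apply, shift_apply, h3]
    ring)

theorem Θ_τ (j : ℤ) (Q : Op) : Θ (τ j Q) = τ j (Θ Q) := by
  have h1 : Θ (τ j Q) = (Θ * τ j) Q := rfl
  have h2 : τ j (Θ Q) = (τ j * Θ) Q := rfl
  have h3 : parityOp * shiftOp ^ j = shiftOp ^ j * parityOp :=
    (Commute.zpow_right (parity_mul_shift : Commute parityOp shiftOp) j).eq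
  rw [h1, h2, Θ, τ, ← map_mul, ← map_mul, h3]

theorem τ_mem_even (j : ℤ) : ∀ Q ∈ evenPart carAlgebra, τ j Q ∈ evenPart carAlgebra :=
  fun Q hQ => ⟨τ_mem_car j Q hQ.1, by
    change Θ (τ j Q) = τ j Q
    rw [Θ_τ, (mem_evenPart.1 hQ).2]⟩

/-- The lattice translation of the even part. -/
def τEven (j : ℤ) : evenPart carAlgebra →⋆ₐ[ℂ] evenPart carAlgebra :=
  restrictTo (τ j) (evenPart carAlgebra) (τ_mem_even j)

theorem τ_neg_τ (j : ℤ) (Q : Op) : τ j (τ (-j) Q) = Q := by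
  rw [← τ_add, add_neg_cancel]; simp [τ]

theorem τEven_surjective (j : ℤ) : Function.Surjective (τEven j) := fun Q =>
  ⟨τEven (-j) Q, Subtype.ext (τ_neg_τ j Q)⟩

theorem evenRestriction_τEven {ψ : carAlgebra →ₚ[ℂ] ℂ} (h : TranslationInvariantCar ψ) (j : ℤ) :
    pullback (evenRestriction ψ) (τEven j) = evenRestriction ψ := by
  ext Q
  exact congrArg (fun f : carAlgebra →ₚ[ℂ] ℂ => f (gradedCar.ι Q)) (h j)

end JordanWigner

/-! ### Equivalence criteria from vector states and intertwiners -/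

section Vector

variable {A B : Type*} [CStarAlgebra A] [PartialOrder A] [StarOrderedRing A]
  [CStarAlgebra B] [PartialOrder B] [StarOrderedRing B]

theorem gns_isometry_ne_zero {H : Type*} [NormedAddCommGroup H] [InnerProductSpace ℂ H]
    {φ : A →ₚ[ℂ] ℂ} (h : IsState φ) (J : φ.GNS →ₗᵢ[ℂ] H) : J.toContinuousLinearMap ≠ 0 :=
  fun h0 => by
    have h1 : J (gnsVector φ) = 0 := congrArg (fun Y => Y (gnsVector φ)) h0
    have h2 := J.norm_map (gnsVector φ)
    rw [h1, norm_zero, gns_norm_vector h] at h2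
    norm_num at h2

/-- If `ψ ∘ α`, with `ψ` pure, is a vector state of an irreducible representation, then its GNS
representation is equivalent to this representation. -/
theorem repEquiv_of_vector {ψ : B →ₚ[ℂ] ℂ} (hψ : IsPureState ψ) {α : A →⋆ₐ[ℂ] B}
    (hα : Function.Surjective α) {H : Type*} [NormedAddCommGroup H] [InnerProductSpace ℂ H]
    [CompleteSpace H] {π : A →⋆ₐ[ℂ] (H →L[ℂ] H)} (hπ : IrreducibleRep π) {η : H} (hvec : ∀ Q, pullback ψ α Q = ⟪η, π Q η⟫_ℂ) :
    RepEquiv (pullback ψ α).gnsStarAlgHom π := by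
  obtain ⟨V, hV, hV'⟩ := exists_gns_isometry (pullback ψ α) π η hvec
  have hirr : IrreducibleRep (pullback ψ α).gnsStarAlgHom :=
    (hψ.irreducible.comp_surjective _ hα).of_equiv (repEquiv_pullback ψ α hα).symm
  exact RepEquiv.of_intertwiner hirr hπ V.toContinuousLinearMap hV'
    (gns_isometry_ne_zero (isState_pullback hψ.isState _) V)

/-- If `ω` is equivalent to `ω ∘ α` and to `ω ∘ α ∘ β`, it is equivalent to `ω ∘ β`. -/
theorem repEquiv_comp_of_unitarilyEquivalent {ω : A →ₚ[ℂ] ℂ} {α β : A →⋆ₐ[ℂ] A}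
    (hα : Function.Surjective α) (h : UnitarilyEquivalent ω (pullback ω α))
    (he : RepEquiv ω.gnsStarAlgHom (ω.gnsStarAlgHom.comp (α.comp β))) :
    RepEquiv ω.gnsStarAlgHom (ω.gnsStarAlgHom.comp β) :=
  he.trans ((RepEquiv.trans h (repEquiv_pullback ω α hα)).comp β).symm

end Vector

namespace GradedExtension

variable {E B : Type*} [CStarAlgebra E] [PartialOrder E] [CStarAlgebra B] [PartialOrder B]
  (G : GradedExtension E B)
variable {H K M : Type*} [NormedAddCommGroup H] [InnerProductSpace ℂ H] [CompleteSpace H]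
  [NormedAddCommGroup K] [InnerProductSpace ℂ K] [CompleteSpace K]
  [NormedAddCommGroup M] [InnerProductSpace ℂ M] [CompleteSpace M]

theorem P_conj (b : B) : G.P (G.u * b * G.u) = G.β (G.P b) := by
  refine G.eq_of_two_smul ?_
  rw [G.ι_P, G.ι_β, ← smul_mul_assoc, ← mul_smul_comm, G.ι_P, map_mul, map_mul, G.θ_u]
  noncomm_ring

/-- An irreducible subrepresentation of the restriction to `E` of a representation of `B` generated
by the irreducible representation `π` is equivalent to `π` or to `π ∘ β`. -/
theorem repEquiv_or {π : E →⋆ₐ[ℂ] (H →L[ℂ] H)} {π' : E →⋆ₐ[ℂ] (M →L[ℂ] M)}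
    {ρ : B →⋆ₐ[ℂ] (K →L[ℂ] K)} (hπ : IrreducibleRep π) (hπ' : IrreducibleRep π')
    (J : H →L[ℂ] K) (hJ : ∀ a ξ, J (π a ξ) = ρ (G.ι a) (J ξ))
    (J' : M →L[ℂ] K) (hJ' : ∀ a ξ, J' (π' a ξ) = ρ (G.ι a) (J' ξ)) (h0 : J' ≠ 0)
    {Ω : H} (hc : DenseRange fun b => ρ b (J Ω)) :
    RepEquiv π π' ∨ RepEquiv π (π'.comp G.β) := by
  have hJ2 : ∀ a ξ, J'.adjoint (ρ (G.ι a) ξ) = π' a (J'.adjoint ξ) :=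
    intertwiner_adjoint (ρ := ρ.comp G.ι) J' hJ'
  -- J'^*J intertwines π with π', and J'^*ρ(u)J intertwines π with π' ∘ β. If both vanished, J'^*
  -- would kill the dense orbit of JΩ, since B = E ⊕ E u.
  by_cases hX : J'.adjoint ∘L J = 0
  · by_cases hY : J'.adjoint ∘L ρ G.u ∘L J = 0
    · exfalso
      have hX' : ∀ ξ, J'.adjoint (J ξ) = 0 := fun ξ => congrArg (fun Y => Y ξ) hX
      have hY' : ∀ ξ, J'.adjoint (ρ G.u (J ξ)) = 0 := fun ξ => congrArg (fun Y => Y ξ) hY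
      have h1 : (J'.adjoint : K → M) = fun _ => 0 := by
        refine hc.equalizer J'.adjoint.continuous continuous_const (funext fun b => ?_)
        change J'.adjoint (ρ b (J Ω)) = 0
        rw [G.decomp b, map_add, add_apply, map_add, rep_mul_apply, hJ2, hJ2, hX', hY', map_zero,
          map_zero, add_zero]
      have h2 : J'.adjoint = 0 := ContinuousLinearMap.ext fun ξ => congrFun h1 ξ
      exact h0 (by rw [← ContinuousLinearMap.adjoint_adjoint J', h2, map_zero])
    · refine Or.inr (RepEquiv.of_intertwiner hπ (hπ'.comp_surjective G.β G.β_surjective) _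
        (fun a ξ => ?_) hY)
      simp only [ContinuousLinearMap.comp_apply]
      rw [hJ, ← rep_mul_apply, u_mul_ι, rep_mul_apply, hJ2]; rfl
  · refine Or.inl (RepEquiv.of_intertwiner hπ hπ' _ (fun a ξ => ?_) hX)
    simp only [ContinuousLinearMap.comp_apply]
    rw [hJ, hJ2]

/-- A unitarily implemented automorphism preserves, up to a sign, the odd part of a vector state
that is irreducible on the even part. -/
theorem exists_sign {ρ : B →⋆ₐ[ℂ] (H →L[ℂ] H)} (hi : IrreducibleRep (ρ.comp G.ι)) {Ω : H}
    (hΩ : Ω ≠ 0) {τ : B →⋆ₐ[ℂ] B} {τE : E →⋆ₐ[ℂ] E} (hτ : ∀ a, τ (G.ι a) = G.ι (τE a))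
    (V : H ≃ₗᵢ[ℂ] H) (hVΩ : V Ω = Ω) (hV : ∀ a ξ, V (ρ (G.ι a) ξ) = ρ (G.ι (τE a)) (V ξ)) :
    ∃ z : ℂ, z * z = 1 ∧
      ∀ a, ⟪Ω, ρ (τ (G.ι a * G.u)) Ω⟫_ℂ = z * ⟪Ω, ρ (G.ι a * G.u) Ω⟫_ℂ := by
  -- Pulled back by V, the operator of τ(u) implements β on E, as ρ(u) does. By irreducibility X =
  -- zρ(u), and both operators have square one.
  let X : H →L[ℂ] H := (V.symm : H →L[ℂ] H) ∘L ρ (τ G.u) ∘L (V : H →L[ℂ] H)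
  have hXV : ∀ ξ, V (X ξ) = ρ (τ G.u) (V ξ) := fun ξ => V.apply_symm_apply _
  have hX : ∀ a ξ, X (ρ (G.ι a) ξ) = ρ (G.ι (G.β a)) (X ξ) := fun a ξ => by
    refine V.injective ?_
    rw [hXV, hV, hV, hXV, ← hτ, ← hτ, ← rep_mul_apply, ← rep_mul_apply, ← map_mul, ← map_mul,
      u_mul_ι]
  have hXX : ∀ ξ, X (X ξ) = ξ := fun ξ => by
    refine V.injective ?_
    rw [hXV, hXV, ← rep_mul_apply, ← map_mul, G.u_mul_u, map_one, map_one]; rfl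
  have huu : ∀ ξ, ρ G.u (ρ G.u ξ) = ξ := fun ξ => by
    rw [← rep_mul_apply, G.u_mul_u, map_one]; rfl
  obtain ⟨z, hz⟩ := hi (ρ G.u * X) fun a ξ => by
    change ρ G.u (X (ρ (G.ι a) ξ)) = ρ (G.ι a) (ρ G.u (X ξ))
    rw [hX, ← rep_mul_apply, u_mul_ι, G.β_β, rep_mul_apply]
  have hz' : ∀ ξ, X ξ = z • ρ G.u ξ := fun ξ => by
    have h1 : ρ G.u (X ξ) = z • ξ := congrArg (fun Y => Y ξ) hz
    rw [← huu (X ξ), h1, map_smul]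
  refine ⟨z, ?_, fun a => ?_⟩
  · have h1 := hXX Ω
    rw [hz', hz', map_smul, huu, smul_smul] at h1
    exact smul_left_injective ℂ hΩ (h1.trans (one_smul ℂ Ω).symm)
  · have h1 : ρ (τ (G.ι a * G.u)) Ω = z • V (ρ (G.ι a * G.u) Ω) := by
      rw [map_mul τ, rep_mul_apply, rep_mul_apply, hV, hτ, ← map_smul, ← map_smul, ← hz', hXV, hVΩ]
    rw [h1, inner_smul_right]
    nth_rw 1 [← hVΩ]
    rw [V.inner_map_map]

variable [StarOrderedRing B]

/-- If a state is irreducible on the even part, the even part is weakly dense. -/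
theorem gnsBicommutant_eq {φ : B →ₚ[ℂ] ℂ} (hi : IrreducibleRep (φ.gnsStarAlgHom.comp G.ι))
    {M M' : Set B} (hM : M' ⊆ M) (hM' : ∀ a, G.ι a ∈ M') :
    gnsBicommutant φ M = gnsBicommutant φ M' := by
  refine Set.Subset.antisymm (Set.centralizer_subset ?_)
    (Set.centralizer_subset (Set.centralizer_subset (Set.image_mono hM)))
  intro Y hY
  -- The commutant of M' already consists of scalars.
  obtain ⟨z, rfl⟩ := hi Y fun a ξ =>
    (congrArg (fun X => X ξ) (hY _ ⟨G.ι a, hM' a, rfl⟩)).symm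
  rintro X -
  rw [mul_smul_comm, smul_mul_assoc, one_mul, mul_one]

/-- The commutant of B is contained in that of E. -/
theorem irreducible_of_even {φ : B →ₚ[ℂ] ℂ} (hi : IrreducibleRep (φ.gnsStarAlgHom.comp G.ι)) :
    IrreducibleRep φ.gnsStarAlgHom := fun Y hY => hi Y fun a => hY (G.ι a)

variable [StarOrderedRing E]

/-- The square of an automorphism that leaves the even part of the state invariant leaves the
state invariant. -/
theorem pullback_sq {ω : E →ₚ[ℂ] ℂ} (hp : IsPureState ω) {φ : B →ₚ[ℂ] ℂ}
    (hι : pullback φ G.ι = ω) (U : ω.GNS ≃ₗᵢ[ℂ] φ.GNS) (hU : U (gnsVector ω) = gnsVector φ)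
    (hU' : ∀ a ξ, U (ω.gnsStarAlgHom a ξ) = φ.gnsStarAlgHom (G.ι a) (U ξ))
    {τ : B →⋆ₐ[ℂ] B} {τE : E →⋆ₐ[ℂ] E} (hτ : ∀ a, τ (G.ι a) = G.ι (τE a))
    (hτθ : ∀ b, G.θ (τ b) = τ (G.θ b)) (hs : Function.Surjective τE)
    (hω : pullback ω τE = ω) (b : B) : φ (τ (τ b)) = φ b := by
  have hφι : ∀ a, φ (G.ι a) = ω a := fun a => by rw [← hι]; rfl
  have hωτ : ∀ a, ω (τE a) = ω a := fun a => congrArg (fun f : E →ₚ[ℂ] ℂ => f a) hω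
  have hΩ : gnsVector φ ≠ 0 := by
    rw [← hU]
    refine norm_ne_zero_iff.1 ?_
    rw [U.norm_map, gns_norm_vector hp.isState]; norm_num
  -- U and U₁ realise the GNS space of ω inside π_φ, with E acting directly and through τ
  -- respectively. Hence U₁ U⁻¹ implements τ on E and fixes the cyclic vector.
  obtain ⟨U₁, hU₁, hU₁'⟩ := exists_gns_unitary ω ((φ.gnsStarAlgHom.comp G.ι).comp τE)
    (gnsVector φ) (fun a => by rw [← hωτ, ← hφι, gns_state]; rfl) (by
      have h1 : (fun a => ((φ.gnsStarAlgHom.comp G.ι).comp τE) a (gnsVector φ)) =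
          U ∘ fun a => ω.gnsStarAlgHom (τE a) (gnsVector ω) := funext fun a => by
        change φ.gnsStarAlgHom (G.ι (τE a)) (gnsVector φ) = U _
        rw [hU', hU]
      rw [h1]
      refine U.surjective.denseRange.comp ?_ U.continuous
      refine Dense.mono ?_ (gns_cyclic ω)
      rintro _ ⟨a, rfl⟩
      obtain ⟨a, rfl⟩ := hs a
      exact ⟨a, rfl⟩)
  have hi : IrreducibleRep (φ.gnsStarAlgHom.comp G.ι) := hp.irreducible.of_equiv ⟨U, hU'⟩
  obtain ⟨z, hz, hz'⟩ := G.exists_sign hi hΩ hτ (U.symm.trans U₁)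
    (by rw [← hU, LinearIsometryEquiv.trans_apply, U.symm_apply_apply, hU₁, hU]) fun a ξ => by
      simp only [LinearIsometryEquiv.trans_apply]
      obtain ⟨η, rfl⟩ := U.surjective ξ
      rw [← hU', U.symm_apply_apply, U.symm_apply_apply, hU₁']; rfl
  have hz1 : ∀ a, φ (τ (G.ι a * G.u)) = z * φ (G.ι a * G.u) := fun a => by
    rw [gns_state φ, hz', ← gns_state]
  -- The sign rule is needed for all odd elements, as it is applied a second time to τ(ι(a) u).
  have hz2 : ∀ c, G.θ c = -c → φ (τ c) = z * φ c := fun c hc => by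
    have h1 := G.decomp c
    rw [G.P_odd hc, map_zero, zero_add] at h1
    rw [h1, hz1]
  have hodd := G.θ_ι_mul_u (G.P (b * G.u))
  rw [G.decomp b, map_add, map_add, map_add, map_add, hτ, hτ, hφι, hφι, hωτ, hωτ,
    hz2 _ (by rw [hτθ, hodd, map_neg]), hz2 _ hodd, ← mul_assoc, hz, one_mul]

/-- If `ω` is equivalent to `ω ∘ ϑ ∘ β`, then the pure state `ω ∘ P` is equivalent to its
composition with an automorphism that restricts to `ϑ`. -/
theorem unitarilyEquivalent_comp_P {ω : E →ₚ[ℂ] ℂ} {ψ : B →ₚ[ℂ] ℂ} (hψ : IsPureState ψ)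
    (hψω : ψ = ω.comp G.P) {α : B →⋆ₐ[ℂ] B} (hα : Function.Surjective α) {αE : E →⋆ₐ[ℂ] E}
    (hαP : ∀ b, G.P (α b) = αE (G.P b))
    (h : RepEquiv ω.gnsStarAlgHom (ω.gnsStarAlgHom.comp (αE.comp G.β))) :
    UnitarilyEquivalent ψ (pullback ψ α) := by
  have hψP : ∀ b, ψ b = ω (G.P b) := fun b => by rw [hψω]; rfl
  have hψι : ∀ a, ω a = ψ (G.ι a) := fun a => by rw [hψP, G.P_ι]
  rw [hψω] at hψ
  have hp : IsPureState ω := G.isPureState_of_comp_P hψ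
  have hne := G.not_repEquiv_of_isPureState hψ
  rw [← hψω] at hψ
  obtain ⟨U, hU⟩ := h
  have hU' : ∀ a ξ, U (ω.gnsStarAlgHom a ξ) = ω.gnsStarAlgHom (αE (G.β a)) (U ξ) := hU
  obtain ⟨J, hJ, hJ'⟩ := exists_gns_isometry ω (ψ.gnsStarAlgHom.comp G.ι) (gnsVector ψ)
    fun a => by rw [hψι, gns_state]; rfl
  have hJ1 : ∀ a ξ, J (ω.gnsStarAlgHom a ξ) = ψ.gnsStarAlgHom (G.ι a) (J ξ) := hJ'
  obtain ⟨X, hX, hX'⟩ := G.compression_intertwiner (π := ω.gnsStarAlgHom)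
    (ρ := ψ.gnsStarAlgHom) J.toContinuousLinearMap hJ1
  -- Since ω is not equivalent to ω ∘ β, every vector in the range of J induces a state with
  -- vanishing odd part.
  have hX0 : X = 0 := by
    by_contra h0
    exact hne (RepEquiv.of_intertwiner hp.irreducible
      (hp.irreducible.comp_surjective _ G.β_surjective) X hX h0)
  have hodd : ∀ a ξ, ⟪J ξ, ψ.gnsStarAlgHom (G.ι a * G.u) (J ξ)⟫_ℂ = 0 := fun a ξ => by
    have h1 := hX' a ξ
    rw [hX0, zero_apply, map_zero, inner_zero_right] at h1
    exact h1.symm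
  -- ξ induces ω ∘ αE ∘ β on E. Moving Jξ by π_ψ(u) cancels β, so η induces ω ∘ αE ∘ P = ψ ∘ α.
  obtain ⟨ξ, hUξ⟩ := U.surjective (gnsVector ω)
  have hstate : ∀ a, ⟪ξ, ω.gnsStarAlgHom a ξ⟫_ℂ = ω (αE (G.β a)) := fun a => by
    rw [← U.inner_map_map, hU', hUξ, ← gns_state]
  obtain ⟨η, hη⟩ : ∃ η, η = ψ.gnsStarAlgHom G.u (J ξ) := ⟨_, rfl⟩
  have hvec : ∀ Q, pullback ψ α Q = ⟪η, ψ.gnsStarAlgHom Q η⟫_ℂ := fun Q => by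
    have h1 : ⟪η, ψ.gnsStarAlgHom Q η⟫_ℂ =
        ⟪J ξ, ψ.gnsStarAlgHom (G.u * Q * G.u) (J ξ)⟫_ℂ := by
      rw [hη, inner_rep, G.star_u, rep_mul_apply, rep_mul_apply]
    rw [h1, G.decomp (G.u * Q * G.u), map_add, add_apply, inner_add_right, hodd, add_zero, ← hJ1,
      J.inner_map_map, hstate, G.P_conj, G.β_β, ← hαP, ← hψP, pullback_apply]
  exact (repEquiv_of_vector hψ hα hψ.irreducible hvec).symm

/-- If a pure state `ψ = ω ∘ P` is equivalent to `ψ ∘ α`, then `ω ∘ α` is equivalent to `ω` or to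
`ω ∘ β`. -/
theorem repEquiv_of_unitarilyEquivalent {ω : E →ₚ[ℂ] ℂ} {ψ : B →ₚ[ℂ] ℂ} (hp : IsPureState ω)
    (hψι : pullback ψ G.ι = ω) {α : B →⋆ₐ[ℂ] B} {αE : E →⋆ₐ[ℂ] E}
    (hαE : Function.Surjective αE) (hα : ∀ a, α (G.ι a) = G.ι (αE a))
    (h : UnitarilyEquivalent ψ (pullback ψ α))
    (hne : ¬ UnitarilyEquivalent ω (pullback ω αE)) :
    RepEquiv ω.gnsStarAlgHom (ω.gnsStarAlgHom.comp (αE.comp G.β)) := by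
  have hψ' : ∀ a, ω a = ψ (G.ι a) := fun a => by rw [← hψι]; rfl
  obtain ⟨U, hU⟩ := h
  obtain ⟨J, hJ, hJ'⟩ := exists_gns_isometry ω (ψ.gnsStarAlgHom.comp G.ι) (gnsVector ψ)
    fun a => by rw [hψ', gns_state]; rfl
  have hequiv := repEquiv_pullback ω αE hαE
  have hirr : IrreducibleRep (pullback ω αE).gnsStarAlgHom :=
    (hp.irreducible.comp_surjective _ hαE).of_equiv hequiv.symm
  -- η induces ψ ∘ α in π_ψ, so its E-orbit spans a copy of the GNS space of ω ∘ αE, which is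
  -- compared with that of ω.
  obtain ⟨η, hUη⟩ := U.surjective (gnsVector (pullback ψ α))
  obtain ⟨J₁, hJ₁, hJ₁'⟩ := exists_gns_isometry (pullback ω αE)
    (ψ.gnsStarAlgHom.comp G.ι) η fun a => by
      change _ = ⟪η, ψ.gnsStarAlgHom (G.ι a) η⟫_ℂ
      rw [← U.inner_map_map, hU, hUη, ← gns_state, pullback_apply, pullback_apply, hψ', hα]
  have hc : DenseRange fun b => ψ.gnsStarAlgHom b (J.toContinuousLinearMap (gnsVector ω)) := by
    rw [LinearIsometry.coe_toContinuousLinearMap, hJ]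
    exact gns_cyclic ψ
  rcases G.repEquiv_or (ρ := ψ.gnsStarAlgHom) hp.irreducible hirr J.toContinuousLinearMap
    hJ' J₁.toContinuousLinearMap hJ₁'
    (gns_isometry_ne_zero (isState_pullback hp.isState _) J₁) hc with h1 | h1
  · exact absurd h1 hne
  · exact h1.trans (hequiv.comp G.β)

end GradedExtension

/-! ### Weak limits of asymptotically central sequences -/

/-- In an irreducible representation, an asymptotically central sequence with constant
expectation converges weakly, along an ultrafilter, to a scalar. -/
theorem exists_weak_limit {A : Type*} [CStarAlgebra A] {H : Type*} [NormedAddCommGroup H]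
    [InnerProductSpace ℂ H] [CompleteSpace H] {π : A →⋆ₐ[ℂ] (H →L[ℂ] H)} (hi : IrreducibleRep π)
    {Ω : H} (hΩ : ‖Ω‖ = 1) (D : ℕ → A) {C : ℝ} (hC : ∀ n, ‖D n‖ ≤ C) {s : Set A} (hs : Dense s)
    (hcomm : ∀ a ∈ s, ∀ᶠ n in Filter.atTop, Commute (D n) (star a)) {m : ℂ}
    (hm : ∀ n, ⟪Ω, π (D n) Ω⟫_ℂ = m) :
    ∃ F : Filter ℕ, F.NeBot ∧ F ≤ Filter.atTop ∧
      ∀ ξ η, Filter.Tendsto (fun n => ⟪ξ, π (D n) η⟫_ℂ) F (nhds (m * ⟪ξ, η⟫_ℂ)) := by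
  let F : Ultrafilter ℕ := Filter.hyperfilter ℕ
  have hF : (F : Filter ℕ) ≤ Filter.atTop := by
    rw [← Nat.cofinite_eq_atTop]; exact Filter.hyperfilter_le_cofinite
  have hbd : ∀ ξ η n, ‖⟪ξ, π (D n) η⟫_ℂ‖ ≤ C * ‖ξ‖ * ‖η‖ := fun ξ η n => by
    have h1 : ‖π (D n)‖ ≤ C := (NonUnitalStarAlgHom.norm_apply_le π (D n)).trans (hC n)
    calc ‖⟪ξ, π (D n) η⟫_ℂ‖ ≤ ‖ξ‖ * ‖π (D n) η‖ := norm_inner_le_norm _ _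
      _ ≤ ‖ξ‖ * (C * ‖η‖) := by gcongr; exact (π (D n)).le_of_opNorm_le h1 η
      _ = C * ‖ξ‖ * ‖η‖ := by ring
  have hlim : ∀ ξ η, ∃ l, Filter.Tendsto (fun n => ⟪ξ, π (D n) η⟫_ℂ) F (nhds l) := fun ξ η => by
    obtain ⟨l, -, hl⟩ := (isCompact_closedBall (0 : ℂ) (C * ‖ξ‖ * ‖η‖)).ultrafilter_le_nhds
      (F.map fun n => ⟪ξ, π (D n) η⟫_ℂ) (by
        rw [Filter.le_principal_iff]
        exact Filter.mem_map.2 (Filter.Eventually.of_forall fun n => by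
          simpa using hbd ξ η n))
    exact ⟨l, hl⟩
  choose b hb using hlim
  have hu : ∀ ξ η l, Filter.Tendsto (fun n => ⟪ξ, π (D n) η⟫_ℂ) F (nhds l) → b ξ η = l :=
    fun ξ η l hl => tendsto_nhds_unique (hb ξ η) hl
  let f : H →ₗ⋆[ℂ] H →ₗ[ℂ] ℂ := LinearMap.mk₂'ₛₗ (starRingEnd ℂ) (RingHom.id ℂ) b
    (fun ξ ξ' η => hu _ _ _ (by simpa only [inner_add_left] using (hb ξ η).add (hb ξ' η)))
    (fun r ξ η => hu _ _ _ (by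
      simpa only [inner_smul_left, smul_eq_mul] using (hb ξ η).const_mul ((starRingEnd ℂ) r)))
    (fun ξ η η' => hu _ _ _ (by
      simpa only [map_add, inner_add_right] using (hb ξ η).add (hb ξ η')))
    (fun r ξ η => hu _ _ _ (by
      simpa only [map_smul, inner_smul_right, smul_eq_mul, RingHom.id_apply] using (hb ξ η).const_mul r))
  let f' : H →L⋆[ℂ] H →L[ℂ] ℂ := f.mkContinuous₂ C fun ξ η =>
    le_of_tendsto (hb ξ η).norm (Filter.Eventually.of_forall (hbd ξ η))
  -- L stands in the first slot of the inner product, so it is the adjoint of the weak limit. This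
  -- is why `hcomm` concerns a^* and why z is conjugated below.
  let L : H →L[ℂ] H := InnerProductSpace.continuousLinearMapOfBilin f'
  have hL : ∀ ξ η, ⟪L ξ, η⟫_ℂ = b ξ η := fun ξ η =>
    InnerProductSpace.continuousLinearMapOfBilin_apply f' ξ η
  have hcs : ∀ a ∈ s, ∀ ξ, L (π a ξ) = π a (L ξ) := fun a ha ξ => by
    refine ext_inner_right ℂ fun η => ?_
    rw [hL, inner_rep, hL]
    refine hu _ _ _ ((hb ξ (π (star a) η)).congr' ?_)
    filter_upwards [hF (hcomm a ha)] with n hn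
    rw [inner_rep, ← rep_mul_apply, ← rep_mul_apply, hn.eq]
  have hπc : Continuous fun a => π a :=
    AddMonoidHomClass.continuous_of_bound π 1 fun a => by
      rw [one_mul]; exact NonUnitalStarAlgHom.norm_apply_le π a
  obtain ⟨z, hz⟩ := hi L fun a ξ =>
    congrFun (Continuous.ext_on hs (f := fun a => L (π a ξ)) (g := fun a => π a (L ξ))
      (by fun_prop) (by fun_prop) fun a ha => hcs a ha ξ) a
  have hz' : ∀ ξ η, b ξ η = (starRingEnd ℂ) z * ⟪ξ, η⟫_ℂ := fun ξ η => by
    rw [← hL, hz, ← inner_smul_left]; rfl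
  -- The constant expectation in Ω identifies the scalar.
  have hzm : (starRingEnd ℂ) z = m := by
    have h1 := hz' Ω Ω
    rw [inner_self_complex, hΩ] at h1
    have h2 : b Ω Ω = m := hu _ _ _ (by simp only [hm]; exact tendsto_const_nhds)
    rw [← h2, h1]; simp
  refine ⟨F, F.neBot, hF, fun ξ η => ?_⟩
  rw [← hzm, ← hz']
  exact hb ξ η

/-- If `π(D_n)` converges weakly to a nonzero scalar and `Y` commutes with `π(P D_n)`, then `Y`
commutes with `π(P)`. -/
theorem commutes_of_weak_limit {A : Type*} [CStarAlgebra A] {H : Type*} [NormedAddCommGroup H]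
    [InnerProductSpace ℂ H] [CompleteSpace H] {π : A →⋆ₐ[ℂ] (H →L[ℂ] H)} {D : ℕ → A}
    {F : Filter ℕ} [F.NeBot] {m : ℂ} (hm0 : m ≠ 0)
    (hlim : ∀ ξ η, Filter.Tendsto (fun n => ⟪ξ, π (D n) η⟫_ℂ) F (nhds (m * ⟪ξ, η⟫_ℂ)))
    {Y : H →L[ℂ] H} {P : A} (hY : ∀ᶠ n in F, ∀ ξ, π (P * D n) (Y ξ) = Y (π (P * D n) ξ)) (ξ : H) :
    π P (Y ξ) = Y (π P ξ) := by
  refine ext_inner_left ℂ fun ζ => mul_left_cancel₀ hm0 ?_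
  -- The matrix elements of π(P D_n) Y and Y π(P D_n) agree eventually, and tend to m times those of
  -- π(P) Y and Y π(P).
  have h1 := hlim (π (star P) ζ) (Y ξ)
  have h2 := hlim (π (star P) (Y.adjoint ζ)) ξ
  rw [inner_rep, star_star] at h1 h2
  rw [ContinuousLinearMap.adjoint_inner_left] at h2
  refine tendsto_nhds_unique h1 (h2.congr' ?_)
  filter_upwards [hY] with n hn
  rw [inner_rep, inner_rep, star_star, ContinuousLinearMap.adjoint_inner_left, ← rep_mul_apply,
    ← rep_mul_apply, hn]

/-- An operator that commutes with the even and with the odd part of `Q` commutes with `Q`. -/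
theorem commutes_of_add_sub {A : Type*} [CStarAlgebra A] {H : Type*} [NormedAddCommGroup H]
    [InnerProductSpace ℂ H] [CompleteSpace H] {π : A →⋆ₐ[ℂ] (H →L[ℂ] H)} {Y : H →L[ℂ] H}
    {Q R : A} {ξ : H} (he : π (Q + R) (Y ξ) = Y (π (Q + R) ξ))
    (ho : π (Q - R) (Y ξ) = Y (π (Q - R) ξ)) : π Q (Y ξ) = Y (π Q ξ) := by
  have hsum : Q + R + (Q - R) = (2 : ℂ) • Q := by rw [two_smul]; abel
  have h2 : π ((2 : ℂ) • Q) (Y ξ) = Y (π ((2 : ℂ) • Q) ξ) := by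
    rw [← hsum, map_add π (Q + R), add_apply, he, ho, add_apply, map_add Y]
  rw [map_smul, smul_apply, smul_apply, map_smul] at h2
  exact smul_right_injective _ (two_ne_zero : (2 : ℂ) ≠ 0) h2

/-- If an asymptotically central sequence of odd elements of `M` has constant nonzero expectation,
then the odd elements of `M` are weak limits of even ones. -/
theorem gnsBicommutant_eq_even {A : Type*} [CStarAlgebra A] [PartialOrder A] [StarOrderedRing A]
    {φ : A →ₚ[ℂ] ℂ} (hφ : IsState φ) (hi : IrreducibleRep φ.gnsStarAlgHom) {θ : A →⋆ₐ[ℂ] A}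
    (hθ : ∀ a, θ (θ a) = a) {M : StarSubalgebra ℂ A} (hM : ∀ a ∈ M, θ a ∈ M) {M' : Set A}
    (hM' : ∀ a, a ∈ M' ↔ a ∈ M ∧ θ a = a) (D : ℕ → A) {C : ℝ} (hC : ∀ n, ‖D n‖ ≤ C)
    (hodd : ∀ n, θ (D n) = -D n) (hD : ∀ᶠ n in Filter.atTop, D n ∈ M) {s : Set A} (hs : Dense s)
    (hcomm : ∀ a ∈ s, ∀ᶠ n in Filter.atTop, Commute (D n) (star a)) {m : ℂ}
    (hm : ∀ n, φ (D n) = m) (hm0 : m ≠ 0) :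
    gnsBicommutant φ M = gnsBicommutant φ M' := by
  obtain ⟨F, hF, hFt, hlim⟩ := exists_weak_limit hi (gns_norm_vector hφ) D hC hs hcomm (m := m)
    (fun n => by rw [← gns_state, hm])
  refine Set.Subset.antisymm (Set.centralizer_subset ?_)
    (Set.centralizer_subset (Set.centralizer_subset (Set.image_mono fun Q hQ => ((hM' Q).1 hQ).1)))
  rintro Y hY _ ⟨Q, hQ, rfl⟩
  have hQ' : Q ∈ M := hQ
  have hY' : ∀ P ∈ M, θ P = P → ∀ ξ, φ.gnsStarAlgHom P (Y ξ) = Y (φ.gnsStarAlgHom P ξ) :=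
    fun P hP hP' ξ => congrArg (fun X => X ξ) (hY _ ⟨P, (hM' P).2 ⟨hP, hP'⟩, rfl⟩)
  refine ContinuousLinearMap.ext fun ξ => ?_
  -- Q + θQ is even, and (Q - θQ) D_n is a product of two odd elements, hence even; Y commutes with
  -- both.
  refine commutes_of_add_sub (R := θ Q)
    (hY' _ (add_mem hQ' (hM Q hQ')) (by rw [map_add, hθ, add_comm]) ξ)
    (commutes_of_weak_limit hm0 hlim ?_ ξ)
  filter_upwards [hFt hD] with n hn
  refine hY' _ (mul_mem (sub_mem hQ' (hM Q hQ')) hn) ?_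
  rw [map_mul, map_sub, hθ, hodd, mul_neg, ← neg_mul, neg_sub]

namespace JordanWigner

/-! Locality of the spin algebra -/

/-- Follows from c_j² = 0 and c_j c_j^* c_j = c_j. It leaves σ_x and σ_z as the only generators to
test in the locality argument. -/
theorem σy_eq (j : ℤ) : σy j = Complex.I • (σx j * σz j) := by
  have h2 : c j * c j = 0 := by
    have h := car_rel' j j
    rw [← two_smul ℂ] at h
    exact (smul_eq_zero.1 h).resolve_left two_ne_zero
  have h3 : star (c j) * star (c j) = 0 := by rw [← star_mul, h2, star_zero]
  have h1 : c j * (star (c j) * c j) = c j := by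
    have h := congrArg (fun Q => Q * c j) (car_rel j j)
    simp only [if_true, one_mul, add_mul, mul_assoc, h2, mul_zero, add_zero] at h
    exact h
  have h4 : (c j + star (c j)) * σz j = c j - star (c j) := by
    rw [σz, mul_sub, mul_one, mul_smul_comm, add_mul, h1, ← mul_assoc, h3, zero_mul, add_zero,
      two_smul]
    abel
  rw [σy, σx, mul_assoc (T * S j : Op), h4]

theorem shift_mul_σx (j : ℤ) : (shiftOp : Op) * σx j = σx (j + 1) * shiftOp := by
  rw [← τ_one_σx, τ, zpow_one, Unitary.conjStarAlgAut_apply, mul_assoc _ _ (shiftOp : Op),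
    Unitary.star_mul_self_of_mem shiftOp.2, mul_one]

theorem σx_one_apply (v : Space) (p : Config) : σx 1 v p = v (symmDiff p.1 {1}, !p.2) := by
  have h : σx 1 v p = (T : Op) ((c 1 + star (c 1)) v) p := by rw [σx_one]; rfl
  have h1 : p.1.filter (· < 1) = p.1.filter (· ≤ 0) := by
    ext k; simp only [Finset.mem_filter]; constructor <;> rintro ⟨h, h'⟩ <;> exact ⟨h, by omega⟩
  rw [h, T_apply, Op.add_apply, c_apply, star_c_apply]
  simp only [h1]
  have h2 := neg_one_pow_mul_self (p.1.filter (· ≤ 0)).card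
  split_ifs
  · linear_combination v (symmDiff p.1 {1}, !p.2) * h2
  · linear_combination v (symmDiff p.1 {1}, !p.2) * h2

theorem shift_σx_apply (j : ℤ) (v : Space) (p : Config) :
    (if p.2 then -1 else 1) * σx j v (shift p) = σx (j + 1) ((shiftOp : Op) v) p := by
  rw [← shift_apply, ← Op.mul_apply, ← Op.mul_apply, shift_mul_σx]

theorem shift_symmDiff (j : ℤ) (p : Config) :
    shift (symmDiff p.1 {j + 1}, !p.2) = (symmDiff (shift p).1 {j}, !(shift p).2) := by
  ext k
  · simp [shift, Finset.mem_symmDiff]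
  · simp [shift]

/-- Up to a sign, `σ_x^{(j)}` changes the occupation of the site `j` and exchanges the copies. -/
theorem exists_σx_apply (j : ℤ) :
    ∃ κ : ℂ, ∀ (v : Space) (p : Config), σx j v p = κ * v (symmDiff p.1 {j}, !p.2) := by
  induction j using Int.inductionOn' (b := 1) with
  | zero => exact ⟨1, fun v p => by rw [σx_one_apply, one_mul]⟩
  | succ k _ ih =>
    obtain ⟨κ, hκ⟩ := ih
    -- `shiftOp` has opposite signs on the two copies and σ_x exchanges them, so each translation
    -- reverses the sign.
    refine ⟨-κ, fun v p => ?_⟩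
    obtain ⟨w, rfl⟩ : ∃ w, v = (shiftOp : Op) w := ⟨star (shiftOp : Op) v, by
      rw [← Op.mul_apply, Unitary.mul_star_self_of_mem shiftOp.2]; rfl⟩
    rw [← shift_σx_apply, hκ, shift_apply, shift_symmDiff]
    cases hp : p.2 <;> simp
  | pred k _ ih =>
    obtain ⟨κ, hκ⟩ := ih
    refine ⟨-κ, fun v q => ?_⟩
    obtain ⟨p, rfl⟩ := shift.surjective q
    have h := shift_σx_apply (k - 1) v p
    have h' := shift_symmDiff (k - 1) p
    rw [sub_add_cancel] at h h'
    rw [hκ, shift_apply, h'] at h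
    cases hp : p.2
    · simp only [hp] at h ⊢
      simpa using h
    · rw [hp] at h
      simp only [if_true, Bool.not_true, Bool.false_eq_true, if_false, one_mul] at h
      linear_combination -h

/-- Both operators are constant multiples of basis flips. This is where the strings T S_j undo
fermionic anticommutation. -/
theorem commute_σx_σx (j k : ℤ) : Commute (σx j) (σx k) := by
  obtain ⟨κ, hκ⟩ := exists_σx_apply j
  obtain ⟨μ, hμ⟩ := exists_σx_apply k
  refine Op.ext fun v p => ?_
  simp only [Op.mul_apply, hκ, hμ]
  rw [symmDiff_assoc, symmDiff_comm ({j} : Finset ℤ) {k}, ← symmDiff_assoc]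
  ring

theorem commute_σx_σz {j k : ℤ} (h : j ≠ k) : Commute (σx j) (σz k) := by
  obtain ⟨κ, hκ⟩ := exists_σx_apply j
  refine Op.ext fun v p => ?_
  simp only [Op.mul_apply, hκ, σz_apply]
  have h1 : k ∈ symmDiff p.1 {j} ↔ k ∈ p.1 := by simp [Finset.mem_symmDiff, h.symm]
  simp only [h1]
  ring

theorem τ_eq_of_τ_one {f : ℤ → Op} (hf : ∀ j, τ 1 (f j) = f (j + 1)) (k j : ℤ) :
    τ k (f j) = f (j + k) := by
  induction k using Int.induction_on with
  | zero => simp [τ]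
  | succ i ih => rw [add_comm (i : ℤ) 1, τ_add, ih, hf]; congr 1; ring
  | pred i ih =>
    have h := τ_neg_one (hf (j + (-i) - 1))
    rw [sub_add_cancel] at h
    rw [sub_eq_add_neg, add_comm, τ_add, ih, h]; congr 1; ring

theorem star_σx (j : ℤ) : star (σx j) = σx j := by
  have h := τ_eq_of_τ_one τ_one_σx (j - 1) 1
  rw [add_sub_cancel] at h
  have h1 : star (σx 1) = σx 1 := by
    rw [← coe_spinUnitary]; exact star_spinUnitary
  rw [← h, ← map_star, h1]

theorem star_σz (j : ℤ) : star (σz j) = σz j := by simp [σz]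

/-- Algebras with commuting generators commute if one set of generators is selfadjoint. -/
theorem commute_generatedBy {G₁ G₂ : Set Op} (h₂ : ∀ b ∈ G₂, star b = b)
    (h : ∀ a ∈ G₁, ∀ b ∈ G₂, Commute a b) {P Q : Op}
    (hP : P ∈ generatedBy G₁) (hQ : Q ∈ generatedBy G₂) : Commute P Q := by
  -- The centralizer of a *-closed set is a closed *-algebra. The argument is used twice: first
  -- against the generators G₂, then against the whole algebra generated by G₁.
  have key : ∀ {G G' : Set Op}, (∀ b ∈ G', star b ∈ G') → (∀ a ∈ G, ∀ b ∈ G', Commute a b) →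
      ∀ a ∈ generatedBy G, ∀ b ∈ G', Commute a b := by
    intro G G' hs hc
    have hle : generatedBy G ≤ StarSubalgebra.centralizer ℂ G' := by
      refine StarSubalgebra.topologicalClosure_minimal (StarAlgebra.adjoin_le fun a ha => ?_) ?_
      · rw [SetLike.mem_coe, StarSubalgebra.mem_centralizer_iff]
        exact fun g hg => ⟨(hc a ha g hg).eq.symm, (hc a ha _ (hs g hg)).eq.symm⟩
      · rw [StarSubalgebra.coe_centralizer]
        exact Set.isClosed_centralizer _
    intro a ha b hb
    exact ((StarSubalgebra.mem_centralizer_iff ℂ).1 (hle ha) b hb).1.symm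
  have h1 := key (fun b hb => (h₂ b hb).symm ▸ hb) h
  exact (key (G := G₂) (G' := generatedBy G₁) (fun b hb => star_mem hb)
    (fun a ha b hb => (h1 b hb a ha).symm) Q hQ P hP).symm

theorem spinAlgebraOn_le (Λ : Set ℤ) : spinAlgebraOn Λ ≤ generatedBy (σx '' Λ ∪ σz '' Λ) := by
  refine StarSubalgebra.topologicalClosure_minimal (StarAlgebra.adjoin_le ?_)
    (StarSubalgebra.isClosed_topologicalClosure _)
  have hx : ∀ j ∈ Λ, σx j ∈ generatedBy (σx '' Λ ∪ σz '' Λ) := fun j hj =>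
    mem_generatedBy (Or.inl ⟨j, hj, rfl⟩)
  have hz : ∀ j ∈ Λ, σz j ∈ generatedBy (σx '' Λ ∪ σz '' Λ) := fun j hj =>
    mem_generatedBy (Or.inr ⟨j, hj, rfl⟩)
  rintro _ ((⟨j, hj, rfl⟩ | ⟨j, hj, rfl⟩) | ⟨j, hj, rfl⟩)
  · exact hx j hj
  · rw [σy_eq]
    exact StarSubalgebra.smul_mem _ (mul_mem (hx j hj) (hz j hj)) _
  · exact hz j hj

/-- Observables localized in disjoint regions commute. -/
theorem commute_of_disjoint {Λ Λ' : Set ℤ} (hd : Disjoint Λ Λ') {P Q : Op}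
    (hP : P ∈ spinAlgebraOn Λ) (hQ : Q ∈ spinAlgebraOn Λ') : Commute P Q := by
  have hs : ∀ Λ : Set ℤ, ∀ a ∈ σx '' Λ ∪ σz '' Λ, star a = a := by
    rintro Λ _ (⟨j, -, rfl⟩ | ⟨j, -, rfl⟩)
    exacts [star_σx j, star_σz j]
  refine commute_generatedBy (hs Λ') ?_ (spinAlgebraOn_le Λ hP) (spinAlgebraOn_le Λ' hQ)
  rintro _ (⟨j, hj, rfl⟩ | ⟨j, hj, rfl⟩) _ (⟨k, hk, rfl⟩ | ⟨k, hk, rfl⟩)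
  · exact commute_σx_σx j k
  · exact commute_σx_σz (hd.ne_of_mem hj hk)
  · exact (commute_σx_σz (hd.ne_of_mem hj hk).symm).symm
  · exact σz_comm j k

theorem spinAlgebraOn_mono {Λ Λ' : Set ℤ} (h : Λ ⊆ Λ') : spinAlgebraOn Λ ≤ spinAlgebraOn Λ' :=
  StarSubalgebra.topologicalClosure_mono (StarAlgebra.adjoin_mono (by gcongr))

theorem spinAlgebraOn_le_spin (Λ : Set ℤ) : spinAlgebraOn Λ ≤ spinAlgebra :=
  spinAlgebraOn_mono (Set.subset_univ Λ)

instance (Λ : Set ℤ) : IsClosed (spinAlgebraOn Λ : Set Op) :=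
  inferInstanceAs (IsClosed (generatedBy _ : Set Op))

theorem σx_mem_on {Λ : Set ℤ} {j : ℤ} (hj : j ∈ Λ) : σx j ∈ spinAlgebraOn Λ :=
  mem_generatedBy (Or.inl (Or.inl ⟨j, hj, rfl⟩))
theorem σy_mem_on {Λ : Set ℤ} {j : ℤ} (hj : j ∈ Λ) : σy j ∈ spinAlgebraOn Λ :=
  mem_generatedBy (Or.inl (Or.inr ⟨j, hj, rfl⟩))
theorem σz_mem_on {Λ : Set ℤ} {j : ℤ} (hj : j ∈ Λ) : σz j ∈ spinAlgebraOn Λ :=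
  mem_generatedBy (Or.inr ⟨j, hj, rfl⟩)

theorem Θ_mem_on (Λ : Set ℤ) : ∀ Q ∈ spinAlgebraOn Λ, Θ Q ∈ spinAlgebraOn Λ :=
  conj_mem _ inferInstance (by
    rintro _ ((⟨j, hj, rfl⟩ | ⟨j, hj, rfl⟩) | ⟨j, hj, rfl⟩)
    · exact (Θ_σx j).symm ▸ neg_mem (σx_mem_on hj)
    · exact (Θ_σy j).symm ▸ neg_mem (σy_mem_on hj)
    · exact (Θ_σz j).symm ▸ σz_mem_on hj)

theorem τ_mem_on {Λ Λ' : Set ℤ} (k : ℤ) (h : ∀ j ∈ Λ, j + k ∈ Λ') :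
    ∀ Q ∈ spinAlgebraOn Λ, τ k Q ∈ spinAlgebraOn Λ' :=
  conj_mem _ inferInstance (by
    rintro _ ((⟨j, hj, rfl⟩ | ⟨j, hj, rfl⟩) | ⟨j, hj, rfl⟩)
    · exact (τ_eq_of_τ_one τ_one_σx k j).symm ▸ σx_mem_on (h j hj)
    · exact (τ_eq_of_τ_one τ_one_σy k j).symm ▸ σy_mem_on (h j hj)
    · exact (τ_eq_of_τ_one τ_one_σz k j).symm ▸ σz_mem_on (h j hj))

/-- The algebra of strictly local observables. -/
def localAlgebra : StarSubalgebra ℂ Op where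
  carrier := {Q | ∃ N : ℕ, Q ∈ spinAlgebraOn (Set.Icc (-N) N)}
  mul_mem' := by
    rintro P Q ⟨N, hP⟩ ⟨M, hQ⟩
    exact ⟨max N M, mul_mem
      (spinAlgebraOn_mono (Set.Icc_subset_Icc (by simp) (by simp)) hP)
      (spinAlgebraOn_mono (Set.Icc_subset_Icc (by simp) (by simp)) hQ)⟩
  add_mem' := by
    rintro P Q ⟨N, hP⟩ ⟨M, hQ⟩
    exact ⟨max N M, add_mem
      (spinAlgebraOn_mono (Set.Icc_subset_Icc (by simp) (by simp)) hP)
      (spinAlgebraOn_mono (Set.Icc_subset_Icc (by simp) (by simp)) hQ)⟩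
  algebraMap_mem' r := ⟨0, algebraMap_mem _ r⟩
  star_mem' := by
    rintro P ⟨N, hP⟩
    exact ⟨N, star_mem hP⟩

theorem dense_local : Dense {Q : spinAlgebra | (Q : Op) ∈ localAlgebra} := by
  have hle : spinAlgebra ≤ localAlgebra.topologicalClosure := by
    refine StarSubalgebra.topologicalClosure_mono (StarAlgebra.adjoin_le ?_)
    have hj : ∀ j : ℤ, j ∈ Set.Icc (-(j.natAbs : ℤ)) j.natAbs := fun j => by
      constructor <;> omega
    rintro _ ((⟨j, -, rfl⟩ | ⟨j, -, rfl⟩) | ⟨j, -, rfl⟩)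
    · exact ⟨j.natAbs, σx_mem_on (hj j)⟩
    · exact ⟨j.natAbs, σy_mem_on (hj j)⟩
    · exact ⟨j.natAbs, σz_mem_on (hj j)⟩
  intro Q
  rw [closure_subtype]
  have h1 : (Q : Op) ∈ closure (localAlgebra : Set Op) := hle Q.2
  refine closure_mono (fun P hP => ?_) h1
  obtain ⟨N, hN⟩ := hP
  exact ⟨⟨P, spinAlgebraOn_le_spin _ hN⟩, ⟨N, hN⟩, rfl⟩

end JordanWigner

/-! ### Application to the CAR algebra and the spin chain -/

namespace JordanWigner

/-- T commutes with the parity operator, so Θ_- preserves the grading. -/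
theorem ΘmEven_P (Q : carAlgebra) : gradedCar.P (ΘmCar Q) = ΘmEven (gradedCar.P Q) := by
  refine gradedCar.eq_of_two_smul ?_
  have h1 : gradedCar.ι (ΘmEven (gradedCar.P Q)) = ΘmCar (gradedCar.ι (gradedCar.P Q)) := rfl
  rw [gradedCar.ι_P, h1, ← map_smul, gradedCar.ι_P, map_add]
  congr 1
  refine Subtype.ext ?_
  have h2 : parityOp * T = T * parityOp := Subtype.ext parity_mul_T
  change (Θ * Θm) (Q : Op) = (Θm * Θ) (Q : Op)
  rw [Θ, Θm, ← map_mul, ← map_mul, h2]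

section

variable {ψ : carAlgebra →ₚ[ℂ] ℂ}

theorem eq_evenRestriction_comp_P (hΘ : pullback ψ ΘCar = ψ) :
    ψ = (evenRestriction ψ).comp gradedCar.P :=
  gradedCar.eq_comp_P hΘ rfl

theorem isPureState_evenRestriction (hψ : IsPureState ψ) (hΘ : pullback ψ ΘCar = ψ) :
    IsPureState (evenRestriction ψ) :=
  gradedCar.isPureState_of_comp_P (by rwa [← eq_evenRestriction_comp_P hΘ])

/-- Purity of ψ, read off on the even part; this is the obstruction used in case (ii). -/
theorem not_repEquiv_car (hψ : IsPureState ψ) (hΘ : pullback ψ ΘCar = ψ) :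
    ¬ RepEquiv (evenRestriction ψ).gnsStarAlgHom
      ((evenRestriction ψ).gnsStarAlgHom.comp gradedCar.β) :=
  gradedCar.not_repEquiv_of_isPureState (by rwa [← eq_evenRestriction_comp_P hΘ])

/-- If `ψ_+` and `ψ_+ ∘ Ad σ_x^{(1)}` are equivalent, so are `ψ` and `ψ ∘ Θ_-`. -/
theorem unitarilyEquivalent_of_repEquiv_spin (hψ : IsPureState ψ) (hΘ : pullback ψ ΘCar = ψ)
    (h : RepEquiv (evenRestriction ψ).gnsStarAlgHom
      ((evenRestriction ψ).gnsStarAlgHom.comp gradedSpin.β)) :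
    UnitarilyEquivalent ψ (pullback ψ ΘmCar) := by
  rw [gradedSpin_β_eq] at h
  exact gradedCar.unitarilyEquivalent_comp_P hψ (eq_evenRestriction_comp_P hΘ) ΘmCar_surjective
    ΘmEven_P h

/-- If `ψ` and `ψ ∘ Θ_-` are equivalent but `ψ_+` and `ψ_+ ∘ Θ_-` are not, then `ψ_+` and
`ψ_+ ∘ Ad σ_x^{(1)}` are equivalent. -/
theorem repEquiv_spin (hψ : IsPureState ψ) (hΘ : pullback ψ ΘCar = ψ)
    (h : UnitarilyEquivalent ψ (pullback ψ ΘmCar))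
    (hne : ¬ UnitarilyEquivalent (evenRestriction ψ) (pullback (evenRestriction ψ) ΘmEven)) :
    RepEquiv (evenRestriction ψ).gnsStarAlgHom
      ((evenRestriction ψ).gnsStarAlgHom.comp gradedSpin.β) := by
  rw [gradedSpin_β_eq]
  exact gradedCar.repEquiv_of_unitarilyEquivalent (isPureState_evenRestriction hψ hΘ) rfl
    ΘmEven_surjective ΘmCar_ι h hne

theorem isExtension_comp_P (ω : evenPart carAlgebra →ₚ[ℂ] ℂ) :
    IsExtension (ω.comp gradedSpin.P) ω :=
  gradedSpin.pullback_comp_P_ι ω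

/-- The `Θ`-invariant extension of `ψ_+` to the spin algebra. -/
theorem exists_invariant_extension (hψ : IsPureState ψ) (hΘ : pullback ψ ΘCar = ψ)
    (hne : ¬ RepEquiv (evenRestriction ψ).gnsStarAlgHom
      ((evenRestriction ψ).gnsStarAlgHom.comp gradedSpin.β)) :
    ∃ φ : spinAlgebra →ₚ[ℂ] ℂ,
      (IsState φ ∧ pullback φ ΘSpin = φ ∧ IsExtension φ (evenRestriction ψ)) ∧
      (∀ φ' : spinAlgebra →ₚ[ℂ] ℂ, IsState φ' → pullback φ' ΘSpin = φ' →
        IsExtension φ' (evenRestriction ψ) → φ' = φ) ∧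
      IsPureState φ ∧ (TranslationInvariantCar ψ → TranslationInvariantSpin φ) := by
  have hp := isPureState_evenRestriction hψ hΘ
  refine ⟨(evenRestriction ψ).comp gradedSpin.P,
    ⟨gradedSpin.isState_comp_P hp.isState, gradedSpin.pullback_comp_P_θ _, isExtension_comp_P _⟩,
    fun φ' _ h h' => gradedSpin.eq_comp_P h h', gradedSpin.isPureState_comp_P hp hne,
    fun ht j => ?_⟩
  -- The translate of φ is again a Θ-invariant extension of ψ_+, so uniqueness applies.
  refine gradedSpin.eq_comp_P ?_ ?_
  · ext Q
    have h1 : τSpin j (gradedSpin.θ Q) = gradedSpin.θ (τSpin j Q) :=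
      Subtype.ext (Θ_τ j Q).symm
    rw [pullback_apply, pullback_apply, h1]
    exact congrArg (evenRestriction ψ) (gradedSpin.P_θ _)
  · ext Q
    have h1 : τSpin j (gradedSpin.ι Q) = gradedSpin.ι (τEven j Q) := rfl
    rw [pullback_apply, pullback_apply, h1]
    change evenRestriction ψ (gradedSpin.P _) = _
    rw [gradedSpin.P_ι, ← pullback_apply, evenRestriction_τEven ht]

end

theorem gradedSpin_ι : gradedSpin.ι = evenToSpin := rfl

theorem gradedSpin_θ : gradedSpin.θ = ΘSpin := rfl

theorem τSpin_ι (j : ℤ) (Q : evenPart carAlgebra) :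
    τSpin j (gradedSpin.ι Q) = gradedSpin.ι (τEven j Q) := rfl

theorem θ_τSpin (j : ℤ) (Q : spinAlgebra) :
    gradedSpin.θ (τSpin j Q) = τSpin j (gradedSpin.θ Q) := Subtype.ext (Θ_τ j Q)

/-- The translation τ_1 may act on φ with sign -1 on odd elements; only its square is certain to fix
φ. -/
theorem pullback_τSpin_two {ψ : carAlgebra →ₚ[ℂ] ℂ} (hp : IsPureState (evenRestriction ψ))
    {φ : spinAlgebra →ₚ[ℂ] ℂ} (hι : IsExtension φ (evenRestriction ψ))
    (U : (evenRestriction ψ).GNS ≃ₗᵢ[ℂ] φ.GNS)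
    (hU : U (gnsVector (evenRestriction ψ)) = gnsVector φ)
    (hU' : ∀ a ξ, U ((evenRestriction ψ).gnsStarAlgHom a ξ) =
      φ.gnsStarAlgHom (evenToSpin a) (U ξ)) (ht : TranslationInvariantCar ψ) :
    pullback φ (τSpin 2) = φ := by
  refine PositiveLinearMap.ext fun Q => ?_
  have h1 : τSpin 2 Q = τSpin 1 (τSpin 1 Q) := Subtype.ext (τ_add 1 1 Q)
  rw [pullback_apply, h1]
  rw [IsExtension, ← gradedSpin_ι] at hι
  rw [← gradedSpin_ι] at hU'
  exact gradedSpin.pullback_sq hp hι U hU hU' (τSpin_ι 1) (θ_τSpin 1) (τEven_surjective 1)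
    (evenRestriction_τEven ht 1) Q

/-! ### Half-chain von Neumann algebras -/

section HalfChain

variable {φ : spinAlgebra →ₚ[ℂ] ℂ}

/-- A state of the spin algebra that is not `Θ`-invariant does not vanish on the odd local
observables. -/
theorem exists_odd_local (hφ : pullback φ ΘSpin ≠ φ) :
    ∃ (N : ℕ) (Q : spinAlgebra), (Q : Op) ∈ spinAlgebraOn (Set.Icc (-N) N) ∧
      ΘSpin Q = -Q ∧ φ Q ≠ 0 := by
  by_contra! h
  refine hφ (DFunLike.coe_injective ?_)
  have hΘc : Continuous ΘSpin := by
    refine Continuous.subtype_mk ?_ _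
    exact (continuous_conj parityOp).comp continuous_subtype_val
  have hφc : Continuous φ := map_continuous φ
  refine Continuous.ext_on dense_local (hφc.comp hΘc) hφc fun Q hQ => ?_
  obtain ⟨N, hN⟩ := hQ
  have hΘ2 : ΘSpin (ΘSpin Q) = Q := Subtype.ext (Θ_Θ Q)
  -- Θ(Q) - Q is odd and has the same support; if φ vanished on all such elements, it would be
  -- invariant on a dense set, hence everywhere.
  have h1 := h N (ΘSpin Q - Q) (sub_mem (Θ_mem_on _ _ hN) hN) (by
    rw [map_sub, hΘ2, neg_sub])
  rw [map_sub] at h1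
  exact sub_eq_zero.1 h1

theorem ΘSpin_ΘSpin (Q : spinAlgebra) : ΘSpin (ΘSpin Q) = Q := Subtype.ext (Θ_Θ Q)

theorem pullback_τSpin_even (h : pullback φ (τSpin 2) = φ) (k : ℤ) (Q : spinAlgebra) :
    φ (τSpin (2 * k) Q) = φ Q := by
  have htwo : ∀ Q, φ (τSpin 2 Q) = φ Q := fun Q =>
    congrArg (fun f : spinAlgebra →ₚ[ℂ] ℂ => f Q) h
  induction k using Int.induction_on generalizing Q with
  | zero => exact congrArg φ (Subtype.ext (by simp [τSpin, restrictTo, τ]))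
  | succ i ih =>
    have h1 : τSpin (2 * (i + 1)) Q = τSpin 2 (τSpin (2 * i) Q) := Subtype.ext (by
      change τ _ (Q : Op) = τ 2 (τ _ (Q : Op))
      rw [← τ_add]; congr 2; ring)
    rw [h1, htwo, ih]
  | pred i ih =>
    have h1 : τSpin 2 (τSpin (2 * (-i - 1)) Q) = τSpin (2 * -i) Q := Subtype.ext (by
      change τ 2 (τ _ (Q : Op)) = τ _ (Q : Op)
      rw [← τ_add]; congr 2; ring)
    rw [← htwo, h1, ih]

/-- The half chain algebras of a pure `τ_2`-invariant state that is not `Θ`-invariant. -/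
theorem spinBicommutant_halfChain (hs : IsState φ) (hi : IrreducibleRep φ.gnsStarAlgHom)
    (hφ : pullback φ ΘSpin ≠ φ) (hτ : pullback φ (τSpin 2) = φ) {Λ : Set ℤ} {ε : ℤ}
    (hε : ε = 1 ∨ ε = -1)
    (hΛ : ∀ N : ℕ, ∀ᶠ n : ℕ in Filter.atTop,
      ∀ j ∈ Set.Icc (-N : ℤ) N, j + 2 * (ε * n) ∈ Λ) :
    spinBicommutant φ (spinAlgebraOn Λ) = spinBicommutant φ (evenPart (spinAlgebraOn Λ)) := by
  obtain ⟨N, Q, hQ, hodd, h0⟩ := exists_odd_local hφ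
  have hoddQ : Θ (Q : Op) = -Q := congrArg Subtype.val hodd
  refine gnsBicommutant_eq_even hs hi (θ := ΘSpin) ΘSpin_ΘSpin
    (M := (spinAlgebraOn Λ).comap spinAlgebra.subtype) (fun P hP => Θ_mem_on Λ P hP)
    (fun P => ⟨fun hP => ⟨hP.1, Subtype.ext hP.2⟩, fun hP => ⟨hP.1, congrArg Subtype.val hP.2⟩⟩)
    (fun n => τSpin (2 * (ε * n)) Q) (C := ‖Q‖)
    (fun n => NonUnitalStarAlgHom.norm_apply_le (τSpin (2 * (ε * n))) Q) (fun n => ?_) ?_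
    dense_local (fun P hP => ?_) (fun n => pullback_τSpin_even hτ (ε * n) Q) h0
  · refine Subtype.ext ?_
    change Θ (τ _ (Q : Op)) = -τ _ (Q : Op)
    rw [Θ_τ, hoddQ, map_neg]
  · filter_upwards [hΛ N] with n hn
    exact τ_mem_on _ hn _ hQ
  · obtain ⟨M, hM⟩ := hP
    -- Disjointness from [-M, M] needs only 2n > N + M, which this bound ensures in either
    -- direction.
    filter_upwards [Filter.eventually_gt_atTop (N + M)] with n hn
    refine Subtype.ext (commute_of_disjoint (Λ := Set.Icc (-N + 2 * (ε * n)) (N + 2 * (ε * n)))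
      ?_ (τ_mem_on _ (fun j hj => Set.mem_Icc.2 ⟨by linarith [hj.1], by linarith [hj.2]⟩) _ hQ)
      (star_mem hM))
    rw [Set.disjoint_left]
    rintro j ⟨h1, h2⟩ ⟨h3, h4⟩
    rcases hε with rfl | rfl <;> omega

end HalfChain

/-- The non-invariant extension of `ψ_+` to the spin algebra. -/
theorem exists_noninvariant_extension {ω : evenPart carAlgebra →ₚ[ℂ] ℂ} (hp : IsPureState ω)
    (he : RepEquiv ω.gnsStarAlgHom (ω.gnsStarAlgHom.comp gradedSpin.β)) :
    ∃ φ : spinAlgebra →ₚ[ℂ] ℂ, IsState φ ∧ IsExtension φ ω ∧ pullback φ ΘSpin ≠ φ ∧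
      ∃ U : ω.GNS ≃ₗᵢ[ℂ] φ.GNS, U (gnsVector ω) = gnsVector φ ∧
        ∀ a ξ, U (ω.gnsStarAlgHom a ξ) = φ.gnsStarAlgHom (evenToSpin a) (U ξ) := by
  have h := gradedSpin.exists_extension_of_equiv hp he
  rw [gradedSpin_ι, gradedSpin_θ] at h
  exact h

/-- On the GNS space of φ, the even part acts as in the GNS representation of the pure state ω. -/
theorem irreducible_of_intertwiner {ω : evenPart carAlgebra →ₚ[ℂ] ℂ} (hp : IsPureState ω)
    {φ : spinAlgebra →ₚ[ℂ] ℂ} (U : ω.GNS ≃ₗᵢ[ℂ] φ.GNS)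
    (hU : ∀ a ξ, U (ω.gnsStarAlgHom a ξ) = φ.gnsStarAlgHom (evenToSpin a) (U ξ)) :
    IrreducibleRep (φ.gnsStarAlgHom.comp gradedSpin.ι) := by
  rw [gradedSpin_ι]
  exact hp.irreducible.of_equiv ⟨U, hU⟩

theorem spinBicommutant_even_eq {φ : spinAlgebra →ₚ[ℂ] ℂ}
    (hi : IrreducibleRep (φ.gnsStarAlgHom.comp gradedSpin.ι)) :
    spinBicommutant φ spinAlgebra = spinBicommutant φ (evenPart spinAlgebra) :=
  gradedSpin.gnsBicommutant_eq hi (fun Q _ => Q.2) fun a =>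
    mem_evenPart.2 ⟨(gradedSpin.ι a).2, (mem_evenPart.1 a.2).2⟩

theorem halfChains {φ : spinAlgebra →ₚ[ℂ] ℂ} (hs : IsState φ)
    (hi : IrreducibleRep φ.gnsStarAlgHom) (hθ : pullback φ ΘSpin ≠ φ)
    (hτ : pullback φ (τSpin 2) = φ) :
    spinBicommutant φ (spinAlgebraOn (Set.Iic 0)) =
        spinBicommutant φ (evenPart (spinAlgebraOn (Set.Iic 0))) ∧
      spinBicommutant φ (spinAlgebraOn (Set.Ici 1)) =
        spinBicommutant φ (evenPart (spinAlgebraOn (Set.Ici 1))) := by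
  refine ⟨spinBicommutant_halfChain hs hi hθ hτ (Or.inr rfl) fun N => ?_,
    spinBicommutant_halfChain hs hi hθ hτ (Or.inl rfl) fun N => ?_⟩
  · filter_upwards [Filter.eventually_ge_atTop N] with n hn j hj
    have := hj.2
    simp only [Set.mem_Iic]
    omega
  -- The inequality is strict because the right half chain starts at 1: with N = n = 0, site 0 would
  -- not have moved into it.
  · filter_upwards [Filter.eventually_gt_atTop N] with n hn j hj
    have := hj.1
    simp only [Set.mem_Ici]
    omega

/-- The equivalence ω ∼ ω ∘ Θ_- cancels Θ_- from ω ∼ ω ∘ Θ_- ∘ β, leaving ω ∼ ω ∘ β, which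
contradicts purity of ψ. -/
theorem not_repEquiv_spin {ψ : carAlgebra →ₚ[ℂ] ℂ} (hψ : IsPureState ψ)
    (hΘ : pullback ψ ΘCar = ψ)
    (h : UnitarilyEquivalent (evenRestriction ψ) (pullback (evenRestriction ψ) ΘmEven)) :
    ¬ RepEquiv (evenRestriction ψ).gnsStarAlgHom
      ((evenRestriction ψ).gnsStarAlgHom.comp gradedSpin.β) := fun he => by
  refine not_repEquiv_car hψ hΘ ?_
  rw [gradedSpin_β_eq] at he
  exact repEquiv_comp_of_unitarilyEquivalent ΘmEven_surjective h he

end JordanWigner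

end

theorem mainTheorem7 (ψ : carAlgebra →ₚ[ℂ] ℂ) (hψ : IsPureState ψ)
    (hΘ : pullback ψ ΘCar = ψ) :
    -- (i)
    (¬ UnitarilyEquivalent ψ (pullback ψ ΘmCar) →
      ∃ φ : spinAlgebra →ₚ[ℂ] ℂ,
        (IsState φ ∧ pullback φ ΘSpin = φ ∧ IsExtension φ (evenRestriction ψ)) ∧
        (∀ φ' : spinAlgebra →ₚ[ℂ] ℂ, IsState φ' → pullback φ' ΘSpin = φ' →
          IsExtension φ' (evenRestriction ψ) → φ' = φ) ∧
        IsPureState φ ∧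
        (TranslationInvariantCar ψ → TranslationInvariantSpin φ)) ∧
    -- (ii)
    (UnitarilyEquivalent ψ (pullback ψ ΘmCar) →
      UnitarilyEquivalent (evenRestriction ψ) (pullback (evenRestriction ψ) ΘmEven) →
      ∃ φ : spinAlgebra →ₚ[ℂ] ℂ,
        (IsState φ ∧ pullback φ ΘSpin = φ ∧ IsExtension φ (evenRestriction ψ)) ∧
        (∀ φ' : spinAlgebra →ₚ[ℂ] ℂ, IsState φ' → pullback φ' ΘSpin = φ' →
          IsExtension φ' (evenRestriction ψ) → φ' = φ) ∧
        IsPureState φ ∧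
        (TranslationInvariantCar ψ → TranslationInvariantSpin φ)) ∧
    -- (iii)
    (UnitarilyEquivalent ψ (pullback ψ ΘmCar) →
      ¬ UnitarilyEquivalent (evenRestriction ψ) (pullback (evenRestriction ψ) ΘmEven) →
      ∃ φ : spinAlgebra →ₚ[ℂ] ℂ,
        IsPureState φ ∧ IsExtension φ (evenRestriction ψ) ∧ pullback φ ΘSpin ≠ φ ∧
        (∃ U : (evenRestriction ψ).GNS ≃ₗᵢ[ℂ] φ.GNS,
          U (gnsVector (evenRestriction ψ)) = gnsVector φ ∧
          ∀ (Q : evenPart carAlgebra) (ξ : (evenRestriction ψ).GNS),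
            U ((evenRestriction ψ).gnsStarAlgHom Q ξ) = φ.gnsStarAlgHom (evenToSpin Q) (U ξ)) ∧
        spinBicommutant φ spinAlgebra = spinBicommutant φ (evenPart spinAlgebra) ∧
        (TranslationInvariantCar ψ →
          pullback φ (τSpin 2) = φ ∧
          spinBicommutant φ (spinAlgebraOn (Set.Iic 0)) =
            spinBicommutant φ (evenPart (spinAlgebraOn (Set.Iic 0))) ∧
          spinBicommutant φ (spinAlgebraOn (Set.Ici 1)) =
            spinBicommutant φ (evenPart (spinAlgebraOn (Set.Ici 1))))) := by
  have hp := isPureState_evenRestriction hψ hΘ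
  refine ⟨fun h => ?_, fun _ h => ?_, fun h h' => ?_⟩
  · exact exists_invariant_extension hψ hΘ fun he =>
      h (unitarilyEquivalent_of_repEquiv_spin hψ hΘ he)
  · exact exists_invariant_extension hψ hΘ (not_repEquiv_spin hψ hΘ h)
  · obtain ⟨φ, hs, hι, hθ, U, hU, hU'⟩ :=
      exists_noninvariant_extension hp (repEquiv_spin hψ hΘ h h')
    have hiE := irreducible_of_intertwiner hp U hU'
    have hi := gradedSpin.irreducible_of_even hiE
    refine ⟨φ, isPureState_of_irreducible hs hi, hι, hθ, ⟨U, hU, hU'⟩,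
      spinBicommutant_even_eq hiE, fun ht => ?_⟩
    have hτ := pullback_τSpin_two hp hι U hU hU' ht
    exact ⟨hτ, halfChains hs hi hθ hτ⟩
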